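/- **Setting.** Let $u_0$ be a random initial state in $\mathbb R^d$, let $w_0,w_1,\dots$ be driving noises ($w_n$ acting on the time interval $[n,n+1]$, e.g. the increments of a Wiener process), and let $\eta_1,\eta_2,\dots\sim N(0,\Gamma)$ with $\Gamma\in\mathbb R^{d_O\times d_O}$ positive definite, all independent. Let $\mathcal F_n$ be the completed $\sigma$-algebra generated by $u_0,w_0,\dots,w_{n-1},\eta_1,\dots,\eta_n$, and let $L^p_n$ be the space of $\mathcal F_n$-measurable $u:\Omega\to\mathbb R^d$ with $\|u\|_p=\mathbb E[|u|^p]^{1/p}<\infty$. Let $\Psi_n(u)=\Psi_n(u,w_n)$ be the random maps of the dynamics $u_{n+1}=\Psi_n(u_n)$, let $\Psi_n^N(u)=\Psi^N_n(u,w_n)$, $N\in\mathbb N$, be numerical solvers (with $\Psi^\infty_n=\Psi_n$), $H\in\mathbb R^{d_O\times d}$, and let $y_1,y_2,\dots\in\mathbb R^{d_O}$ be given non-random observations. For a covariance matrix $C$ put $K(C)=CH^{\mathsf T}(HCH^{\mathsf T}+\Gamma)^{-1}$. **Mean-field EnKF.** $\bar\mu_0$ is the law of $u_0$. Given $\bar\mu_n$,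 let $\hat v\sim\bar\mu_n$ be independent of $w_n$, $\bar v=\Psi_n(\hat v)$, $\bar K_{n+1}=K(\mathrm{Cov}(\bar v))$; then $\bar\mu_{n+1}$ is the law of $(I-\bar K_{n+1}H)\bar v+\bar K_{n+1}(y_{n+1}+\eta)$ with $\eta\sim N(0,\Gamma)$ independent of $\bar v$. **EnKF and MLEnKF.** With resolution $N$ and ensemble size $P$, EnKF starts from $P$ independent copies of $u_0$, moves each particle by $v_{n+1,i}=\Psi^N_n(\hat v_{n,i})$ with its own independent driving noise, and sets $\hat v_{n+1,i}=(I-KH)v_{n+1,i}+K(y_{n+1}+\eta_{n+1,i})$, where $K=K(C)$, $C$ is the biased sample covariance of $v_{n+1,1},\dots,v_{n+1,P}$, and $\eta_{n+1,i}\sim N(0,\Gamma)$ are independent; $\mu_n^{N,P}[\varphi]=P^{-1}\sum_i\varphi(\hat v_{n,i})$. For $P_\ell=2P_{\ell-1}$, a coupled sample on level $\ell\ge1$ is $\mu^{\ell,\mathbf f}_n[\varphi]-\mu^{\ell,\mathbf c}_n[\varphi]$, where $\mu^{\ell,\mathbf f}_n=\mu_n^{N_\ell,P_\ell}$ and $\mu^{\ell,\mathbf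 c}_n$ is the average of two EnKF measures with parameters $N_{\ell-1},P_{\ell-1}$, which use the initial states, driving noises and observation perturbations of the first, respectively the second, $P_{\ell-1}$ fine particles; $\mu_n^{0,\mathbf c}=0$. The MLEnKF estimator is $$\mu^{\mathrm{ML}}_n[\varphi]=\sum_{\ell=0}^L\frac1{M_\ell}\sum_{m=1}^{M_\ell}\big(\mu_n^{\ell,\mathbf f,m}[\varphi]-\mu_n^{\ell,\mathbf c,m}[\varphi]\big),$$ all samples over $(\ell,m)$ being independent, and $\mathrm{Cost}(\mathrm{MLEnKF})=\sum_{\ell=0}^LM_\ell N_\ell P_\ell$. **Assumption 1** (with $\alpha>0$ and a set $\mathbb F$ of observables). $u_0\in\bigcap_{p\ge2}L^p_0$, and for every $n\ge0$: (i) for each $p\ge2$ there is $c$ with $\|\Psi^N_n(u)\|_p\le c(1+\|u\|_p)$ for all $N\in\mathbb N$, $u\in\bigcap_{q\ge2}L^q_n$; (ii) $\mathbb F\subset C^2_P(\mathbb R^d,\mathbb R)$ (twice continuously differentiable, derivatives up to order two of polynomial growth) contains all polynomials of degree at most two and, with $\varphi$, also every function $x\mapsto\mathbb E[\varphi((I-\bar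 K_nH)x+\bar K_n(y_n+\eta))]$, $\eta\sim N(0,\Gamma)$, $n\ge1$; and whenever $u,u^N\in\bigcap_{q\ge2}L^q_n$ satisfy $|\mathbb E[\varphi(u^N)-\varphi(u)]|\le c_\varphi N^{-\alpha}$ for all $N\ge 1$, $\varphi\in\mathbb F$, then $|\mathbb E[\varphi(\Psi^N_n(u^N))-\varphi(\Psi_n(u))]|\le\tilde c_\varphi N^{-\alpha}$ for all $N\ge 1$, $\varphi\in\mathbb F$; (iii) for each $p\ge2$ there is $c$ with $\|\Psi^N_n(u)-\Psi^N_n(v)\|_p\le c\|u-v\|_p$ for all $N\in\mathbb N$, $u,v\in\bigcap_{q\ge2}L^q_n$; (iv) there is $c$ such that evaluating $\Psi^N_n(u)$ costs almost surely at most $cN$, for all $N\in\mathbb N$, $u\in\bigcap_{q\ge2}L^q_n$. **Assumption 2** (with $\beta>0$). Almost surely $\Psi_n$ and $\Psi^N_n$ are $C^2$ in the state. For every exponentially growing sequence $\{N_\ell\}\subset\mathbb N$ (i.e. $N_\ell\eqsim2^{r\ell}$ for some $r>0$), all $n\ge0$ and $p\ge2$ there is $c$ such that for all $\ell\in\mathbb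 N_0\cup\{\infty\}$ (with $N_\infty=\infty$): $\|\partial^\kappa\Psi^{N_\ell}_n(u)\|_p\le c(1+\|u\|_p)$ for $|\kappa|_1\le1$, $u\in L^p_n$; $\|\partial^\kappa\Psi^{N_\ell}_n(u)\|_p\le c(1+\|u\|_{2p})$ for $|\kappa|_1=2$, $u\in L^{2p}_n$; and, for $\ell<\infty$, $\|\partial^\kappa\Psi^{N_{\ell+1}}_n(u)-\partial^\kappa\Psi^{N_\ell}_n(u)\|_p\le c(1+\|u\|_p)N_\ell^{-\beta/2}$ for $|\kappa|_1\le1$, $u\in L^p_n$. **Corollary 2.** Let Assumptions 1 and 2 hold. For $\epsilon,s>0$ let $r_s=\min(1,(1+\beta s)/2,\alpha s)$, $L=\lceil\log_2(\epsilon^{-1})/r_s\rceil$ (and $L=0$ if $\epsilon>1$), $P_{\ell+1}=2P_\ell$, $P_\ell\eqsim2^\ell$, $N_\ell\eqsim2^{s\ell}$ and, for $\ell\le L$, $$M_\ell\eqsim\begin{cases}\epsilon^{-2}\,2^{-\frac{3+2s+\min(\beta s,1)}3\ell}+1&\text{if }\min(\beta s,1)>s,\\ \epsilon^{-2}L^2\,2^{-(1+s)\ell}+1&\text{if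 }\min(\beta s,1)=s,\\ \epsilon^{-2-\frac{2(s-\min(\beta s,1))}{3r_s}}\,2^{-\frac{3+2s+\min(\beta s,1)}3\ell}+1&\text{if }\min(\beta s,1)<s.\end{cases}$$ Then for all $\varphi\in\mathbb F$, $n\ge0$, $p\ge2$, the function $\varphi$ is $\bar\mu_n$-integrable and $$\|\mu^{\mathrm{ML}}_n[\varphi]-\bar\mu_n[\varphi]\|_p\lesssim\epsilon\qquad\text{for all }\epsilon>0,$$ with a constant depending on the given problem, on $s,\varphi,n,p$ and on the constants implied in $\eqsim$, but not on $\epsilon,\{M_\ell\},\{N_\ell\},\{P_\ell\}$. Moreover, if $$s\in\begin{cases}[\alpha^{-1},1)&\text{if }\beta>1,\ \alpha>1,\\ [\alpha^{-1},1]&\text{if }(\beta>1,\ \alpha=1)\text{ or }(\beta=1,\ \alpha\ge1),\\ \{\alpha^{-1}\}&\text{if }(\beta\ge1,\ \alpha<1)\text{ or }(\beta<1,\ \alpha\le\beta),\\ \{(2\alpha-\beta)^{-1}\}&\text{if }\beta<1,\ \alpha>\beta,\end{cases}$$ then, for every $\epsilon_0\in(0,1)$ and uniformly over $\epsilon\in(0,\epsilon_0]$,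 $$\mathrm{Cost}(\mathrm{MLEnKF})\eqsim\begin{cases}\epsilon^{-2}&\text{if }\beta>1,\ \alpha>1,\\ \epsilon^{-2}|\log\epsilon|^3&\text{if }(\beta>1,\ \alpha=1)\text{ or }(\beta=1,\ \alpha\ge1),\\ \epsilon^{-(1+1/\alpha)}&\text{if }(\beta\ge1,\ \alpha<1)\text{ or }(\beta<1,\ \alpha\le\beta),\\ \epsilon^{-(2+(1-\beta)/\alpha)}&\text{if }\beta<1,\ \alpha>\beta,\end{cases}$$ and the accumulated cost of all solver evaluations made by the estimator up to a fixed time $n$ is almost surely bounded by a constant (depending also on $n$) times the same rate. -/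

import Mathlib

open MeasureTheory ProbabilityTheory
open scoped NNReal ENNReal Matrix

noncomputable section

namespace MLEnKF

/-- Euclidean space of column vectors. -/
abbrev Vec (d : ℕ) := EuclideanSpace ℝ (Fin d)

/-- The filtering problem together with its hierarchy of numerical solvers.
`exact n x w` is the random map `Ψ_n(x, ω)`, which depends on `ω` through the driving noise
`w = w_n(ω)` on the time interval `[n, n + 1]` (for an SDE: the increments of the Wiener process on
that interval; `𝓦` is then the path space and `noiseLaw n` the Wiener measure).
`solver n N` is `Ψ_n^N`; only resolutions `N ≥ 1` matter. `cost n N x w` is the computational cost of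
evaluating `Ψ_n^N(x, w)`. `y n` is the given (non-random) observation at time `n ≥ 1`. -/
structure FilterModel (d dO : ℕ) (𝓦 : Type*) [MeasurableSpace 𝓦] where
  initLaw : Measure (Vec d)
  noiseLaw : ℕ → Measure 𝓦
  exact : ℕ → Vec d → 𝓦 → Vec d
  solver : ℕ → ℕ → Vec d → 𝓦 → Vec d
  cost : ℕ → ℕ → Vec d → 𝓦 → ℝ≥0
  H : Matrix (Fin dO) (Fin d) ℝ
  Γ : Matrix (Fin dO) (Fin dO) ℝ
  y : ℕ → Vec dO
  posDef_Γ : Γ.PosDef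
  measurable_exact : ∀ n, Measurable fun q : Vec d × 𝓦 => exact n q.1 q.2
  measurable_solver : ∀ n N, Measurable fun q : Vec d × 𝓦 => solver n N q.1 q.2
  measurable_cost : ∀ n N, Measurable fun q : Vec d × 𝓦 => cost n N q.1 q.2

section Reference

variable {d dO : ℕ} {𝓦 : Type*} [MeasurableSpace 𝓦] {Ω : Type*} [MeasurableSpace Ω]

/-- The random inputs of the filtering problem on a probability space `(Ω, Pr)`: the initial
state `u₀`, the driving noises `w_n` and the observation noises `η_n ∼ N(0, Γ)`, all independent. -/
structure ReferenceNoise (M : FilterModel d dO 𝓦) (Pr : Measure Ω) where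
  u₀ : Ω → Vec d
  w : ℕ → Ω → 𝓦
  η : ℕ → Ω → Vec dO
  measurable_u₀ : Measurable u₀
  measurable_w : ∀ n, Measurable (w n)
  measurable_η : ∀ n, Measurable (η n)
  law_u₀ : Pr.map u₀ = M.initLaw
  law_w : ∀ n, Pr.map (w n) = M.noiseLaw n
  law_η : ∀ n, Pr.map (η n) = multivariateGaussian 0 M.Γ
  indep : iIndep
    (Sum.elim (fun _ : Unit => MeasurableSpace.comap u₀ inferInstance)
      (Sum.elim (fun n : ℕ => MeasurableSpace.comap (w n) inferInstance)
        (fun n : ℕ => MeasurableSpace.comap (η n) inferInstance))) Pr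

variable {M : FilterModel d dO 𝓦} {Pr : Measure Ω}

/-- The information at time `n`, generated by `u₀`, the driving noise on `[0, n]` and
`η_1, …, η_n` (null sets are added in `ReferenceNoise.MemLpAt`). -/
def ReferenceNoise.past (R : ReferenceNoise M Pr) (n : ℕ) : MeasurableSpace Ω :=
  MeasurableSpace.comap R.u₀ inferInstance
    ⊔ (⨆ k ∈ Finset.range n, MeasurableSpace.comap (R.w k) inferInstance)
    ⊔ (⨆ j ∈ Finset.Icc 1 n, MeasurableSpace.comap (R.η j) inferInstance)

/-- `u ∈ L^p_n(Ω, ℝ^d)`: measurable with respect to the completed information at time `n`, with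
finite `p`-th moment. -/
def ReferenceNoise.MemLpAt (R : ReferenceNoise M Pr) (n : ℕ) (p : ℝ) (u : Ω → Vec d) : Prop :=
  AEStronglyMeasurable[R.past n] u Pr ∧ MemLp u (ENNReal.ofReal p) Pr

/-- `u ∈ ⋂_{p ≥ 2} L^p_n(Ω, ℝ^d)`. -/
def ReferenceNoise.MemAllLpAt (R : ReferenceNoise M Pr) (n : ℕ) (u : Ω → Vec d) : Prop :=
  ∀ p : ℝ, 2 ≤ p → R.MemLpAt n p u

end Reference

section FunctionSpaces

variable {d : ℕ}

/-- The partial derivative `∂_{i_1} ⋯ ∂_{i_k} f` (component-wise for vector-valued `f`). -/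
def partialDeriv {k : ℕ} (i : Fin k → Fin d) (f : Vec d → Vec d) (x : Vec d) : Vec d :=
  iteratedFDeriv ℝ k f x fun j => EuclideanSpace.single (i j) (1 : ℝ)

/-- `φ ∈ C²_P(ℝ^d, ℝ)`: twice continuously differentiable, all derivatives up to order two having
polynomial growth. -/
def IsC2Poly (φ : Vec d → ℝ) : Prop :=
  ContDiff ℝ 2 φ ∧ ∃ (C : ℝ) (m : ℕ), ∀ k : ℕ, k ≤ 2 → ∀ x : Vec d,
    ‖iteratedFDeriv ℝ k φ x‖ ≤ C * (1 + ‖x‖) ^ m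

end FunctionSpaces

section Kalman

variable {d dO : ℕ} {𝓦 : Type*} [MeasurableSpace 𝓦]

/-- The Kalman gain `K = C Hᵀ (H C Hᵀ + Γ)⁻¹`. -/
def FilterModel.gain (M : FilterModel d dO 𝓦) (C : Matrix (Fin d) (Fin d) ℝ) :
    Matrix (Fin d) (Fin dO) ℝ :=
  C * M.Hᵀ * (M.H * C * M.Hᵀ + M.Γ)⁻¹

/-- The Kalman-type update `(I - K H) v + K ỹ` of a state `v`. -/
def FilterModel.assimilate (M : FilterModel d dO 𝓦) (K : Matrix (Fin d) (Fin dO) ℝ)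
    (v : Vec d) (yt : Vec dO) : Vec d :=
  Matrix.toEuclideanLin (1 - K * M.H) v + Matrix.toEuclideanLin K yt

/-- Covariance matrix of a distribution on `ℝ^d`. -/
def covMatrix (μ : Measure (Vec d)) : Matrix (Fin d) (Fin d) ℝ :=
  Matrix.of fun i j => covariance (fun x : Vec d => x i) (fun x : Vec d => x j) μ

/-- Mean-field prediction: the law of `Ψ_n(v, w_n)` for independent `v ∼ μ` and `w_n`. -/
def FilterModel.mfPredict (M : FilterModel d dO 𝓦) (n : ℕ) (μ : Measure (Vec d)) :
    Measure (Vec d) :=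
  (μ.prod (M.noiseLaw n)).map fun q => M.exact n q.1 q.2

/-- Mean-field update with the observation at time `n`: the law of
`(I - K H) v + K (y_n + η)` for independent `v ∼ μ` and `η ∼ N(0, Γ)`, the gain `K` being computed
from the covariance matrix of `μ`. -/
def FilterModel.mfUpdate (M : FilterModel d dO 𝓦) (n : ℕ) (μ : Measure (Vec d)) :
    Measure (Vec d) :=
  (μ.prod (multivariateGaussian 0 M.Γ)).map fun q =>
    M.assimilate (M.gain (covMatrix μ)) q.1 (M.y n + q.2)

/-- The mean-field EnKF updated measure at time `n`. -/
def FilterModel.mfMeasure (M : FilterModel d dO 𝓦) : ℕ → Measure (Vec d)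
  | 0 => M.initLaw
  | n + 1 => M.mfUpdate (n + 1) (M.mfPredict n (M.mfMeasure n))

/-- The deterministic mean-field Kalman gain at time `n + 1`. -/
def FilterModel.mfGain (M : FilterModel d dO 𝓦) (n : ℕ) : Matrix (Fin d) (Fin dO) ℝ :=
  M.gain (covMatrix (M.mfPredict n (M.mfMeasure n)))

/-- The observable `x ↦ E[φ((I - K̄ H) x + K̄ (y + η))]`, `η ∼ N(0, Γ)`, where `K̄` and `y` are the
mean-field gain and the observation at time `n + 1`. -/
def FilterModel.pullback (M : FilterModel d dO 𝓦) (n : ℕ) (φ : Vec d → ℝ) (x : Vec d) : ℝ :=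
  ∫ z, φ (M.assimilate (M.mfGain n) x (M.y (n + 1) + z)) ∂(multivariateGaussian 0 M.Γ)

end Kalman

section Assumptions

variable {d dO : ℕ} {𝓦 : Type*} [MeasurableSpace 𝓦] {Ω : Type*} [MeasurableSpace Ω]
  {M : FilterModel d dO 𝓦} {Pr : Measure Ω}

/-- First assumption: integrability of the initial state, stability, weak convergence with rate
`α` on the class `𝔽` of observables, Lipschitz continuity and cost of the numerical solvers. -/
structure Assumption1 (R : ReferenceNoise M Pr) (α : ℝ) (𝔽 : Set (Vec d → ℝ)) : Prop where
  initial : R.MemAllLpAt 0 R.u₀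
  stability : ∀ (n : ℕ) (p : ℝ), 2 ≤ p → ∃ c : ℝ≥0, ∀ N : ℕ, 1 ≤ N → ∀ u : Ω → Vec d,
    R.MemAllLpAt n u →
      eLpNorm (fun ω => M.solver n N (u ω) (R.w n ω)) (ENNReal.ofReal p) Pr
        ≤ c * (1 + eLpNorm u (ENNReal.ofReal p) Pr)
  alpha_pos : 0 < α
  poly_mem : ∀ q : MvPolynomial (Fin d) ℝ, q.totalDegree ≤ 2 →
    (fun x : Vec d => MvPolynomial.eval (fun i => x i) q) ∈ 𝔽
  mem_C2Poly : ∀ φ ∈ 𝔽, IsC2Poly φ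
  pullback_mem : ∀ (n : ℕ), ∀ φ ∈ 𝔽, M.pullback n φ ∈ 𝔽
  weak : ∀ (n : ℕ) (u : Ω → Vec d) (uN : ℕ → Ω → Vec d),
    R.MemAllLpAt n u → (∀ N, 1 ≤ N → R.MemAllLpAt n (uN N)) →
    (∀ φ ∈ 𝔽, ∃ c : ℝ, ∀ N : ℕ, 1 ≤ N →
      |∫ ω, (φ (uN N ω) - φ (u ω)) ∂Pr| ≤ c * (N : ℝ) ^ (-α)) →
    ∀ φ ∈ 𝔽, ∃ c : ℝ, ∀ N : ℕ, 1 ≤ N →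
      |∫ ω, (φ (M.solver n N (uN N ω) (R.w n ω)) - φ (M.exact n (u ω) (R.w n ω))) ∂Pr|
        ≤ c * (N : ℝ) ^ (-α)
  lipschitz : ∀ (n : ℕ) (p : ℝ), 2 ≤ p → ∃ c : ℝ≥0, ∀ N : ℕ, 1 ≤ N → ∀ u v : Ω → Vec d,
    R.MemAllLpAt n u → R.MemAllLpAt n v →
      eLpNorm (fun ω => M.solver n N (u ω) (R.w n ω) - M.solver n N (v ω) (R.w n ω))
          (ENNReal.ofReal p) Pr
        ≤ c * eLpNorm (fun ω => u ω - v ω) (ENNReal.ofReal p) Pr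
  cost_le : ∀ n : ℕ, ∃ c : ℝ≥0, ∀ N : ℕ, 1 ≤ N → ∀ u : Ω → Vec d, R.MemAllLpAt n u →
    ∀ᵐ ω ∂Pr, M.cost n N (u ω) (R.w n ω) ≤ c * N

/-- `a ≂ b` with constant `κ`: `a ≤ κ b` and `b ≤ κ a`. -/
def EquivBy (κ a b : ℝ) : Prop := a ≤ κ * b ∧ b ≤ κ * a

/-- `{N_ℓ}` is an exponentially growing sequence of (positive) natural numbers:
`N_ℓ ≂ 2^{sℓ}` for some `s > 0`. -/
def IsExpGrowing (N : ℕ → ℕ) : Prop :=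
  (∀ l, 1 ≤ N l) ∧ ∃ s : ℝ, 0 < s ∧ ∃ κ : ℝ, ∀ l : ℕ, EquivBy κ (N l) ((2 : ℝ) ^ (s * l))

/-- The bounds on a map `ψ = ψ(x, w_n)` and on its partial derivatives of order at most two, with
constant `c`. -/
structure DerivBounds (R : ReferenceNoise M Pr) (n : ℕ) (p : ℝ) (c : ℝ≥0)
    (ψ : Vec d → 𝓦 → Vec d) : Prop where
  first : ∀ k : ℕ, k ≤ 1 → ∀ (i : Fin k → Fin d) (u : Ω → Vec d), R.MemLpAt n p u →
    eLpNorm (fun ω => partialDeriv i (fun x => ψ x (R.w n ω)) (u ω)) (ENNReal.ofReal p) Pr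
      ≤ c * (1 + eLpNorm u (ENNReal.ofReal p) Pr)
  second : ∀ (i : Fin 2 → Fin d) (u : Ω → Vec d), R.MemLpAt n (2 * p) u →
    eLpNorm (fun ω => partialDeriv i (fun x => ψ x (R.w n ω)) (u ω)) (ENNReal.ofReal p) Pr
      ≤ c * (1 + eLpNorm u (ENNReal.ofReal (2 * p)) Pr)

/-- Second assumption: regularity of the (numerical and exact) random maps, with moment bounds for
their partial derivatives, and strong convergence with rate `β / 2` along exponentially growing
sequences of resolutions. -/
structure Assumption2 (R : ReferenceNoise M Pr) (β : ℝ) : Prop where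
  beta_pos : 0 < β
  smooth_exact : ∀ n : ℕ, ∀ᵐ w ∂(M.noiseLaw n), ContDiff ℝ 2 fun x => M.exact n x w
  smooth_solver : ∀ n N : ℕ, 1 ≤ N →
    ∀ᵐ w ∂(M.noiseLaw n), ContDiff ℝ 2 fun x => M.solver n N x w
  bounds : ∀ N : ℕ → ℕ, IsExpGrowing N → ∀ (n : ℕ) (p : ℝ), 2 ≤ p → ∃ c : ℝ≥0,
    DerivBounds R n p c (M.exact n) ∧
    (∀ l : ℕ, DerivBounds R n p c (M.solver n (N l))) ∧
    ∀ (l k : ℕ), k ≤ 1 → ∀ (i : Fin k → Fin d) (u : Ω → Vec d), R.MemLpAt n p u →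
      eLpNorm (fun ω => partialDeriv i (fun x => M.solver n (N (l + 1)) x (R.w n ω)) (u ω)
          - partialDeriv i (fun x => M.solver n (N l) x (R.w n ω)) (u ω)) (ENNReal.ofReal p) Pr
        ≤ c * (1 + eLpNorm u (ENNReal.ofReal p) Pr) * ENNReal.ofReal ((N l : ℝ) ^ (-β / 2))

end Assumptions

section Ensembles

variable {d dO : ℕ} {𝓦 : Type*} [MeasurableSpace 𝓦]

/-- Realized random inputs of one ensemble: initial particles `init i`, driving noise `noise n i`
of particle `i` on `[n, n + 1]`, and perturbation `obs n i` of the observation at time `n`. -/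
structure Drivers (d dO : ℕ) (𝓦 : Type*) where
  init : ℕ → Vec d
  noise : ℕ → ℕ → 𝓦
  obs : ℕ → ℕ → Vec dO

/-- The inputs of the particles `q, q + 1, q + 2, …`. -/
def Drivers.shift (D : Drivers d dO 𝓦) (q : ℕ) : Drivers d dO 𝓦 where
  init i := D.init (i + q)
  noise n i := D.noise n (i + q)
  obs n i := D.obs n (i + q)

/-- The biased sample covariance of the particles `v 0, …, v (P - 1)`. -/
def sampleCov (P : ℕ) (v : ℕ → Vec d) : Matrix (Fin d) (Fin d) ℝ :=
  Matrix.of fun a b =>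
    (∑ i ∈ Finset.range P, v i a * v i b) / P
      - ((∑ i ∈ Finset.range P, v i a) / P) * ((∑ i ∈ Finset.range P, v i b) / P)

/-- The updated EnKF particles at time `n`, with solver resolution `N` and ensemble size `P`
(the ensemble consists of the particles with index `i < P`). -/
def FilterModel.enkf (M : FilterModel d dO 𝓦) (N P : ℕ) (D : Drivers d dO 𝓦) : ℕ → ℕ → Vec d
  | 0 => D.init
  | n + 1 =>
    let v : ℕ → Vec d := fun i => M.solver n N (M.enkf N P D n i) (D.noise n i)
    fun i => M.assimilate (M.gain (sampleCov P v)) (v i) (M.y (n + 1) + D.obs (n + 1) i)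

/-- The EnKF sample average `μ_n^{N,P}[φ]`. -/
def FilterModel.enkfMean (M : FilterModel d dO 𝓦) (N P : ℕ) (D : Drivers d dO 𝓦) (n : ℕ)
    (φ : Vec d → ℝ) : ℝ :=
  (∑ i ∈ Finset.range P, φ (M.enkf N P D n i)) / P

/-- The cost of all solver evaluations up to time `n` in one EnKF ensemble. -/
def FilterModel.enkfSolverCost (M : FilterModel d dO 𝓦) (N P : ℕ) (D : Drivers d dO 𝓦) (n : ℕ) :
    ℝ≥0 :=
  ∑ k ∈ Finset.range n, ∑ i ∈ Finset.range P, M.cost k N (M.enkf N P D k i) (D.noise k i)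

/-- One pairwise coupled sample `μ_n^{ℓ,f}[φ] - μ_n^{ℓ,c}[φ]`. The two coarse ensembles of size
`P_{ℓ-1}` use the inputs of the first, respectively second, half of the `P_ℓ = 2 P_{ℓ-1}` fine
particles; there is no coarse part on level `0`. -/
def FilterModel.levelSample (M : FilterModel d dO 𝓦) (N P : ℕ → ℕ) (D : Drivers d dO 𝓦) (n : ℕ)
    (φ : Vec d → ℝ) : ℕ → ℝ
  | 0 => M.enkfMean (N 0) (P 0) D n φ
  | l + 1 => M.enkfMean (N (l + 1)) (P (l + 1)) D n φ
      - (M.enkfMean (N l) (P l) D n φ + M.enkfMean (N l) (P l) (D.shift (P l)) n φ) / 2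

/-- The cost of all solver evaluations up to time `n` in one pairwise coupled sample. -/
def FilterModel.levelSolverCost (M : FilterModel d dO 𝓦) (N P : ℕ → ℕ) (D : Drivers d dO 𝓦)
    (n : ℕ) : ℕ → ℝ≥0
  | 0 => M.enkfSolverCost (N 0) (P 0) D n
  | l + 1 => M.enkfSolverCost (N (l + 1)) (P (l + 1)) D n
      + (M.enkfSolverCost (N l) (P l) D n + M.enkfSolverCost (N l) (P l) (D.shift (P l)) n)

variable {Ω' : Type*} [MeasurableSpace Ω']

/-- The random inputs of all the ensembles: for level `ℓ`, sample `m` and particle `i`, an initial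
state distributed as `u₀`, driving noises and `N(0, Γ)` observation perturbations, all
independent. -/
structure EnsembleNoise (M : FilterModel d dO 𝓦) (Pr' : Measure Ω') where
  init : ℕ × ℕ × ℕ → Ω' → Vec d
  noise : ℕ × ℕ × ℕ × ℕ → Ω' → 𝓦
  obs : ℕ × ℕ × ℕ × ℕ → Ω' → Vec dO
  measurable_init : ∀ a, Measurable (init a)
  measurable_noise : ∀ a, Measurable (noise a)
  measurable_obs : ∀ a, Measurable (obs a)
  law_init : ∀ a, Pr'.map (init a) = M.initLaw
  law_noise : ∀ l m n i, Pr'.map (noise (l, m, n, i)) = M.noiseLaw n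
  law_obs : ∀ a, Pr'.map (obs a) = multivariateGaussian 0 M.Γ
  indep : iIndep
    (Sum.elim (fun a : ℕ × ℕ × ℕ => MeasurableSpace.comap (init a) inferInstance)
      (Sum.elim (fun a : ℕ × ℕ × ℕ × ℕ => MeasurableSpace.comap (noise a) inferInstance)
        (fun a : ℕ × ℕ × ℕ × ℕ => MeasurableSpace.comap (obs a) inferInstance))) Pr'

variable {M : FilterModel d dO 𝓦} {Pr' : Measure Ω'}

/-- The inputs of the `m`-th sample on level `l`. -/
def EnsembleNoise.drivers (S : EnsembleNoise M Pr') (l m : ℕ) (ω : Ω') : Drivers d dO 𝓦 where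
  init i := S.init (l, m, i) ω
  noise n i := S.noise (l, m, n, i) ω
  obs n i := S.obs (l, m, n, i) ω

/-- The MLEnKF estimator `μ_n^{ML}[φ]` with finest level `L` and `Ms l` samples on level `l`. -/
def EnsembleNoise.mlenkf (S : EnsembleNoise M Pr') (L : ℕ) (Ms N P : ℕ → ℕ) (n : ℕ)
    (φ : Vec d → ℝ) (ω : Ω') : ℝ :=
  ∑ l ∈ Finset.range (L + 1),
    (∑ m ∈ Finset.range (Ms l), M.levelSample N P (S.drivers l m ω) n φ l) / Ms l

/-- The total cost of the solver evaluations performed by the MLEnKF estimator up to time `n`. -/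
def EnsembleNoise.solverCost (S : EnsembleNoise M Pr') (L : ℕ) (Ms N P : ℕ → ℕ) (n : ℕ)
    (ω : Ω') : ℝ≥0 :=
  ∑ l ∈ Finset.range (L + 1), ∑ m ∈ Finset.range (Ms l),
    M.levelSolverCost N P (S.drivers l m ω) n l

end Ensembles

section Configuration

/-- `Cost(MLEnKF) = ∑_{ℓ ≤ L} M_ℓ N_ℓ P_ℓ`. -/
def mlCost (L : ℕ) (Ms N P : ℕ → ℕ) : ℝ :=
  ∑ l ∈ Finset.range (L + 1), (Ms l : ℝ) * N l * P l

/-- `min(1, (1 + β s) / 2, α s)`. -/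
def levelRate (α β s : ℝ) : ℝ := min 1 (min ((1 + β * s) / 2) (α * s))

/-- The finest level `L = ⌈log₂(ε⁻¹) / min(1, (1 + β s) / 2, α s)⌉` (and `0` if `ε > 1`). -/
def finestLevel (α β s ε : ℝ) : ℕ := ⌈Real.logb 2 ε⁻¹ / levelRate α β s⌉₊

/-- The prescribed size of `M_ℓ`. -/
def sampleRate (α β s ε : ℝ) (l : ℕ) : ℝ :=
  if s < min (β * s) 1 then
    ε ^ (-2 : ℝ) * (2 : ℝ) ^ (-((3 + 2 * s + min (β * s) 1) / 3 * l)) + 1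
  else if min (β * s) 1 = s then
    ε ^ (-2 : ℝ) * (finestLevel α β s ε : ℝ) ^ 2 * (2 : ℝ) ^ (-((1 + s) * l)) + 1
  else
    ε ^ (-2 - 2 * (s - min (β * s) 1) / (3 * levelRate α β s))
      * (2 : ℝ) ^ (-((3 + 2 * s + min (β * s) 1) / 3 * l)) + 1

/-- The configuration of the estimator for the tolerance `ε`, all `≂` having the constant `κ`:
`P_{ℓ+1} = 2 P_ℓ`, `P_ℓ ≂ 2^ℓ`, `N_ℓ ≂ 2^{sℓ}`, and `M_ℓ` as prescribed for `ℓ ≤ L`. -/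
structure IsConfiguration (α β s κ ε : ℝ) (Ms N P : ℕ → ℕ) : Prop where
  double : ∀ l, P (l + 1) = 2 * P l
  size : ∀ l : ℕ, EquivBy κ (P l) ((2 : ℝ) ^ l)
  resolution : ∀ l : ℕ, EquivBy κ (N l) ((2 : ℝ) ^ (s * l))
  samples : ∀ l : ℕ, l ≤ finestLevel α β s ε → EquivBy κ (Ms l) (sampleRate α β s ε l)

/-- The optimized choices of the parameter `s`. -/
def optimalS (α β : ℝ) : Set ℝ :=
  open Classical in
  if 1 < β ∧ 1 < α then Set.Ico α⁻¹ 1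
  else if (1 < β ∧ α = 1) ∨ (β = 1 ∧ 1 ≤ α) then Set.Icc α⁻¹ 1
  else if (1 ≤ β ∧ α < 1) ∨ (β < 1 ∧ α ≤ β) then {α⁻¹}
  else {(2 * α - β)⁻¹}

/-- The cost rate in the four regimes; the last one is `β < 1` and `α > β`. -/
def costRate (α β ε : ℝ) : ℝ :=
  open Classical in
  if 1 < β ∧ 1 < α then ε ^ (-2 : ℝ)
  else if (1 < β ∧ α = 1) ∨ (β = 1 ∧ 1 ≤ α) then ε ^ (-2 : ℝ) * |Real.log ε| ^ 3
  else if (1 ≤ β ∧ α < 1) ∨ (β < 1 ∧ α ≤ β) then ε ^ (-(1 + 1 / α))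
  else ε ^ (-(2 + (1 - β) / α))

end Configuration

end MLEnKF

end

open MLEnKF

/-! The proof rests on a first-order expansion of the EnKF around its mean-field limit. Let every
particle also follow the mean-field recursion of the same resolution `N`, driven by its own data
only. These limit particles are independent and identically distributed. Every quantity `X_i` that
the EnKF computes for particle `i` then satisfies, in all `L^p` and uniformly in `N` and `P`, X_i =
Xl(data_i) + ∑_k A_k(data_i) · (ensemble average of h_k(data)) + O(1/P), with centred `h_k`, where
`Xl`, `A_k` and `h_k` change only by O(N^(-β/2)) between consecutive resolutions. This is `Expands`.
The class is closed under sums, products, ensemble averages (`Expands.exists_average`), smooth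
random maps with fresh noise (`Expands.kernel`, Taylor's formula) and the Kalman gain
(`Expands.gain`, resolvent identity; the inverse stays bounded because `Γ` is positive definite).
Hence it survives each prediction and update (`Expands.enkf`), and the EnKF average of `φ` equals
c_N + (average of h_N) + O(1/P).

In a coupled sample the two coarse ensembles together use exactly the data of the fine one, so the
mean of their two linear terms is the average of the coarse `h` over all fine particles
(`emp_two_mul`). What remains is the average of the centred difference of the fine and the coarse
`h`, of size N^(-β/2) P^(-1/2), plus O(1/P). Averaging `M_ℓ` independent samples gains M_ℓ^(-1/2).
The linear term has mean zero, so the bias of one EnKF is O(1/P) with respect to the mean-field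
model of resolution `N`. That model is O(N^(-α)) away from the exact one: by induction over time,
the weak error passes through the covariance (a polynomial of degree two), the gain, and the
pullback of `φ` (`mean_field_weak_error`).

Expectations telescope over the levels. With b = min(βs, 1) the error is therefore at most a
constant times ∑ M_ℓ^(-1/2) 2^(-(1+b)ℓ/2) + 2^(-L) + 2^(-αsL). Both this sum and the cost are
geometric in `ℓ` with ratio 2^((s-b)/3), up to the effect of the `+ 1` in `M_ℓ`. The sign of `s - b`
decides whether level 0, all levels or level `L` dominate.

Two transfers connect this with the hypotheses. Moment bounds are tested at deterministic states and
carried by Tonelli's theorem to any state independent of the fresh noise (`LpO.comp_indep`), in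
particular to interacting particles on another probability space. Constants that may depend on a
sequence of resolutions are made uniform by selecting the worst case in each of countably many
finite blocks (`exists_uniform_of_sequences`). -/

namespace MLEnKF

/-! ### Calculus of moment bounds valid in every `L^p` -/

/-- The family `X` is bounded in every `L^p`, `p < ∞`, by a multiple (depending on `p` only)
of `ρ`. -/
structure LpO {Λ Ω : Type*} [MeasurableSpace Ω] (μ : Measure Ω) (X : Λ → Ω → ℝ)
    (ρ : Λ → ℝ≥0) : Prop where
  meas : ∀ a, AEStronglyMeasurable (X a) μ
  bound : ∀ p : ℝ≥0, ∃ C : ℝ≥0, ∀ a, eLpNorm (X a) p μ ≤ (C * ρ a : ℝ≥0)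

namespace LpO

variable {Λ Λ' Ω : Type*} [MeasurableSpace Ω] {μ : Measure Ω} {X Y : Λ → Ω → ℝ}
  {ρ ρ' : Λ → ℝ≥0}

/-- On a probability space the norms increase with the exponent, so small `p` are covered by `max p
2`. This leaves the range where Minkowski's inequality holds and in which the assumptions are
stated. -/
theorem of_two_le [IsProbabilityMeasure μ] (hm : ∀ a, AEStronglyMeasurable (X a) μ)
    (h : ∀ p : ℝ≥0, 2 ≤ p → ∃ C : ℝ≥0, ∀ a, eLpNorm (X a) p μ ≤ (C * ρ a : ℝ≥0)) :
    LpO μ X ρ := by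
  refine ⟨hm, fun p => ?_⟩
  obtain ⟨C, hC⟩ := h (max p 2) (le_max_right _ _)
  refine ⟨C, fun a => le_trans (eLpNorm_le_eLpNorm_of_exponent_le ?_ (hm a)) (hC a)⟩
  exact_mod_cast le_max_left p 2

theorem mono (h : LpO μ X ρ) (K : ℝ≥0) (hK : ∀ a, ρ a ≤ K * ρ' a) : LpO μ X ρ' := by
  refine ⟨h.meas, fun p => ?_⟩
  obtain ⟨C, hC⟩ := h.bound p
  refine ⟨C * K, fun a => (hC a).trans ?_⟩
  rw [mul_assoc]
  exact_mod_cast mul_le_mul_right (hK a) C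

theorem le (h : LpO μ X ρ) (hK : ∀ a, ρ a ≤ ρ' a) : LpO μ X ρ' :=
  h.mono 1 (by simpa using hK)

theorem congr (h : LpO μ X ρ) (hXY : ∀ a ω, X a ω = Y a ω) : LpO μ Y ρ := by
  have : X = Y := by ext a ω; exact hXY a ω
  exact this ▸ h

theorem reindex (h : LpO μ X ρ) (f : Λ' → Λ) : LpO μ (fun a => X (f a)) (fun a => ρ (f a)) :=
  ⟨fun a => h.meas (f a), fun p => (h.bound p).imp fun _ hC a => hC (f a)⟩

theorem of_abs_le (h : LpO μ X ρ) (hm : ∀ a, AEStronglyMeasurable (Y a) μ)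
    (hXY : ∀ a, ∀ᵐ ω ∂μ, |Y a ω| ≤ |X a ω|) : LpO μ Y ρ := by
  refine ⟨hm, fun p => ?_⟩
  obtain ⟨C, hC⟩ := h.bound p
  exact ⟨C, fun a => (eLpNorm_mono_ae (by simpa using hXY a)).trans (hC a)⟩

theorem abs (h : LpO μ X ρ) : LpO μ (fun a ω => |X a ω|) ρ :=
  h.of_abs_le (fun a => (h.meas a).norm) (fun a => by simp)

theorem const [IsProbabilityMeasure μ] {c : Λ → ℝ} (K : ℝ≥0) (h : ∀ a, |c a| ≤ K * ρ a) :
    LpO μ (fun a _ => c a) ρ := by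
  refine of_two_le (fun a => aestronglyMeasurable_const) fun p hp => ⟨K, fun a => ?_⟩
  rw [eLpNorm_const _ (by positivity) (IsProbabilityMeasure.ne_zero μ)]
  simp only [measure_univ, ENNReal.one_rpow, mul_one]
  rw [← ofReal_norm, ← ENNReal.ofReal_coe_nnreal]
  exact ENNReal.ofReal_le_ofReal (by simpa using h a)

theorem add [IsProbabilityMeasure μ] (hX : LpO μ X ρ) (hY : LpO μ Y ρ) :
    LpO μ (fun a ω => X a ω + Y a ω) ρ := by
  refine of_two_le (fun a => (hX.meas a).add (hY.meas a)) fun p hp => ?_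
  obtain ⟨C, hC⟩ := hX.bound p
  obtain ⟨D, hD⟩ := hY.bound p
  refine ⟨C + D, fun a => (eLpNorm_add_le (hX.meas a) (hY.meas a) ?_).trans ?_⟩
  · exact_mod_cast (one_le_two).trans hp
  · rw [add_mul]
    push_cast
    exact_mod_cast add_le_add (hC a) (hD a)

theorem neg (hX : LpO μ X ρ) : LpO μ (fun a ω => -X a ω) ρ :=
  hX.of_abs_le (fun a => (hX.meas a).neg) (by simp)

theorem sub [IsProbabilityMeasure μ] (hX : LpO μ X ρ) (hY : LpO μ Y ρ) :
    LpO μ (fun a ω => X a ω - Y a ω) ρ :=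
  (hX.add hY.neg).congr fun _ _ => (sub_eq_add_neg _ _).symm

theorem zero : LpO μ (fun (_ : Λ) _ => 0) ρ :=
  ⟨fun _ => aestronglyMeasurable_const, fun _ => ⟨0, by simp⟩⟩

theorem sum [IsProbabilityMeasure μ] {K : Type*} (s : Finset K) {Z : K → Λ → Ω → ℝ}
    (h : ∀ k ∈ s, LpO μ (Z k) ρ) : LpO μ (fun a ω => ∑ k ∈ s, Z k a ω) ρ := by
  classical
  induction s using Finset.induction_on with
  | empty => simpa using zero
  | insert k s hk ih =>
    simp only [Finset.sum_insert hk]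
    exact (h k (by simp)).add (ih fun j hj => h j (by simp [hj]))

/-- Hölder's inequality with exponents `2p` and `2p`. Products cost integrability, which is why
bounds are always carried for all `p` at once. -/
theorem mul (hX : LpO μ X ρ) (hY : LpO μ Y ρ') :
    LpO μ (fun a ω => X a ω * Y a ω) (fun a => ρ a * ρ' a) := by
  refine ⟨fun a => (hX.meas a).mul (hY.meas a), fun p => ?_⟩
  obtain ⟨C, hC⟩ := hX.bound (2 * p)
  obtain ⟨D, hD⟩ := hY.bound (2 * p)
  refine ⟨C * D, fun a => ?_⟩
  have : ENNReal.HolderTriple ((2 * p : ℝ≥0) : ℝ≥0∞) ((2 * p : ℝ≥0) : ℝ≥0∞) (p : ℝ≥0∞) := by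
    constructor
    push_cast
    rw [ENNReal.mul_inv (by simp) (by simp), ← add_mul, ENNReal.inv_two_add_inv_two, one_mul]
  refine (eLpNorm_smul_le_mul_eLpNorm (p := ((2 * p : ℝ≥0) : ℝ≥0∞))
    (q := ((2 * p : ℝ≥0) : ℝ≥0∞)) (hY.meas a) (hX.meas a)).trans ?_
  refine (mul_le_mul' (hC a) (hD a)).trans (le_of_eq ?_)
  rw [← ENNReal.coe_mul]
  congr 1
  ring

theorem mul_one_right (hX : LpO μ X ρ) (hY : LpO μ Y 1) : LpO μ (fun a ω => X a ω * Y a ω) ρ :=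
  (hX.mul hY).le (by simp)

theorem mul_one_left (hX : LpO μ X 1) (hY : LpO μ Y ρ) : LpO μ (fun a ω => X a ω * Y a ω) ρ :=
  (hX.mul hY).le (by simp)

theorem const_mul (c : ℝ) (hX : LpO μ X ρ) : LpO μ (fun a ω => c * X a ω) ρ := by
  refine ⟨fun a => (hX.meas a).const_mul c, fun p => ?_⟩
  obtain ⟨C, hC⟩ := hX.bound p
  refine ⟨‖c‖₊ * C, fun a => ?_⟩
  have := eLpNorm_const_smul c (X a) (p : ℝ≥0∞) μ
  simp only [Pi.smul_def, smul_eq_mul] at this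
  rw [this, mul_assoc]
  push_cast
  exact mul_le_mul' le_rfl (hC a)

theorem pow [IsProbabilityMeasure μ] (hX : LpO μ X ρ) (k : ℕ) :
    LpO μ (fun a ω => X a ω ^ k) (fun a => ρ a ^ k) := by
  induction k with
  | zero => simpa using const (μ := μ) (ρ := fun _ : Λ => 1) (c := fun _ => 1) 1 (by simp)
  | succ k ih => simpa only [pow_succ] using ih.mul hX

theorem average [IsProbabilityMeasure μ] {Z : Λ → ℕ → Ω → ℝ}
    (h : LpO μ (fun q : Λ × ℕ => Z q.1 q.2) (fun q => ρ q.1)) (P : Λ → ℕ) :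
    LpO μ (fun a ω => (∑ i ∈ Finset.range (P a), Z a i ω) / P a) ρ := by
  have hm : ∀ a i, AEStronglyMeasurable (Z a i) μ := fun a i => h.meas (a, i)
  refine of_two_le (fun a => ?_) fun p hp => ?_
  · have := Finset.aestronglyMeasurable_fun_sum (Finset.range (P a)) (fun i _ => hm a i)
    simp only [div_eq_mul_inv]
    exact this.mul_const _
  obtain ⟨C, hC⟩ := h.bound p
  refine ⟨C, fun a => ?_⟩
  have hs : eLpNorm (∑ i ∈ Finset.range (P a), Z a i) p μ ≤ P a * (C * ρ a : ℝ≥0) := by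
    refine (eLpNorm_sum_le (fun i _ => hm a i) (by exact_mod_cast (one_le_two).trans hp)).trans ?_
    refine (Finset.sum_le_sum fun i _ => hC (a, i)).trans ?_
    simp
  have : (fun ω => (∑ i ∈ Finset.range (P a), Z a i ω) / (P a : ℝ))
      = ((P a : ℝ)⁻¹) • (∑ i ∈ Finset.range (P a), Z a i) := by
    ext ω
    simp [div_eq_inv_mul]
  rw [this, eLpNorm_const_smul]
  -- For `P a = 0` the average is `0` by the convention for division by zero.
  rcases Nat.eq_zero_or_pos (P a) with h0 | h0
  · simp [h0]
  refine (mul_le_mul' le_rfl hs).trans ?_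
  rw [← mul_assoc]
  have : ‖((P a : ℝ)⁻¹)‖ₑ * (P a : ℝ≥0∞) = 1 := by
    rw [enorm_inv (by positivity)]
    have : ‖(P a : ℝ)‖ₑ = (P a : ℝ≥0∞) := by
      rw [Real.enorm_natCast]
    rw [this]
    exact ENNReal.inv_mul_cancel (by exact_mod_cast h0.ne') (by simp)
  rw [this, one_mul]

theorem memLp (h : LpO μ X ρ) (a : Λ) (p : ℝ≥0) : MemLp (X a) p μ := by
  obtain ⟨C, hC⟩ := h.bound p
  exact ⟨h.meas a, (hC a).trans_lt ENNReal.coe_lt_top⟩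

theorem integrable (h : LpO μ X ρ) (a : Λ) : Integrable (X a) μ :=
  memLp_one_iff_integrable.1 (by exact_mod_cast h.memLp a 1)

theorem abs_integral_le (h : LpO μ X ρ) : ∃ C : ℝ≥0, ∀ a, |∫ ω, X a ω ∂μ| ≤ C * ρ a := by
  obtain ⟨C, hC⟩ := h.bound 1
  refine ⟨C, fun a => ?_⟩
  have h1 := hC a
  simp only [ENNReal.coe_one] at h1
  rw [eLpNorm_one_eq_lintegral_enorm] at h1
  have h2 := (enorm_integral_le_lintegral_enorm (μ := μ) (X a)).trans h1
  rw [← ofReal_norm, ← ENNReal.ofReal_coe_nnreal] at h2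
  have := (ENNReal.ofReal_le_ofReal_iff (by positivity)).1 h2
  simpa using this

theorem integral_const [IsProbabilityMeasure μ] (h : LpO μ X ρ) :
    LpO μ (fun a _ => ∫ ω, X a ω ∂μ) ρ := by
  obtain ⟨C, hC⟩ := h.abs_integral_le
  exact const C hC

/-- Evaluation of a kernel at an independent random argument. -/
theorem comp_indep [IsProbabilityMeasure μ] {Λ₀ Z 𝓦 : Type*} [MeasurableSpace Z]
    [MeasurableSpace 𝓦] {ν : Measure 𝓦} [SFinite ν] {g : Λ₀ → Z → 𝓦 → ℝ} {b : Λ₀ → Z → ℝ≥0}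
    (hg : LpO ν (fun q : Λ₀ × Z => g q.1 q.2) (fun q => b q.1 q.2))
    (hgm : ∀ j, Measurable fun q : Z × 𝓦 => g j q.1 q.2)
    (π : Λ → Λ₀) {ζ : Λ → Ω → Z} {w : Λ → Ω → 𝓦} (hζ : ∀ a, Measurable (ζ a))
    (hw : ∀ a, Measurable (w a)) (hlaw : ∀ a, μ.map (w a) = ν)
    (hind : ∀ a, IndepFun (ζ a) (w a) μ)
    (hb : LpO μ (fun a ω => (b (π a) (ζ a ω) : ℝ)) ρ) :
    LpO μ (fun a ω => g (π a) (ζ a ω) (w a ω)) ρ := by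
  refine of_two_le (fun a => ?_) fun p hp => ?_
  · exact ((hgm (π a)).comp ((hζ a).prodMk (hw a))).aestronglyMeasurable
  obtain ⟨C, hC⟩ := hg.bound p
  obtain ⟨D, hD⟩ := hb.bound p
  refine ⟨C * D, fun a => ?_⟩
  have hp0 : (p : ℝ≥0∞) ≠ 0 := by
    have : (0 : ℝ≥0) < p := lt_of_lt_of_le (by norm_num) hp
    exact_mod_cast this.ne'
  have hpr : 0 < (p : ℝ) := by
    have : (0 : ℝ≥0) < p := lt_of_lt_of_le (by norm_num) hp
    exact_mod_cast this
  -- By independence the joint law of `ζ` and `w` is a product. Tonelli's theorem integrates out `w`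
  -- first, with `ζ` frozen, where the bound for fixed arguments applies; only moments of `b` at `ζ`
  -- remain.
  have key : ∫⁻ ω, ‖g (π a) (ζ a ω) (w a ω)‖ₑ ^ (p : ℝ) ∂μ
      ≤ ∫⁻ ω, (C * b (π a) (ζ a ω) : ℝ≥0∞) ^ (p : ℝ) ∂μ := by
    have hmeas : Measurable fun q : Z × 𝓦 => ‖g (π a) q.1 q.2‖ₑ ^ (p : ℝ) :=
      (hgm (π a)).enorm.pow_const _
    have h1 : ∫⁻ ω, ‖g (π a) (ζ a ω) (w a ω)‖ₑ ^ (p : ℝ) ∂μ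
        = ∫⁻ q, ‖g (π a) q.1 q.2‖ₑ ^ (p : ℝ) ∂((μ.map (ζ a)).prod ν) := by
      rw [← hlaw a, ← (indepFun_iff_map_prod_eq_prod_map_map (hζ a).aemeasurable
        (hw a).aemeasurable).1 (hind a), lintegral_map hmeas ((hζ a).prodMk (hw a))]
    rw [h1, lintegral_prod _ hmeas.aemeasurable]
    rw [lintegral_map (hmeas.lintegral_prod_right') (hζ a)]
    refine lintegral_mono fun ω => ?_
    have := hC (π a, ζ a ω)
    rw [eLpNorm_eq_lintegral_rpow_enorm_toReal hp0 (by simp)] at this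
    simp only [ENNReal.coe_toReal, one_div] at this
    rw [ENNReal.rpow_inv_le_iff hpr] at this
    exact_mod_cast this
  have hbn : eLpNorm (fun ω => (b (π a) (ζ a ω) : ℝ)) p μ
      = (∫⁻ ω, (b (π a) (ζ a ω) : ℝ≥0∞) ^ (p : ℝ) ∂μ) ^ (p : ℝ)⁻¹ := by
    rw [eLpNorm_eq_lintegral_rpow_enorm_toReal hp0 (by simp)]
    simp [Real.enorm_eq_ofReal_abs]
  rw [eLpNorm_eq_lintegral_rpow_enorm_toReal hp0 (by simp)]
  simp only [ENNReal.coe_toReal, one_div]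
  refine (ENNReal.rpow_le_rpow key (by positivity)).trans ?_
  simp_rw [ENNReal.mul_rpow_of_nonneg _ _ hpr.le]
  rw [lintegral_const_mul' _ _ (by simp), ENNReal.mul_rpow_of_nonneg _ _ (by positivity),
    ← ENNReal.rpow_mul, mul_inv_cancel₀ hpr.ne', ENNReal.rpow_one, ← hbn, mul_assoc]
  push_cast
  refine mul_le_mul' le_rfl ?_
  exact_mod_cast hD a

end LpO

/-! ### Averages of independent centred random variables -/

/-- Binomial expansion in `y`. The linear term is kept exactly, because its expectation will vanish.
Every term of order at least two is dominated by the two extreme ones, and the binomial coefficients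
add up to at most 4^(k+1). -/
theorem add_pow_even_le (x y : ℝ) (k : ℕ) :
    (x + y) ^ (2 * k + 2) ≤ x ^ (2 * k + 2) + (2 * k + 2) * (x ^ (2 * k + 1) * y)
      + 4 ^ (k + 1) * (x ^ (2 * k) * y ^ 2 + y ^ (2 * k + 2)) := by
  have hterm : ∀ m ∈ Finset.range (2 * k + 1),
      y ^ (m + 2) * x ^ (2 * k + 2 - (m + 2)) * ((2 * k + 2).choose (m + 2) : ℝ)
        ≤ (x ^ (2 * k) * y ^ 2 + y ^ (2 * k + 2)) * ((2 * k + 2).choose (m + 2) : ℝ) := by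
    intro m hm
    have hm' : m ≤ 2 * k := by simpa [Nat.lt_succ_iff] using hm
    refine mul_le_mul_of_nonneg_right ?_ (by positivity)
    have h1 : 2 * k + 2 - (m + 2) = 2 * k - m := by omega
    rw [h1]
    have hxe : x ^ (2 * k) = |x| ^ (2 * k) := by rw [pow_mul, pow_mul, sq_abs]
    have hye : y ^ (2 * k) = |y| ^ (2 * k) := by rw [pow_mul, pow_mul, sq_abs]
    have h2 : |y| ^ m * |x| ^ (2 * k - m) ≤ |x| ^ (2 * k) + |y| ^ (2 * k) := by
      rcases le_total (|x|) (|y|) with h | h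
      · calc |y| ^ m * |x| ^ (2 * k - m) ≤ |y| ^ m * |y| ^ (2 * k - m) := by gcongr
          _ = |y| ^ (2 * k) := by rw [← pow_add]; congr 1; omega
          _ ≤ _ := le_add_of_nonneg_left (by positivity)
      · calc |y| ^ m * |x| ^ (2 * k - m) ≤ |x| ^ m * |x| ^ (2 * k - m) := by gcongr
          _ = |x| ^ (2 * k) := by rw [← pow_add]; congr 1; omega
          _ ≤ _ := le_add_of_nonneg_right (by positivity)
    calc y ^ (m + 2) * x ^ (2 * k - m) = y ^ 2 * (y ^ m * x ^ (2 * k - m)) := by ring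
      _ ≤ y ^ 2 * (|y| ^ m * |x| ^ (2 * k - m)) := by
          refine mul_le_mul_of_nonneg_left ?_ (sq_nonneg y)
          rw [← abs_pow, ← abs_pow, ← abs_mul]
          exact le_abs_self _
      _ ≤ y ^ 2 * (|x| ^ (2 * k) + |y| ^ (2 * k)) := by gcongr
      _ = _ := by rw [← hxe, ← hye]; ring
  have hchoose : ∑ m ∈ Finset.range (2 * k + 1), ((2 * k + 2).choose (m + 2) : ℝ)
      ≤ 4 ^ (k + 1) := by
    have := Nat.sum_range_choose (2 * k + 2)
    rw [Finset.sum_range_succ', Finset.sum_range_succ'] at this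
    have h4 : 2 ^ (2 * k + 2) = 4 ^ (k + 1) := by
      rw [show 2 * k + 2 = 2 * (k + 1) by ring, pow_mul]; norm_num
    have h5 : ∑ m ∈ Finset.range (2 * k + 1), (2 * k + 2).choose (m + 2) ≤ 4 ^ (k + 1) := by
      rw [← h4, ← this]; simp only [add_assoc]; norm_num
    exact_mod_cast h5
  rw [add_comm x y, add_pow, Finset.sum_range_succ', Finset.sum_range_succ']
  have hs := Finset.sum_le_sum hterm
  rw [← Finset.mul_sum] at hs
  have hnn : 0 ≤ x ^ (2 * k) * y ^ 2 + y ^ (2 * k + 2) := by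
    have h1 : (0 : ℝ) ≤ x ^ (2 * k) := by rw [pow_mul]; positivity
    have h2 : (0 : ℝ) ≤ y ^ (2 * k + 2) := by
      rw [show 2 * k + 2 = 2 * (k + 1) by ring, pow_mul]; positivity
    positivity
  have h3 := hs.trans (mul_le_mul_of_nonneg_left hchoose hnn)
  simp only [add_assoc, one_add_one_eq_two] at h3 ⊢
  norm_num at h3 ⊢
  linarith

variable {Ω : Type*} [MeasurableSpace Ω] {μ : Measure Ω}

theorem memLp_pow_integrable {X : Ω → ℝ} [IsFiniteMeasure μ] (h : ∀ p : ℝ≥0, MemLp X p μ)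
    (k : ℕ) : Integrable (fun ω => X ω ^ k) μ := by
  have h1 := (h k).integrable_norm_pow'
  refine h1.mono ((h k).1.pow k) (ae_of_all _ fun ω => ?_)
  simp

/-- Even-moment bound of Marcinkiewicz–Zygmund type, by induction on `k` and, inside, on the number
of summands. When `X P` is added to the partial sum `S`, the linear term drops out by independence
and centring. The mixed term factors into E[S^(2k)] E[(X P)^2], which the outer hypothesis bounds by
a multiple of P^k. Summing increments of order P^k gives P^(k+1). -/
theorem exists_integral_sum_pow_le (k : ℕ) : ∃ C : ℝ, 0 ≤ C ∧
    ∀ {Ω : Type*} [MeasurableSpace Ω] {μ : Measure Ω} [IsProbabilityMeasure μ]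
      (X : ℕ → Ω → ℝ) (b : ℝ),
      0 ≤ b → (∀ i (p : ℝ≥0), MemLp (X i) p μ) → (∀ i, ∫ ω, X i ω ∂μ = 0) →
      (∀ n, IndepFun (fun ω => ∑ i ∈ Finset.range n, X i ω) (X n) μ) →
      (∀ j, j ≤ k → ∀ i, ∫ ω, X i ω ^ (2 * j) ∂μ ≤ b ^ (2 * j)) →
      ∀ P : ℕ, ∫ ω, (∑ i ∈ Finset.range P, X i ω) ^ (2 * k) ∂μ ≤ C * b ^ (2 * k) * P ^ k := by
  induction k with
  | zero => exact ⟨1, by norm_num, by intros; simp⟩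
  | succ k ih =>
    obtain ⟨C, hC0, hC⟩ := ih
    refine ⟨4 ^ (k + 1) * (C + 1), by positivity, ?_⟩
    intro Ω _ μ _ X b hb hm hc hind hbd P
    have hS : ∀ n (p : ℝ≥0), MemLp (fun ω => ∑ i ∈ Finset.range n, X i ω) p μ :=
      fun n p => memLp_finsetSum _ fun i _ => hm i p
    induction P with
    | zero => simp
    | succ P ihP =>
      set S : Ω → ℝ := fun ω => ∑ i ∈ Finset.range P, X i ω with hSdef
      have hprod : ∀ a c : ℕ, Integrable (fun ω => S ω ^ a * X P ω ^ c) μ := fun a c =>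
        ((hind P).comp (φ := fun x => x ^ a) (ψ := fun x => x ^ c) (by fun_prop)
          (by fun_prop)).integrable_mul (memLp_pow_integrable (hS P) a)
          (memLp_pow_integrable (hm P) c)
      have hfac : ∀ a c : ℕ, ∫ ω, S ω ^ a * X P ω ^ c ∂μ
          = (∫ ω, S ω ^ a ∂μ) * ∫ ω, X P ω ^ c ∂μ := fun a c =>
        ((hind P).comp (φ := fun x => x ^ a) (ψ := fun x => x ^ c) (by fun_prop)
          (by fun_prop)).integral_fun_mul_eq_mul_integral
          (memLp_pow_integrable (hS P) a).1 (memLp_pow_integrable (hm P) c).1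
      have h1 : ∫ ω, (∑ i ∈ Finset.range (P + 1), X i ω) ^ (2 * (k + 1)) ∂μ
          ≤ ∫ ω, (S ω ^ (2 * k + 2) + (2 * k + 2) * (S ω ^ (2 * k + 1) * X P ω ^ 1)
            + 4 ^ (k + 1) * (S ω ^ (2 * k) * X P ω ^ 2 + S ω ^ 0 * X P ω ^ (2 * k + 2))) ∂μ := by
        refine integral_mono (memLp_pow_integrable (hS (P + 1)) _) ?_ fun ω => ?_
        · exact ((memLp_pow_integrable (hS P) _).add ((hprod _ _).const_mul _)).add
            (((hprod _ _).add (hprod _ _)).const_mul _)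
        · simp only [Finset.sum_range_succ, pow_one, pow_zero, one_mul]
          exact add_pow_even_le _ _ k
      have h2 : ∫ ω, (S ω ^ (2 * k + 2) + (2 * k + 2) * (S ω ^ (2 * k + 1) * X P ω ^ 1)
            + 4 ^ (k + 1) * (S ω ^ (2 * k) * X P ω ^ 2 + S ω ^ 0 * X P ω ^ (2 * k + 2))) ∂μ
          = ∫ ω, S ω ^ (2 * k + 2) ∂μ + 4 ^ (k + 1) * ((∫ ω, S ω ^ (2 * k) ∂μ)
              * (∫ ω, X P ω ^ 2 ∂μ) + ∫ ω, X P ω ^ (2 * k + 2) ∂μ) := by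
        have i1 : Integrable (fun ω => S ω ^ (2 * k + 2)) μ := memLp_pow_integrable (hS P) _
        have i2 := (hprod (2 * k + 1) 1).const_mul (2 * k + 2 : ℝ)
        have i12 : Integrable (fun ω => S ω ^ (2 * k + 2)
          + (2 * k + 2) * (S ω ^ (2 * k + 1) * X P ω ^ 1)) μ := i1.add i2
        have i3 : Integrable (fun ω => S ω ^ (2 * k) * X P ω ^ 2
          + S ω ^ 0 * X P ω ^ (2 * k + 2)) μ := (hprod _ _).add (hprod _ _)
        rw [integral_add i12 (i3.const_mul _), integral_add i1 i2,
          integral_const_mul, integral_const_mul, integral_add (hprod _ _) (hprod _ _),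
          hfac, hfac, hfac]
        simp [hc]
      have h3 := hC X b hb hm hc hind (fun j hj i => hbd j (hj.trans k.le_succ) i) P
      have h4 := hbd (k + 1) le_rfl P
      have h5 := hbd 1 (by omega) P
      simp only [mul_one] at h5
      have h6 : (∫ ω, S ω ^ (2 * k) ∂μ) * (∫ ω, X P ω ^ 2 ∂μ)
          ≤ (C * b ^ (2 * k) * P ^ k) * b ^ 2 := by
        refine mul_le_mul h3 h5 (integral_nonneg fun ω => sq_nonneg _) (by positivity)
      have hP1 : (P : ℝ) ^ k ≤ (P + 1) ^ k := by gcongr; linarith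
      have hP2 : (1 : ℝ) ≤ (P + 1) ^ k := one_le_pow₀ (by linarith [Nat.cast_nonneg (α := ℝ) P])
      have hP3 : (P : ℝ) ^ (k + 1) + (P + 1) ^ k ≤ (P + 1 : ℝ) ^ (k + 1) := by
        rw [pow_succ, pow_succ]
        nlinarith [mul_le_mul_of_nonneg_right hP1 (Nat.cast_nonneg (α := ℝ) P)]
      have hbk : 0 ≤ b ^ (2 * (k + 1)) := by positivity
      calc ∫ ω, (∑ i ∈ Finset.range (P + 1), X i ω) ^ (2 * (k + 1)) ∂μ
          ≤ 4 ^ (k + 1) * (C + 1) * b ^ (2 * (k + 1)) * P ^ (k + 1)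
            + 4 ^ (k + 1) * ((C * b ^ (2 * k) * P ^ k) * b ^ 2 + b ^ (2 * (k + 1))) := by
            rw [h2] at h1
            refine h1.trans (add_le_add ihP ?_)
            gcongr
            exact h4
        _ = 4 ^ (k + 1) * b ^ (2 * (k + 1)) * ((C + 1) * P ^ (k + 1) + (C * P ^ k + 1)) := by
            ring
        _ ≤ 4 ^ (k + 1) * b ^ (2 * (k + 1)) * ((C + 1) * P ^ (k + 1) + (C + 1) * (P + 1) ^ k) := by
            gcongr
            nlinarith [mul_le_mul_of_nonneg_left hP1 hC0]
        _ ≤ 4 ^ (k + 1) * b ^ (2 * (k + 1)) * ((C + 1) * (P + 1 : ℝ) ^ (k + 1)) := by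
            gcongr
            nlinarith
        _ = _ := by push_cast; ring

theorem eLpNorm_even_le_iff {X : Ω → ℝ} {k : ℕ} (hk : k ≠ 0)
    (h : MemLp X ((2 * k : ℕ) : ℝ≥0) μ) {b : ℝ} (hb : 0 ≤ b) :
    eLpNorm X ((2 * k : ℕ) : ℝ≥0) μ ≤ ENNReal.ofReal b ↔ ∫ ω, X ω ^ (2 * k) ∂μ ≤ b ^ (2 * k) := by
  have h0 : (((2 * k : ℕ) : ℝ≥0) : ℝ≥0∞) ≠ 0 := by
    simp only [ENNReal.coe_natCast]; exact_mod_cast (by omega : 2 * k ≠ 0)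
  rw [h.eLpNorm_eq_integral_rpow_norm h0 ENNReal.coe_ne_top, ENNReal.ofReal_le_ofReal_iff hb]
  have h1 : ∀ ω, ‖X ω‖ ^ (((2 * k : ℕ) : ℝ≥0) : ℝ≥0∞).toReal = X ω ^ (2 * k) := fun ω => by
    simp only [ENNReal.coe_toReal, NNReal.coe_natCast, Real.rpow_natCast]
    rw [pow_mul, pow_mul, Real.norm_eq_abs, sq_abs]
  simp_rw [h1]
  simp only [ENNReal.coe_toReal, NNReal.coe_natCast]
  rw [Real.rpow_inv_le_iff_of_pos (integral_nonneg fun ω => by rw [pow_mul]; positivity) hb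
    (by positivity), Real.rpow_natCast]

/-- Averages of `P` independent centred random variables are smaller by the factor `P^{-1/2}`. -/
theorem LpO.average_indep [IsProbabilityMeasure μ] {Λ : Type*} {Z : Λ → ℕ → Ω → ℝ}
    {ρ : Λ → ℝ≥0} (h : LpO μ (fun q : Λ × ℕ => Z q.1 q.2) (fun q => ρ q.1)) (P : Λ → ℕ)
    (hc : ∀ a i, ∫ ω, Z a i ω ∂μ = 0)
    (hind : ∀ a n, IndepFun (fun ω => ∑ i ∈ Finset.range n, Z a i ω) (Z a n) μ) :
    LpO μ (fun a ω => (∑ i ∈ Finset.range (P a), Z a i ω) / P a)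
      (fun a => ρ a * (NNReal.sqrt (P a))⁻¹) := by
  have hm := (h.average P).meas
  refine of_two_le hm fun p hp => ?_
  -- The exponent is enlarged to an even integer `2k`, where the norm is a moment of a polynomial of
  -- the sum.
  obtain ⟨k, hk⟩ := exists_nat_ge p
  have hk0 : k ≠ 0 := by
    rintro rfl
    simp only [Nat.cast_zero] at hk
    exact absurd (hp.trans hk) (by norm_num)
  obtain ⟨C, hC⟩ := h.bound ((2 * k : ℕ) : ℝ≥0)
  obtain ⟨D, hD0, hD⟩ := exists_integral_sum_pow_le k
  -- `1 + D` replaces the `2k`-th root of `D`, as `D ≤ (1 + D) ^ (2 * k)`.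
  refine ⟨(Real.toNNReal (1 + D)) * C, fun a => ?_⟩
  rcases Nat.eq_zero_or_pos (P a) with h0 | h0
  · simp [h0]
  have hmono : (p : ℝ≥0∞) ≤ ((2 * k : ℕ) : ℝ≥0) := by
    refine ENNReal.coe_le_coe.2 (hk.trans ?_)
    push_cast
    exact le_mul_of_one_le_left (by positivity) (by norm_num)
  refine (eLpNorm_le_eLpNorm_of_exponent_le hmono (hm a)).trans ?_
  rw [← ENNReal.ofReal_coe_nnreal (p := _ * _), eLpNorm_even_le_iff hk0 ((h.average P).memLp a _) (by positivity)]
  have hb : ∀ j, j ≤ k → ∀ i, ∫ ω, Z a i ω ^ (2 * j) ∂μ ≤ ((C * ρ a : ℝ≥0) : ℝ) ^ (2 * j) := by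
    intro j hj i
    rcases Nat.eq_zero_or_pos j with hj0 | hj0
    · simp [hj0]
    rw [← eLpNorm_even_le_iff hj0.ne' (h.memLp (a, i) _) (by positivity), ENNReal.ofReal_coe_nnreal]
    refine le_trans (eLpNorm_le_eLpNorm_of_exponent_le ?_ (h.meas (a, i))) (hC (a, i))
    exact_mod_cast (by omega : 2 * j ≤ 2 * k)
  have := hD (Z a) _ (by positivity) (fun i p => h.memLp (a, i) p) (hc a) (hind a) hb (P a)
  simp_rw [div_pow]
  rw [integral_div]
  have hPpos : (0 : ℝ) < P a := by exact_mod_cast h0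
  rw [div_le_iff₀ (by positivity)]
  refine this.trans ?_
  have hsq : ((NNReal.sqrt (P a) : ℝ≥0) : ℝ) ^ (2 * k) = (P a : ℝ) ^ k := by
    rw [pow_mul]; congr 1; simp
  push_cast
  rw [Real.coe_toNNReal _ (by positivity)]
  have e : ((1 + D) * (C : ℝ) * ((ρ a : ℝ) * (NNReal.sqrt (P a) : ℝ)⁻¹)) ^ (2 * k)
      * (P a : ℝ) ^ (2 * k) = (1 + D) ^ (2 * k) * (C * ρ a) ^ (2 * k) * (P a) ^ k := by
    have hs0 : ((NNReal.sqrt (P a) : ℝ≥0) : ℝ) ^ (2 * k) ≠ 0 := by rw [hsq]; positivity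
    have h2 : (P a : ℝ) ^ (2 * k) = (P a : ℝ) ^ k * (P a : ℝ) ^ k := by rw [← pow_add]; congr 1; ring
    simp only [mul_pow, inv_pow]
    rw [hsq, h2]
    field_simp
  have e' := e
  simp only [Real.coe_sqrt, NNReal.coe_natCast] at e' ⊢
  rw [e']
  gcongr
  calc D ≤ 1 + D := by linarith
    _ = (1 + D) ^ 1 := (pow_one _).symm
    _ ≤ (1 + D) ^ (2 * k) := pow_le_pow_right₀ (by linarith) (by omega)

/-! ### Independent families of three kinds of inputs -/

section Triples

variable {Ω A B C I J K : Type*} [mΩ : MeasurableSpace Ω] [MeasurableSpace A] [MeasurableSpace B]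
  [MeasurableSpace C]

/-- The σ-algebras generated by the members of three families of random variables. -/
abbrev tripleSpace (X : I → Ω → A) (Y : J → Ω → B) (Z : K → Ω → C) :
    I ⊕ (J ⊕ K) → MeasurableSpace Ω :=
  Sum.elim (fun i => MeasurableSpace.comap (X i) inferInstance)
    (Sum.elim (fun j => MeasurableSpace.comap (Y j) inferInstance)
      (fun k => MeasurableSpace.comap (Z k) inferInstance))

/-- The information contained in the members with index in `s`. -/
abbrev tripleInfo (X : I → Ω → A) (Y : J → Ω → B) (Z : K → Ω → C) (s : Set (I ⊕ (J ⊕ K))) :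
    MeasurableSpace Ω := ⨆ u ∈ s, tripleSpace X Y Z u

variable {X : I → Ω → A} {Y : J → Ω → B} {Z : K → Ω → C} {μ : Measure Ω}

theorem tripleSpace_le (hX : ∀ i, Measurable (X i)) (hY : ∀ j, Measurable (Y j))
    (hZ : ∀ k, Measurable (Z k)) (u : I ⊕ (J ⊕ K)) : tripleSpace X Y Z u ≤ mΩ := by
  rcases u with i | j | k
  · exact (hX i).comap_le
  · exact (hY j).comap_le
  · exact (hZ k).comap_le

theorem tripleInfo_le (hX : ∀ i, Measurable (X i)) (hY : ∀ j, Measurable (Y j))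
    (hZ : ∀ k, Measurable (Z k)) (s : Set (I ⊕ (J ⊕ K))) : tripleInfo X Y Z s ≤ mΩ :=
  iSup₂_le fun u _ => tripleSpace_le hX hY hZ u

theorem tripleInfo_mono {s t : Set (I ⊕ (J ⊕ K))} (h : s ⊆ t) :
    tripleInfo X Y Z s ≤ tripleInfo X Y Z t :=
  biSup_mono h

theorem measurable_tripleInfo_left {s : Set (I ⊕ (J ⊕ K))} {i : I} (h : Sum.inl i ∈ s) :
    Measurable[tripleInfo X Y Z s] (X i) :=
  (comap_measurable (X i)).mono
    (le_iSup₂ (f := fun u (_ : u ∈ s) => tripleSpace X Y Z u) (Sum.inl i) h) le_rfl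

theorem measurable_tripleInfo_mid {s : Set (I ⊕ (J ⊕ K))} {j : J} (h : Sum.inr (Sum.inl j) ∈ s) :
    Measurable[tripleInfo X Y Z s] (Y j) :=
  (comap_measurable (Y j)).mono
    (le_iSup₂ (f := fun u (_ : u ∈ s) => tripleSpace X Y Z u) (Sum.inr (Sum.inl j)) h) le_rfl

theorem measurable_tripleInfo_right {s : Set (I ⊕ (J ⊕ K))} {k : K}
    (h : Sum.inr (Sum.inr k) ∈ s) : Measurable[tripleInfo X Y Z s] (Z k) :=
  (comap_measurable (Z k)).mono
    (le_iSup₂ (f := fun u (_ : u ∈ s) => tripleSpace X Y Z u) (Sum.inr (Sum.inr k)) h) le_rfl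

/-- Disjoint blocks of an independent family generate independent σ-algebras. Independence of the
inputs thereby becomes disjointness of index sets. -/
theorem indep_of_tripleInfo {m₁ m₂ : MeasurableSpace Ω} {mΩ : MeasurableSpace Ω}
    {μ : Measure Ω} (hX : ∀ i, Measurable (X i)) (hY : ∀ j, Measurable (Y j))
    (hZ : ∀ k, Measurable (Z k)) (h : iIndep (tripleSpace X Y Z) μ) {s t : Set (I ⊕ (J ⊕ K))}
    (hst : Disjoint s t) (h₁ : m₁ ≤ tripleInfo X Y Z s)
    (h₂ : m₂ ≤ tripleInfo X Y Z t) : Indep m₁ m₂ μ :=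
  indep_of_indep_of_le_left (indep_of_indep_of_le_right
    (indep_iSup_of_disjoint (tripleSpace_le hX hY hZ) h hst) h₂) h₁

theorem indepFun_of_tripleInfo (hX : ∀ i, Measurable (X i)) (hY : ∀ j, Measurable (Y j))
    (hZ : ∀ k, Measurable (Z k)) (h : iIndep (tripleSpace X Y Z) μ) {s t : Set (I ⊕ (J ⊕ K))}
    (hst : Disjoint s t) {E F : Type*} [MeasurableSpace E] [MeasurableSpace F] {f : Ω → E}
    {g : Ω → F} (hf : Measurable[tripleInfo X Y Z s] f) (hg : Measurable[tripleInfo X Y Z t] g) :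
    IndepFun f g μ := by
  rw [IndepFun_iff_Indep]
  exact indep_of_tripleInfo hX hY hZ h hst hf.comap_le hg.comap_le

/-- The joint law of three families of independent random variables. -/
theorem map_triple_eq [IsProbabilityMeasure μ] (hX : ∀ i, Measurable (X i))
    (hY : ∀ j, Measurable (Y j)) (hZ : ∀ k, Measurable (Z k)) (h : iIndep (tripleSpace X Y Z) μ)
    {a : I → Measure A} {b : J → Measure B} {c : K → Measure C} [∀ i, IsProbabilityMeasure (a i)]
    [∀ j, IsProbabilityMeasure (b j)] [∀ k, IsProbabilityMeasure (c k)]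
    (ha : ∀ i, μ.map (X i) = a i) (hb : ∀ j, μ.map (Y j) = b j) (hc : ∀ k, μ.map (Z k) = c k) :
    μ.map (fun ω => ((fun i => X i ω : I → A), (fun j => Y j ω : J → B), (fun k => Z k ω : K → C)))
      = (Measure.infinitePi a).prod ((Measure.infinitePi b).prod (Measure.infinitePi c)) := by
  have hX' : Measurable fun ω i => X i ω := measurable_pi_lambda _ hX
  have hY' : Measurable fun ω i => Y i ω := measurable_pi_lambda _ hY
  have hZ' : Measurable fun ω i => Z i ω := measurable_pi_lambda _ hZ
  have iX : iIndepFun X μ := by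
    rw [iIndepFun_iff_iIndep]
    exact h.precomp (g := Sum.inl) Sum.inl_injective
  have iY : iIndepFun Y μ := by
    rw [iIndepFun_iff_iIndep]
    exact h.precomp (g := fun j => Sum.inr (Sum.inl j)) (fun i j hij => by simpa using hij)
  have iZ : iIndepFun Z μ := by
    rw [iIndepFun_iff_iIndep]
    exact h.precomp (g := fun j => Sum.inr (Sum.inr j)) (fun i j hij => by simpa using hij)
  have eX : μ.map (fun ω i => X i ω) = Measure.infinitePi a := by
    rw [iX.map_fun_eq_infinitePi_map hX]; simp_rw [ha]
  have eY : μ.map (fun ω i => Y i ω) = Measure.infinitePi b := by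
    rw [iY.map_fun_eq_infinitePi_map hY]; simp_rw [hb]
  have eZ : μ.map (fun ω i => Z i ω) = Measure.infinitePi c := by
    rw [iZ.map_fun_eq_infinitePi_map hZ]; simp_rw [hc]
  have hYZ : IndepFun (fun ω j => Y j ω) (fun ω k => Z k ω) μ := by
    refine indepFun_of_tripleInfo hX hY hZ h (s := {u | ∃ j, u = Sum.inr (Sum.inl j)})
      (t := {u | ∃ k, u = Sum.inr (Sum.inr k)}) ?_ ?_ ?_
    · rw [Set.disjoint_left]; rintro u ⟨j, rfl⟩ ⟨k, hk⟩; simp at hk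
    · exact @measurable_pi_lambda _ _ _ (_) _ _ fun j => measurable_tripleInfo_mid ⟨j, rfl⟩
    · exact @measurable_pi_lambda _ _ _ (_) _ _ fun j => measurable_tripleInfo_right ⟨j, rfl⟩
  have hXYZ : IndepFun (fun ω i => X i ω)
      (fun ω => ((fun j => Y j ω : J → B), (fun k => Z k ω : K → C))) μ := by
    refine indepFun_of_tripleInfo hX hY hZ h (s := {u | ∃ j, u = Sum.inl j})
      (t := {u | ∃ k, u = Sum.inr k}) ?_ ?_ ?_
    · rw [Set.disjoint_left]; rintro u ⟨j, rfl⟩ ⟨k, hk⟩; simp at hk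
    · exact @measurable_pi_lambda _ _ _ (_) _ _ fun j => measurable_tripleInfo_left ⟨j, rfl⟩
    · refine @Measurable.prodMk _ _ _ _ _ (_) _ _ ?_ ?_
      · exact @measurable_pi_lambda _ _ _ (_) _ _ fun j => measurable_tripleInfo_mid ⟨_, rfl⟩
      · exact @measurable_pi_lambda _ _ _ (_) _ _ fun j => measurable_tripleInfo_right ⟨_, rfl⟩
  rw [(indepFun_iff_map_prod_eq_prod_map_map hX'.aemeasurable
    (hY'.prodMk hZ').aemeasurable).1 hXYZ, (indepFun_iff_map_prod_eq_prod_map_map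
      hY'.aemeasurable hZ'.aemeasurable).1 hYZ, eX, eY, eZ]

end Triples

/-! ### The data of one particle -/

/-- Initial state, driving noises and observation noises of one particle. -/
abbrev ParticleData (d dO : ℕ) (𝓦 : Type*) := Vec d × (ℕ → 𝓦) × (ℕ → Vec dO)

section Particle

variable {d dO : ℕ} {𝓦 : Type*} [MeasurableSpace 𝓦] {Ω : Type*} [MeasurableSpace Ω]

/-- The part of the data of a particle that is known at time `n`. -/
abbrev pastData (d dO : ℕ) (𝓦 : Type*) [MeasurableSpace 𝓦] (n : ℕ) :
    MeasurableSpace (ParticleData d dO 𝓦) :=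
  MeasurableSpace.comap (fun x => x.1) inferInstance
    ⊔ (⨆ k ∈ Finset.range n, MeasurableSpace.comap (fun x => x.2.1 k) inferInstance)
    ⊔ (⨆ j ∈ Finset.Icc 1 n, MeasurableSpace.comap (fun x => x.2.2 j) inferInstance)

theorem pastData_le (n : ℕ) : pastData d dO 𝓦 n ≤ Prod.instMeasurableSpace := by
  refine sup_le (sup_le ?_ ?_) ?_
  · exact measurable_fst.comap_le
  · exact iSup₂_le fun k _ => Measurable.comap_le
      ((measurable_pi_apply k).comp (measurable_fst.comp measurable_snd))
  · exact iSup₂_le fun k _ => Measurable.comap_le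
      ((measurable_pi_apply k).comp (measurable_snd.comp measurable_snd))

theorem pastData_mono {m n : ℕ} (h : m ≤ n) : pastData d dO 𝓦 m ≤ pastData d dO 𝓦 n :=
  sup_le_sup (sup_le_sup le_rfl (biSup_mono fun k hk => by simp at hk ⊢; omega))
    (biSup_mono fun k hk => by simp at hk ⊢; omega)

theorem measurable_pastData_init (n : ℕ) :
    Measurable[pastData d dO 𝓦 n] (fun x : ParticleData d dO 𝓦 => x.1) :=
  (comap_measurable _).mono (le_sup_of_le_left le_sup_left) le_rfl

theorem measurable_pastData_noise {k n : ℕ} (h : k < n) :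
    Measurable[pastData d dO 𝓦 n] (fun x : ParticleData d dO 𝓦 => x.2.1 k) :=
  (comap_measurable _).mono (le_sup_of_le_left (le_sup_of_le_right
    (le_iSup₂_of_le k (Finset.mem_range.2 h) le_rfl))) le_rfl

theorem measurable_pastData_obs {j n : ℕ} (h1 : 1 ≤ j) (h : j ≤ n) :
    Measurable[pastData d dO 𝓦 n] (fun x : ParticleData d dO 𝓦 => x.2.2 j) :=
  (comap_measurable _).mono (le_sup_of_le_right
    (le_iSup₂_of_le j (Finset.mem_Icc.2 ⟨h1, h⟩) le_rfl)) le_rfl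

/-- A map into the data of one particle is measurable if the data known at time `n` are. -/
theorem comap_pastData_le {m : MeasurableSpace Ω} {n : ℕ} {D : Ω → ParticleData d dO 𝓦}
    (h1 : Measurable[m] fun ω => (D ω).1) (h2 : ∀ k < n, Measurable[m] fun ω => (D ω).2.1 k)
    (h3 : ∀ j, Measurable[m] fun ω => (D ω).2.2 j) :
    MeasurableSpace.comap D (pastData d dO 𝓦 n) ≤ m := by
  simp only [pastData, MeasurableSpace.comap_sup, MeasurableSpace.comap_iSup,
    MeasurableSpace.comap_comp]
  refine sup_le (sup_le h1.comap_le ?_) ?_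
  · exact iSup₂_le fun k hk => (h2 k (Finset.mem_range.1 hk)).comap_le
  · exact iSup₂_le fun k _ => (h3 k).comap_le

variable {M : FilterModel d dO 𝓦} {Pr : Measure Ω}

/-- The data of the reference particle. -/
def ReferenceNoise.data (R : ReferenceNoise M Pr) (ω : Ω) : ParticleData d dO 𝓦 :=
  (R.u₀ ω, fun n => R.w n ω, fun n => R.η n ω)

theorem ReferenceNoise.measurable_data (R : ReferenceNoise M Pr) : Measurable R.data :=
  R.measurable_u₀.prodMk ((measurable_pi_lambda _ R.measurable_w).prodMk
    (measurable_pi_lambda _ R.measurable_η))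

theorem ReferenceNoise.comap_data_pastData (R : ReferenceNoise M Pr) (n : ℕ) :
    MeasurableSpace.comap R.data (pastData d dO 𝓦 n) = R.past n := by
  simp only [pastData, MeasurableSpace.comap_sup, MeasurableSpace.comap_iSup,
    MeasurableSpace.comap_comp, ReferenceNoise.past]
  rfl

theorem ReferenceNoise.measurable_comp_data (R : ReferenceNoise M Pr) {n : ℕ} {E : Type*}
    [MeasurableSpace E] {F : ParticleData d dO 𝓦 → E} (hF : Measurable[pastData d dO 𝓦 n] F) :
    Measurable[R.past n] fun ω => F (R.data ω) := by
  rw [← R.comap_data_pastData]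
  exact hF.comp (comap_measurable _)

theorem ReferenceNoise.isProbabilityMeasure_initLaw [IsProbabilityMeasure Pr]
    (R : ReferenceNoise M Pr) : IsProbabilityMeasure M.initLaw :=
  R.law_u₀ ▸ Measure.isProbabilityMeasure_map R.measurable_u₀.aemeasurable

theorem ReferenceNoise.isProbabilityMeasure_noiseLaw [IsProbabilityMeasure Pr]
    (R : ReferenceNoise M Pr) (n : ℕ) : IsProbabilityMeasure (M.noiseLaw n) :=
  R.law_w n ▸ Measure.isProbabilityMeasure_map (R.measurable_w n).aemeasurable

/-- The law of the data of a particle is determined by the model. -/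
theorem ReferenceNoise.map_data_eq {Ω' : Type*} [MeasurableSpace Ω'] {Pr' : Measure Ω'}
    [IsProbabilityMeasure Pr] [IsProbabilityMeasure Pr'] (R : ReferenceNoise M Pr)
    (R' : ReferenceNoise M Pr') : Pr'.map R'.data = Pr.map R.data := by
  have := R.isProbabilityMeasure_initLaw
  have := R.isProbabilityMeasure_noiseLaw
  have key : ∀ {Ω₁ : Type _} [MeasurableSpace Ω₁] {P₁ : Measure Ω₁} [IsProbabilityMeasure P₁]
      (T : ReferenceNoise M P₁), P₁.map T.data
        = ((Measure.infinitePi fun _ : Unit => M.initLaw).prod ((Measure.infinitePi M.noiseLaw).prod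
          (Measure.infinitePi fun _ : ℕ => multivariateGaussian 0 M.Γ))).map
            fun q => (q.1 (), q.2) := by
    intro Ω₁ _ P₁ _ T
    rw [← map_triple_eq (X := fun _ : Unit => T.u₀) (fun _ => T.measurable_u₀) T.measurable_w
      T.measurable_η T.indep (fun _ => T.law_u₀) T.law_w T.law_η, Measure.map_map]
    · rfl
    · fun_prop
    · exact (measurable_pi_lambda _ fun _ => T.measurable_u₀).prodMk
        ((measurable_pi_lambda _ T.measurable_w).prodMk (measurable_pi_lambda _ T.measurable_η))
  have key' : Pr'.map R'.data
        = ((Measure.infinitePi fun _ : Unit => M.initLaw).prod ((Measure.infinitePi M.noiseLaw).prod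
          (Measure.infinitePi fun _ : ℕ => multivariateGaussian 0 M.Γ))).map
            fun q => (q.1 (), q.2) := by
    rw [← map_triple_eq (X := fun _ : Unit => R'.u₀) (fun _ => R'.measurable_u₀) R'.measurable_w
      R'.measurable_η R'.indep (fun _ => R'.law_u₀) R'.law_w R'.law_η, Measure.map_map]
    · rfl
    · fun_prop
    · exact (measurable_pi_lambda _ fun _ => R'.measurable_u₀).prodMk
        ((measurable_pi_lambda _ R'.measurable_w).prodMk (measurable_pi_lambda _ R'.measurable_η))
  rw [key R, key']

/-- The driving noise after time `n` is independent of the past. -/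
theorem ReferenceNoise.indep_w (R : ReferenceNoise M Pr) (n : ℕ) :
    Indep (R.past n) (MeasurableSpace.comap (R.w n) inferInstance) Pr := by
  have hn : MeasurableSpace.comap (R.w n) inferInstance ≤
      tripleInfo (fun _ : Unit => R.u₀) R.w R.η {Sum.inr (Sum.inl n)} :=
    Measurable.comap_le (measurable_tripleInfo_mid rfl)
  refine indep_of_tripleInfo (X := fun _ : Unit => R.u₀) (fun _ => R.measurable_u₀)
    R.measurable_w R.measurable_η R.indep (s := {Sum.inr (Sum.inl n)}ᶜ)
    disjoint_compl_left ?_ hn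
  refine sup_le (sup_le ?_ ?_) ?_
  · exact Measurable.comap_le
      (measurable_tripleInfo_left (X := fun _ : Unit => R.u₀) (i := ()) (by simp))
  · exact iSup₂_le fun k hk => Measurable.comap_le (measurable_tripleInfo_mid (by simp at hk ⊢; omega))
  · exact iSup₂_le fun k hk => Measurable.comap_le (measurable_tripleInfo_right (by simp))

theorem ReferenceNoise.indepFun_w (R : ReferenceNoise M Pr) {n : ℕ} {E : Type*}
    [MeasurableSpace E] {f : Ω → E} (hf : Measurable[R.past n] f) : IndepFun f (R.w n) Pr := by
  rw [IndepFun_iff_Indep]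
  exact indep_of_indep_of_le_left (R.indep_w n) hf.comap_le

/-- The observation noise at time `n + 1` is independent of the past and of the driving noise up
to time `n + 1`. -/
theorem ReferenceNoise.indepFun_η (R : ReferenceNoise M Pr) {n : ℕ} {E : Type*}
    [MeasurableSpace E] {f : Ω → E}
    (hf : Measurable[R.past n ⊔ MeasurableSpace.comap (R.w n) inferInstance] f) :
    IndepFun f (R.η (n + 1)) Pr := by
  refine indepFun_of_tripleInfo (X := fun _ : Unit => R.u₀) (fun _ => R.measurable_u₀)
    R.measurable_w R.measurable_η R.indep (s := {Sum.inr (Sum.inr (n + 1))}ᶜ)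
    (t := {Sum.inr (Sum.inr (n + 1))})
    disjoint_compl_left (hf.mono ?_ le_rfl) (measurable_tripleInfo_right rfl)
  refine sup_le (sup_le (sup_le ?_ ?_) ?_) ?_
  · exact Measurable.comap_le
      (measurable_tripleInfo_left (X := fun _ : Unit => R.u₀) (i := ()) (by simp))
  · exact iSup₂_le fun k hk => Measurable.comap_le (measurable_tripleInfo_mid (by simp))
  · exact iSup₂_le fun k hk => Measurable.comap_le
      (measurable_tripleInfo_right (by simp at hk ⊢; omega))
  · exact Measurable.comap_le (measurable_tripleInfo_mid (by simp))

end Particle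

/-! ### The random inputs of one ensemble -/

/-- Initial states, driving noises and observation noises of infinitely many particles. -/
structure EnsembleInput {d dO : ℕ} {𝓦 : Type*} [MeasurableSpace 𝓦] (M : FilterModel d dO 𝓦)
    {Ω' : Type*} [MeasurableSpace Ω'] (Pr' : Measure Ω') where
  init : ℕ → Ω' → Vec d
  noise : ℕ × ℕ → Ω' → 𝓦
  obs : ℕ × ℕ → Ω' → Vec dO
  measurable_init : ∀ i, Measurable (init i)
  measurable_noise : ∀ a, Measurable (noise a)
  measurable_obs : ∀ a, Measurable (obs a)
  law_init : ∀ i, Pr'.map (init i) = M.initLaw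
  law_noise : ∀ a, Pr'.map (noise a) = M.noiseLaw a.1
  law_obs : ∀ a, Pr'.map (obs a) = multivariateGaussian 0 M.Γ
  indep : iIndep (tripleSpace init noise obs) Pr'

namespace EnsembleInput

variable {d dO : ℕ} {𝓦 : Type*} [MeasurableSpace 𝓦] {M : FilterModel d dO 𝓦}
  {Ω' : Type*} [mΩ' : MeasurableSpace Ω'] {Pr' : Measure Ω'}

/-- The realized inputs. -/
def drivers (E : EnsembleInput M Pr') (ω : Ω') : Drivers d dO 𝓦 where
  init i := E.init i ω
  noise n i := E.noise (n, i) ω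
  obs n i := E.obs (n, i) ω

/-- The data of particle `i`. -/
def data (E : EnsembleInput M Pr') (i : ℕ) (ω : Ω') : ParticleData d dO 𝓦 :=
  (E.init i ω, fun n => E.noise (n, i) ω, fun n => E.obs (n, i) ω)

/-- Particle `i` as the input of a filtering problem. -/
def particle (E : EnsembleInput M Pr') (i : ℕ) : ReferenceNoise M Pr' where
  u₀ := E.init i
  w n := E.noise (n, i)
  η n := E.obs (n, i)
  measurable_u₀ := E.measurable_init i
  measurable_w n := E.measurable_noise (n, i)
  measurable_η n := E.measurable_obs (n, i)
  law_u₀ := E.law_init i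
  law_w n := E.law_noise (n, i)
  law_η n := E.law_obs (n, i)
  indep := by
    have := E.indep.precomp (g := Sum.elim (fun _ : Unit => Sum.inl i)
      (Sum.elim (fun n : ℕ => Sum.inr (Sum.inl (n, i))) (fun n : ℕ => Sum.inr (Sum.inr (n, i))))) ?_
    · convert! this using 1
      ext u : 1
      rcases u with u | u | u <;> rfl
    · rintro (u | u | u) (v | v | v) h <;> simp at h ⊢ <;> exact h

theorem measurable_data (E : EnsembleInput M Pr') (i : ℕ) : Measurable (E.data i) :=
  (E.particle i).measurable_data

theorem map_data [IsProbabilityMeasure Pr'] (E : EnsembleInput M Pr') {Ω : Type*}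
    [MeasurableSpace Ω] {Pr : Measure Ω} [IsProbabilityMeasure Pr] (R : ReferenceNoise M Pr)
    (i : ℕ) : Pr'.map (E.data i) = Pr.map R.data :=
  R.map_data_eq (E.particle i)

/-- The information available at time `n` (with all observation noises). -/
abbrev past (E : EnsembleInput M Pr') (n : ℕ) : MeasurableSpace Ω' :=
  tripleInfo E.init E.noise E.obs {u | ∀ a, u = Sum.inr (Sum.inl a) → a.1 < n}

theorem past_le (E : EnsembleInput M Pr') (n : ℕ) : E.past n ≤ mΩ' :=
  tripleInfo_le E.measurable_init E.measurable_noise E.measurable_obs _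

theorem past_mono (E : EnsembleInput M Pr') {m n : ℕ} (h : m ≤ n) : E.past m ≤ E.past n :=
  tripleInfo_mono fun _ hu a ha => (hu a ha).trans_le h

theorem measurable_past_init (E : EnsembleInput M Pr') (n i : ℕ) :
    Measurable[E.past n] (E.init i) :=
  measurable_tripleInfo_left (by simp)

theorem measurable_past_obs (E : EnsembleInput M Pr') (n : ℕ) (a : ℕ × ℕ) :
    Measurable[E.past n] (E.obs a) :=
  measurable_tripleInfo_right (by simp)

theorem measurable_past_noise (E : EnsembleInput M Pr') {n k : ℕ} (h : k < n) (i : ℕ) :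
    Measurable[E.past n] (E.noise (k, i)) :=
  measurable_tripleInfo_mid (by
    rintro a ha
    simp only [Sum.inr.injEq, Sum.inl.injEq] at ha
    rw [← ha]
    exact h)

theorem measurable_comp_data (E : EnsembleInput M Pr') {n : ℕ} (i : ℕ) {F : Type*}
    [MeasurableSpace F] {f : ParticleData d dO 𝓦 → F} (hf : Measurable[pastData d dO 𝓦 n] f) :
    Measurable[E.past n] fun ω => f (E.data i ω) := by
  refine (hf.comp (comap_measurable (E.data i))).mono ?_ le_rfl
  exact comap_pastData_le (E.measurable_past_init n i) (fun k hk => E.measurable_past_noise hk i)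
    fun j => E.measurable_past_obs n (j, i)

/-- The index set of `past n` contains no driving noise of time `n` or later. The particles at time
`n` interact with each other, yet jointly they use only this information, so the next driving noise
of any of them is fresh. -/
theorem indepFun_noise (E : EnsembleInput M Pr') {n : ℕ} (i : ℕ) {F : Type*}
    [MeasurableSpace F] {f : Ω' → F} (hf : Measurable[E.past n] f) :
    IndepFun f (E.noise (n, i)) Pr' := by
  refine indepFun_of_tripleInfo E.measurable_init E.measurable_noise E.measurable_obs E.indep
    (t := {Sum.inr (Sum.inl (n, i))}) ?_ hf (measurable_tripleInfo_mid rfl)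
  rw [Set.disjoint_singleton_right]
  intro h
  exact lt_irrefl _ (h (n, i) rfl)

/-- The particles are independent of each other. -/
theorem indepFun_sum_data (E : EnsembleInput M Pr') {F : ParticleData d dO 𝓦 → ℝ}
    (hF : Measurable F) (n : ℕ) :
    IndepFun (fun ω => ∑ i ∈ Finset.range n, F (E.data i ω)) (fun ω => F (E.data n ω)) Pr' := by
  have key : ∀ (s : Set ℕ) (i : ℕ), i ∈ s → Measurable[tripleInfo E.init E.noise E.obs
      {u | Sum.elim id (Sum.elim Prod.snd Prod.snd) u ∈ s}] (fun ω => F (E.data i ω)) := by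
    intro s i hi
    refine hF.comp (@Measurable.prodMk _ _ _ _ _ (_) _ _ (measurable_tripleInfo_left hi)
      (@Measurable.prodMk _ _ _ _ _ (_) _ _ ?_ ?_))
    · exact @measurable_pi_lambda _ _ _ (_) _ _ fun k => measurable_tripleInfo_mid hi
    · exact @measurable_pi_lambda _ _ _ (_) _ _ fun k => measurable_tripleInfo_right hi
  refine indepFun_of_tripleInfo E.measurable_init E.measurable_noise E.measurable_obs E.indep
    (s := {u | Sum.elim id (Sum.elim Prod.snd Prod.snd) u ∈ Set.Iio n})
    (t := {u | Sum.elim id (Sum.elim Prod.snd Prod.snd) u ∈ ({n} : Set ℕ)}) ?_ ?_ (key _ n rfl)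
  · rw [Set.disjoint_left]
    intro u h1 h2
    simp only [Set.mem_Iio, Set.mem_ofPred_eq, Set.mem_singleton_iff] at h1 h2
    omega
  · exact @Finset.measurable_fun_sum _ _ _ _ _ _ (_) _ _ fun i hi => key _ i (by simpa using hi)

/-- The law of all inputs is determined by the model. -/
theorem map_all_eq [IsProbabilityMeasure Pr'] (E E' : EnsembleInput M Pr') :
    Pr'.map (fun ω => ((fun i => E.init i ω : ℕ → Vec d), (fun a => E.noise a ω : ℕ × ℕ → 𝓦),
        (fun a => E.obs a ω : ℕ × ℕ → Vec dO)))
      = Pr'.map (fun ω => ((fun i => E'.init i ω : ℕ → Vec d), (fun a => E'.noise a ω : ℕ × ℕ → 𝓦),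
        (fun a => E'.obs a ω : ℕ × ℕ → Vec dO))) := by
  have := (E.particle 0).isProbabilityMeasure_initLaw
  have := (E.particle 0).isProbabilityMeasure_noiseLaw
  rw [map_triple_eq E.measurable_init E.measurable_noise E.measurable_obs E.indep E.law_init
      E.law_noise E.law_obs, map_triple_eq E'.measurable_init E'.measurable_noise E'.measurable_obs
      E'.indep E'.law_init E'.law_noise E'.law_obs]

end EnsembleInput

/-- The inputs of the particles `q, q + 1, …` in the `m`-th sample on level `l`. -/
def EnsembleNoise.input {d dO : ℕ} {𝓦 : Type*} [MeasurableSpace 𝓦] {M : FilterModel d dO 𝓦}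
    {Ω' : Type*} [MeasurableSpace Ω'] {Pr' : Measure Ω'} (S : EnsembleNoise M Pr') (l m q : ℕ) :
    EnsembleInput M Pr' where
  init i := S.init (l, m, i + q)
  noise a := S.noise (l, m, a.1, a.2 + q)
  obs a := S.obs (l, m, a.1, a.2 + q)
  measurable_init i := S.measurable_init _
  measurable_noise n := S.measurable_noise _
  measurable_obs n := S.measurable_obs _
  law_init i := S.law_init _
  law_noise n := S.law_noise _ _ _ _
  law_obs n := S.law_obs _
  indep := by
    have := S.indep.precomp (g := Sum.elim (fun i : ℕ => Sum.inl (l, m, i + q))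
      (Sum.elim (fun a : ℕ × ℕ => Sum.inr (Sum.inl (l, m, a.1, a.2 + q)))
        (fun a : ℕ × ℕ => Sum.inr (Sum.inr (l, m, a.1, a.2 + q))))) ?_
    · convert! this using 1
      ext u : 1
      rcases u with u | u | u <;> rfl
    · rintro (u | u | u) (v | v | v) h <;> simp at h ⊢ <;>
        first | exact h | exact Prod.ext h.1 h.2

/-! ### Vectors and coordinates -/

section Vectors

variable {d : ℕ} {Ω Λ : Type*}

theorem measurable_vec {m : MeasurableSpace Ω} {V : Ω → Vec d}
    (h : ∀ a, Measurable fun ω => V ω a) : Measurable V :=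
  (MeasurableEquiv.toLp 2 (Fin d → ℝ)).measurable.comp (measurable_pi_lambda _ h)

theorem measurable_coord (a : Fin d) : Measurable fun x : Vec d => x a :=
  (EuclideanSpace.proj (𝕜 := ℝ) a).continuous.measurable

theorem norm_vec_le_sum (x : Vec d) : ‖x‖ ≤ ∑ a, |x a| := by
  rw [EuclideanSpace.norm_eq, Real.sqrt_le_left (Finset.sum_nonneg fun a _ => abs_nonneg _)]
  simp only [Real.norm_eq_abs]
  exact Finset.sum_sq_le_sq_sum_of_nonneg fun a _ => abs_nonneg _

theorem abs_coord_le_norm (x : Vec d) (a : Fin d) : |x a| ≤ ‖x‖ := by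
  simpa using PiLp.norm_apply_le x a

theorem LpO.norm_vec {mΩ : MeasurableSpace Ω} {μ : Measure Ω} [IsProbabilityMeasure μ]
    {V : Λ → Ω → Vec d} {ρ : Λ → ℝ≥0} (hm : ∀ l, Measurable (V l))
    (h : ∀ a, LpO μ (fun l ω => V l ω a) ρ) : LpO μ (fun l ω => ‖V l ω‖) ρ := by
  refine (LpO.sum Finset.univ fun a _ => (h a).abs).of_abs_le
    (fun l => (hm l).norm.aestronglyMeasurable) fun l => ae_of_all _ fun ω => ?_
  rw [abs_norm, abs_of_nonneg (Finset.sum_nonneg fun a _ => abs_nonneg _)]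
  exact norm_vec_le_sum _

end Vectors

/-! ### Families depending on a resolution -/

/-- Pairs of consecutive resolutions and the strong error `δ` of the pair. -/
structure LevelPairs (ι θ : Type*) where
  fine : θ → ι
  coarse : θ → ι
  δ : θ → ℝ≥0

section RegularFamilies

variable {𝓧 ι θ : Type*} [MeasurableSpace 𝓧]

/-- A family of functions of the data of a particle, indexed by the resolution, with uniformly
bounded moments and with differences of order `δ` for pairs of resolutions. -/
structure Regular (Q : Measure 𝓧) (T : LevelPairs ι θ) (F : ι → 𝓧 → ℝ) : Prop where
  meas : ∀ j, Measurable (F j)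
  bdd : LpO Q F 1
  pair : LpO Q (fun τ x => F (T.fine τ) x - F (T.coarse τ) x) T.δ

namespace Regular

variable {Q : Measure 𝓧} [IsProbabilityMeasure Q] {T : LevelPairs ι θ} {F G : ι → 𝓧 → ℝ}

theorem const {c : ι → ℝ} (K K' : ℝ≥0) (h : ∀ j, |c j| ≤ K)
    (h' : ∀ τ, |c (T.fine τ) - c (T.coarse τ)| ≤ K' * T.δ τ) : Regular Q T (fun j _ => c j) where
  meas _ := measurable_const
  bdd := LpO.const K (by simpa using h)
  pair := LpO.const (c := fun τ => c (T.fine τ) - c (T.coarse τ)) K' h'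

theorem fixed {f : 𝓧 → ℝ} (hm : Measurable f) (h : ∀ p : ℝ≥0, MemLp f p Q) :
    Regular Q T (fun _ => f) where
  meas _ := hm
  bdd := ⟨fun _ => hm.aestronglyMeasurable, fun p => by
    refine ⟨(eLpNorm f p Q).toNNReal, fun _ => ?_⟩
    simp [ENNReal.coe_toNNReal (h p).2.ne]⟩
  pair := by simpa using LpO.zero

theorem fixed_const (c : ℝ) : Regular Q T (fun _ _ => c) :=
  fixed measurable_const fun _ => memLp_const c

theorem add (hF : Regular Q T F) (hG : Regular Q T G) : Regular Q T (fun j x => F j x + G j x) where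
  meas j := (hF.meas j).add (hG.meas j)
  bdd := hF.bdd.add hG.bdd
  pair := (hF.pair.add hG.pair).congr fun τ x => by ring

theorem mul (hF : Regular Q T F) (hG : Regular Q T G) : Regular Q T (fun j x => F j x * G j x) where
  meas j := (hF.meas j).mul (hG.meas j)
  bdd := hF.bdd.mul_one_left hG.bdd
  pair := (((hF.bdd.reindex T.fine).mul_one_left hG.pair).add
    (hF.pair.mul_one_right (hG.bdd.reindex T.coarse))).congr fun τ x => by ring

theorem integral (hF : Regular Q T F) : Regular Q T (fun j _ => ∫ x, F j x ∂Q) where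
  meas _ := measurable_const
  bdd := hF.bdd.integral_const
  pair := hF.pair.integral_const.congr fun τ _ =>
    integral_sub (hF.bdd.integrable _) (hF.bdd.integrable _)

theorem neg (hF : Regular Q T F) : Regular Q T (fun j x => -F j x) := by
  simpa using (fixed_const (-1)).mul hF

theorem sub (hF : Regular Q T F) (hG : Regular Q T G) : Regular Q T (fun j x => F j x - G j x) := by
  simpa only [sub_eq_add_neg] using hF.add hG.neg

theorem sum {K : Type*} (s : Finset K) {Z : K → ι → 𝓧 → ℝ} (h : ∀ k ∈ s, Regular Q T (Z k)) :
    Regular Q T (fun j x => ∑ k ∈ s, Z k j x) := by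
  classical
  induction s using Finset.induction_on with
  | empty => simpa using fixed_const 0
  | insert k s hk ih =>
    simp only [Finset.sum_insert hk]
    exact (h k (by simp)).add (ih fun j hj => h j (by simp [hj]))

end Regular

end RegularFamilies

/-! ### Expansions of the particles around the mean-field limit -/

section Expansions

variable {d dO : ℕ} {𝓦 : Type*} [MeasurableSpace 𝓦] {M : FilterModel d dO 𝓦}
  {Ω' : Type*} [MeasurableSpace Ω'] {Pr' : Measure Ω'}

/-- An ensemble of positive size. -/
structure Config (M : FilterModel d dO 𝓦) (Pr' : Measure Ω') where
  E : EnsembleInput M Pr'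
  P : ℕ
  pos : 0 < P

/-- Average over the particles of a function of their data. -/
noncomputable def Config.emp (C : Config M Pr') (F : ParticleData d dO 𝓦 → ℝ) (ω : Ω') : ℝ :=
  (∑ i ∈ Finset.range C.P, F (C.E.data i ω)) / C.P

/-- The Monte Carlo rate `P^{-1/2}`. -/
noncomputable def Config.rate (C : Config M Pr') : ℝ≥0 := (NNReal.sqrt C.P)⁻¹

theorem Config.rate_le_one (C : Config M Pr') : C.rate ≤ 1 := by
  have : (1 : ℝ≥0) ≤ C.P := by exact_mod_cast C.pos
  exact inv_le_one_of_one_le₀ (by simpa using this)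

theorem Config.rate_mul_rate (C : Config M Pr') : C.rate * C.rate = (C.P : ℝ≥0)⁻¹ := by
  rw [Config.rate, ← mul_inv, NNReal.mul_self_sqrt]

/-- `Q` is the law of the data of the particles. -/
class IsParticleLaw (M : FilterModel d dO 𝓦) (Pr' : Measure Ω')
    (Q : Measure (ParticleData d dO 𝓦)) : Prop where
  prob : IsProbabilityMeasure Q
  map_data : ∀ (E : EnsembleInput M Pr') (i : ℕ), Pr'.map (E.data i) = Q
  map_noise : ∀ n, Q.map (fun x => x.2.1 n) = M.noiseLaw n
  prob_noise : ∀ n, IsProbabilityMeasure (M.noiseLaw n)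
  indep : ∀ n, Indep (pastData d dO 𝓦 n)
    (MeasurableSpace.comap (fun x => x.2.1 n) inferInstance) Q

theorem ReferenceNoise.isParticleLaw {Ω : Type*} [MeasurableSpace Ω] {Pr : Measure Ω}
    [IsProbabilityMeasure Pr] [IsProbabilityMeasure Pr'] (R : ReferenceNoise M Pr) :
    IsParticleLaw M Pr' (Pr.map R.data) where
  prob := Measure.isProbabilityMeasure_map R.measurable_data.aemeasurable
  map_data E i := E.map_data R i
  map_noise n := by
    have hm : Measurable fun x : ParticleData d dO 𝓦 => x.2.1 n :=
      (measurable_pi_apply n).comp (measurable_fst.comp measurable_snd)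
    rw [Measure.map_map hm R.measurable_data, ← R.law_w n]
    rfl
  prob_noise := R.isProbabilityMeasure_noiseLaw
  indep n := by
    have hm : Measurable fun x : ParticleData d dO 𝓦 => x.2.1 n :=
      (measurable_pi_apply n).comp (measurable_fst.comp measurable_snd)
    refine (Indep_iff _ _ _).2 fun s t hs ht => ?_
    have hs' := pastData_le n s hs
    obtain ⟨t', ht', rfl⟩ := ht
    rw [Measure.map_apply R.measurable_data (hs'.inter (hm ht')),
      Measure.map_apply R.measurable_data hs', Measure.map_apply R.measurable_data (hm ht')]
    have h1 : MeasurableSet[R.past n] (R.data ⁻¹' s) := by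
      rw [← R.comap_data_pastData]
      exact ⟨s, hs, rfl⟩
    exact (Indep_iff _ _ _).1 (R.indep_w n) _ _ h1 ⟨t', ht', rfl⟩

variable [IsProbabilityMeasure Pr'] {Q : Measure (ParticleData d dO 𝓦)}
  [hQ : IsParticleLaw M Pr' Q] {ι θ : Type*} {T : LevelPairs ι θ}

theorem LpO.comp_data {Λ Λ₀ : Type*} {F : Λ₀ → ParticleData d dO 𝓦 → ℝ} {ρ : Λ₀ → ℝ≥0}
    (h : LpO Q F ρ) (π : Λ → Λ₀) (E : Λ → EnsembleInput M Pr') (i : Λ → ℕ) :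
    LpO Pr' (fun a ω => F (π a) ((E a).data (i a) ω)) (fun a => ρ (π a)) := by
  have hm : ∀ a, AEStronglyMeasurable (F (π a)) (Pr'.map ((E a).data (i a))) := fun a => by
    rw [hQ.map_data]; exact h.meas _
  refine ⟨fun a => (hm a).comp_measurable ((E a).measurable_data _), fun p => ?_⟩
  obtain ⟨C, hC⟩ := h.bound p
  refine ⟨C, fun a => ?_⟩
  have := eLpNorm_map_measure (p := (p : ℝ≥0∞)) (hm a) ((E a).measurable_data _).aemeasurable
  rw [hQ.map_data] at this
  exact (this.symm.le.trans (hC _))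

theorem integral_comp_data {F : ParticleData d dO 𝓦 → ℝ} (hF : Measurable F)
    (E : EnsembleInput M Pr') (i : ℕ) : ∫ ω, F (E.data i ω) ∂Pr' = ∫ x, F x ∂Q := by
  rw [← hQ.map_data E i, integral_map (E.measurable_data i).aemeasurable hF.aestronglyMeasurable]

/-- Data of different particles are independent with common law `Q`, so `LpO.average_indep` provides
the additional factor P^(-1/2). -/
theorem LpO.emp {Λ Λ₀ : Type*} {F : Λ₀ → ParticleData d dO 𝓦 → ℝ} {ρ : Λ₀ → ℝ≥0}
    (h : LpO Q F ρ) (hm : ∀ j, Measurable (F j)) (h0 : ∀ j, ∫ x, F j x ∂Q = 0)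
    (π : Λ → Λ₀) (C : Λ → Config M Pr') :
    LpO Pr' (fun a ω => (C a).emp (F (π a)) ω) (fun a => ρ (π a) * (C a).rate) := by
  have h1 := h.comp_data (M := M) (Pr' := Pr') (fun q : Λ × ℕ => π q.1) (fun q => (C q.1).E)
    (fun q => q.2)
  refine LpO.average_indep (Z := fun a i ω => F (π a) ((C a).E.data i ω)) (ρ := fun a => ρ (π a))
    h1 (fun a => (C a).P) (fun a i => ?_) fun a n => ?_
  · rw [integral_comp_data (Q := Q) (hm _), h0]
  · exact (C a).E.indepFun_sum_data (hm _) n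

/-- The particle quantity `X`, with mean-field limit `Xl`, is an affine function of averages of
independent centred functions of the data, up to an error of order `1 / P`. -/
structure Expands (Q : Measure (ParticleData d dO 𝓦)) (T : LevelPairs ι θ) (n : ℕ)
    (X : ι → Config M Pr' → ℕ → Ω' → ℝ) (Xl : ι → ParticleData d dO 𝓦 → ℝ) : Prop where
  adapted : ∀ j C i, Measurable[C.E.past n] (X j C i)
  limit_adapted : ∀ j, Measurable[pastData d dO 𝓦 n] (Xl j)
  regular : Regular Q T Xl
  expansion : ∃ (J : Type) (_ : Fintype J) (A h : J → ι → ParticleData d dO 𝓦 → ℝ),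
    (∀ k, Regular Q T (A k)) ∧ (∀ k, Regular Q T (h k)) ∧ (∀ k j, ∫ x, h k j x ∂Q = 0) ∧
    LpO Pr' (fun (q : ι × Config M Pr' × ℕ) ω => X q.1 q.2.1 q.2.2 ω
        - Xl q.1 (q.2.1.E.data q.2.2 ω)
        - ∑ k, A k q.1 (q.2.1.E.data q.2.2 ω) * q.2.1.emp (h k q.1) ω)
      (fun q => q.2.1.rate * q.2.1.rate)

namespace Expands

variable {n : ℕ} {X Y : ι → Config M Pr' → ℕ → Ω' → ℝ} {Xl Yl : ι → ParticleData d dO 𝓦 → ℝ}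

theorem linear_part_bdd {J : Type} [Fintype J] {A h : J → ι → ParticleData d dO 𝓦 → ℝ}
    (hA : ∀ k, Regular Q T (A k)) (hh : ∀ k, Regular Q T (h k))
    (h0 : ∀ k j, ∫ x, h k j x ∂Q = 0) :
    LpO Pr' (fun (q : ι × Config M Pr' × ℕ) ω =>
        ∑ k, A k q.1 (q.2.1.E.data q.2.2 ω) * q.2.1.emp (h k q.1) ω)
      (fun q => q.2.1.rate) := by
  refine LpO.sum _ fun k _ => ?_
  have h1 := (hA k).bdd.comp_data (M := M) (Pr' := Pr') (fun q : ι × Config M Pr' × ℕ => q.1)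
    (fun q => q.2.1.E) (fun q => q.2.2)
  have h2 := (hh k).bdd.emp (M := M) (Pr' := Pr') (hh k).meas (h0 k)
    (fun q : ι × Config M Pr' × ℕ => q.1) (fun q => q.2.1)
  exact LpO.mul_one_left h1 (h2.le (by simp))

theorem limit_bdd (hX : Expands Q T n X Xl) :
    LpO Pr' (fun (q : ι × Config M Pr' × ℕ) ω => Xl q.1 (q.2.1.E.data q.2.2 ω)) 1 :=
  hX.regular.bdd.comp_data (M := M) (Pr' := Pr') (fun q : ι × Config M Pr' × ℕ => q.1)
    (fun q => q.2.1.E) (fun q => q.2.2)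

theorem diff (hX : Expands Q T n X Xl) :
    LpO Pr' (fun (q : ι × Config M Pr' × ℕ) ω => X q.1 q.2.1 q.2.2 ω
        - Xl q.1 (q.2.1.E.data q.2.2 ω)) (fun q => q.2.1.rate) := by
  obtain ⟨J, _, A, h, hA, hh, h0, hr⟩ := hX.expansion
  have h1 := linear_part_bdd (M := M) (Pr' := Pr') hA hh h0
  refine ((hr.le fun q => ?_).add h1).congr fun q ω => by ring
  exact mul_le_of_le_one_left' q.2.1.rate_le_one

theorem bdd (hX : Expands Q T n X Xl) :
    LpO Pr' (fun (q : ι × Config M Pr' × ℕ) ω => X q.1 q.2.1 q.2.2 ω) 1 :=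
  ((hX.diff.le fun q => q.2.1.rate_le_one).add hX.limit_bdd).congr fun q ω => by ring

theorem mono (hX : Expands Q T n X Xl) {m : ℕ} (h : n ≤ m) : Expands Q T m X Xl where
  adapted j C i := (hX.adapted j C i).mono (C.E.past_mono h) le_rfl
  limit_adapted j := (hX.limit_adapted j).mono (pastData_mono h) le_rfl
  regular := hX.regular
  expansion := hX.expansion

theorem of_data (h : Regular Q T Xl) (hm : ∀ j, Measurable[pastData d dO 𝓦 n] (Xl j)) :
    Expands Q T n (fun j (C : Config M Pr') i ω => Xl j (C.E.data i ω)) Xl where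
  adapted j C i := C.E.measurable_comp_data i (hm j)
  limit_adapted := hm
  regular := h
  expansion := ⟨Empty, inferInstance, fun k => k.elim, fun k => k.elim, fun k => k.elim,
    fun k => k.elim, fun k => k.elim, by simpa using LpO.zero⟩

theorem const {c : ι → ℝ} (h : Regular Q T fun j _ => c j) :
    Expands Q T n (fun j (_ : Config M Pr') _ _ => c j) (fun j _ => c j) :=
  of_data h fun _ => measurable_const

theorem congr (hX : Expands Q T n X Xl) (h : ∀ j C i ω, X j C i ω = Y j C i ω)
    (hl : ∀ j x, Xl j x = Yl j x) : Expands Q T n Y Yl := by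
  have h1 : X = Y := by ext j C i ω; exact h j C i ω
  have h2 : Xl = Yl := by ext j x; exact hl j x
  exact h1 ▸ h2 ▸ hX

/-- The expansion ignores perturbations of order `1 / P`. It therefore suffices to exhibit a
linearization and to bound the quadratic remainder. -/
theorem add_small (hX : Expands Q T n X Xl) (hY : ∀ j C i, Measurable[C.E.past n] (Y j C i))
    (h : LpO Pr' (fun (q : ι × Config M Pr' × ℕ) ω => Y q.1 q.2.1 q.2.2 ω - X q.1 q.2.1 q.2.2 ω)
      (fun q => q.2.1.rate * q.2.1.rate)) : Expands Q T n Y Xl where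
  adapted := hY
  limit_adapted := hX.limit_adapted
  regular := hX.regular
  expansion := by
    obtain ⟨J, i, A, B, hA, hB, h0, hr⟩ := hX.expansion
    exact ⟨J, i, A, B, hA, hB, h0, (hr.add h).congr fun q ω => by ring⟩

theorem add (hX : Expands Q T n X Xl) (hY : Expands Q T n Y Yl) :
    Expands Q T n (fun j C i ω => X j C i ω + Y j C i ω) (fun j x => Xl j x + Yl j x) where
  adapted j C i := (hX.adapted j C i).add (hY.adapted j C i)
  limit_adapted j := (hX.limit_adapted j).add (hY.limit_adapted j)
  regular := by
    have := hQ.prob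
    exact hX.regular.add hY.regular
  expansion := by
    obtain ⟨J, _, A, h, hA, hh, h0, hr⟩ := hX.expansion
    obtain ⟨J', _, A', h', hA', hh', h0', hr'⟩ := hY.expansion
    refine ⟨J ⊕ J', inferInstance, Sum.elim A A', Sum.elim h h', ?_, ?_, ?_, ?_⟩
    · rintro (k | k)
      exacts [hA k, hA' k]
    · rintro (k | k)
      exacts [hh k, hh' k]
    · rintro (k | k)
      exacts [h0 k, h0' k]
    · refine (hr.add hr').congr fun q ω => ?_
      simp only [Fintype.sum_sum_type, Sum.elim_inl, Sum.elim_inr]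
      ring

/-- The product rule: the coefficients of each factor are multiplied by the limit of the other one,
and the product of the two fluctuations, each of order P^(-1/2), is absorbed in the error. -/
theorem mul (hX : Expands Q T n X Xl) (hY : Expands Q T n Y Yl) :
    Expands Q T n (fun j C i ω => X j C i ω * Y j C i ω) (fun j x => Xl j x * Yl j x) where
  adapted j C i := (hX.adapted j C i).mul (hY.adapted j C i)
  limit_adapted j := (hX.limit_adapted j).mul (hY.limit_adapted j)
  regular := by
    have := hQ.prob
    exact hX.regular.mul hY.regular
  expansion := by
    have := hQ.prob
    have bX := hX.limit_bdd
    have bY := hY.bdd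
    obtain ⟨J, _, A, h, hA, hh, h0, hr⟩ := hX.expansion
    have dY := hY.diff
    obtain ⟨J', _, A', h', hA', hh', h0', hr'⟩ := hY.expansion
    refine ⟨J ⊕ J', inferInstance, Sum.elim (fun k j x => A k j x * Yl j x)
      (fun k j x => A' k j x * Xl j x), Sum.elim h h', ?_, ?_, ?_, ?_⟩
    · rintro (k | k)
      exacts [(hA k).mul hY.regular, (hA' k).mul hX.regular]
    · rintro (k | k)
      exacts [hh k, hh' k]
    · rintro (k | k)
      exacts [h0 k, h0' k]
    · have l := linear_part_bdd (M := M) (Pr' := Pr') hA hh h0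
      -- With remainders r and linear parts l, the remainder of the product is Xl · r_Y + r_X · Y +
      -- l_X · (Y - Yl). Each summand is of order `1 / P`.
      refine (((bX.mul_one_left hr').add (hr.mul_one_right bY)).add (l.mul dY)).congr fun q ω => ?_
      simp only [Fintype.sum_sum_type, Sum.elim_inl, Sum.elim_inr]
      have e1 : ∑ k, A k q.1 (q.2.1.E.data q.2.2 ω) * Yl q.1 (q.2.1.E.data q.2.2 ω)
            * q.2.1.emp (h k q.1) ω
          = (∑ k, A k q.1 (q.2.1.E.data q.2.2 ω) * q.2.1.emp (h k q.1) ω)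
            * Yl q.1 (q.2.1.E.data q.2.2 ω) := by
        rw [Finset.sum_mul]
        exact Finset.sum_congr rfl fun k _ => by ring
      have e2 : ∑ k, A' k q.1 (q.2.1.E.data q.2.2 ω) * Xl q.1 (q.2.1.E.data q.2.2 ω)
            * q.2.1.emp (h' k q.1) ω
          = (∑ k, A' k q.1 (q.2.1.E.data q.2.2 ω) * q.2.1.emp (h' k q.1) ω)
            * Xl q.1 (q.2.1.E.data q.2.2 ω) := by
        rw [Finset.sum_mul]
        exact Finset.sum_congr rfl fun k _ => by ring
      rw [e1, e2]
      ring

theorem sum {K : Type*} (s : Finset K) {Z : K → ι → Config M Pr' → ℕ → Ω' → ℝ}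
    {Zl : K → ι → ParticleData d dO 𝓦 → ℝ} (h : ∀ k ∈ s, Expands Q T n (Z k) (Zl k)) :
    Expands Q T n (fun j C i ω => ∑ k ∈ s, Z k j C i ω) (fun j x => ∑ k ∈ s, Zl k j x) := by
  classical
  induction s using Finset.induction_on with
  | empty =>
    have := hQ.prob
    simpa using const (Q := Q) (Pr' := Pr') (M := M) (n := n) (T := T) (Regular.fixed_const 0)
  | insert k s hk ih =>
    simp only [Finset.sum_insert hk]
    exact (h k (by simp)).add (ih fun j hj => h j (by simp [hj]))

theorem neg (hX : Expands Q T n X Xl) :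
    Expands Q T n (fun j C i ω => -X j C i ω) (fun j x => -Xl j x) := by
  have := hQ.prob
  exact ((const (Q := Q) (Pr' := Pr') (M := M) (n := n) (T := T)
    (Regular.fixed_const (-1))).mul hX).congr (by simp) (by simp)

theorem sub (hX : Expands Q T n X Xl) (hY : Expands Q T n Y Yl) :
    Expands Q T n (fun j C i ω => X j C i ω - Y j C i ω) (fun j x => Xl j x - Yl j x) :=
  (hX.add hY.neg).congr (by intros; ring) (by intros; ring)

/-- The average over the ensemble is the average of independent functions of the data. -/
theorem exists_average (hX : Expands Q T n X Xl) :
    ∃ h : ι → ParticleData d dO 𝓦 → ℝ, Regular Q T h ∧ (∀ j, ∫ x, h j x ∂Q = 0) ∧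
      LpO Pr' (fun (q : ι × Config M Pr') ω =>
          (∑ i ∈ Finset.range q.2.P, X q.1 q.2 i ω) / q.2.P - ∫ x, Xl q.1 x ∂Q
            - q.2.emp (h q.1) ω)
        (fun q => q.2.rate * q.2.rate) := by
  have := hQ.prob
  obtain ⟨J, _, A, h, hA, hh, h0, hr⟩ := hX.expansion
  have hXl := hX.regular
  -- The average of `h k` does not depend on the particle, so averaging `A k` times it gives a
  -- product of two averages. Replacing the average of `A k` by its integral leaves a product of two
  -- centred averages, of order `1 / P`. The new linear term consists of the centred limit and the
  -- `h k` weighted by the integrals of `A k`.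
  refine ⟨fun j x => (Xl j x - ∫ x, Xl j x ∂Q) + ∑ k, (∫ x, A k j x ∂Q) * h k j x, ?_, ?_, ?_⟩
  · exact (hXl.sub hXl.integral).add (Regular.sum _ fun k _ => (hA k).integral.mul (hh k))
  · intro j
    have i1 : ∀ k ∈ Finset.univ, Integrable (fun x => (∫ x, A k j x ∂Q) * h k j x) Q :=
      fun k _ => ((hh k).bdd.integrable j).const_mul _
    rw [integral_add ((hXl.sub hXl.integral).bdd.integrable j) (integrable_finsetSum _ i1),
      integral_finsetSum _ i1, integral_sub (hXl.bdd.integrable j) (integrable_const _)]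
    simp [integral_const_mul, h0]
  · have havg := LpO.average (Λ := ι × Config M Pr') (Z := fun q i ω => X q.1 q.2 i ω
        - Xl q.1 (q.2.E.data i ω)
        - ∑ k, A k q.1 (q.2.E.data i ω) * q.2.emp (h k q.1) ω)
      (ρ := fun q => q.2.rate * q.2.rate)
      (hr.reindex fun q : (ι × Config M Pr') × ℕ => (q.1.1, q.1.2, q.2)) (fun q => q.2.P)
    have hfluct : ∀ k, LpO Pr' (fun (q : ι × Config M Pr') ω =>
        q.2.emp (fun x => A k q.1 x - ∫ x, A k q.1 x ∂Q) ω * q.2.emp (h k q.1) ω)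
        (fun q => q.2.rate * q.2.rate) := by
      intro k
      have r1 := (hA k).sub (hA k).integral
      have h1 := r1.bdd.emp (M := M) (Pr' := Pr') r1.meas (fun j => by
        rw [integral_sub ((hA k).bdd.integrable j) (integrable_const _)]; simp)
        (fun q : ι × Config M Pr' => q.1) (fun q => q.2)
      have h2 := (hh k).bdd.emp (M := M) (Pr' := Pr') (hh k).meas (h0 k)
        (fun q : ι × Config M Pr' => q.1) (fun q => q.2)
      exact (h1.mul h2).le (by simp)
    refine (havg.add (LpO.sum Finset.univ fun k _ => hfluct k)).congr fun q ω => ?_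
    have hP : (q.2.P : ℝ) ≠ 0 := by exact_mod_cast q.2.pos.ne'
    simp only [Config.emp, Finset.sum_sub_distrib, Finset.sum_add_distrib, sub_div, add_div,
      Finset.sum_const, Finset.card_range, nsmul_eq_mul]
    have e1 : (∑ i ∈ Finset.range q.2.P, ∑ k, A k q.1 (q.2.E.data i ω)
          * ((∑ i ∈ Finset.range q.2.P, h k q.1 (q.2.E.data i ω)) / q.2.P)) / (q.2.P : ℝ)
        = ∑ k, ((∑ i ∈ Finset.range q.2.P, A k q.1 (q.2.E.data i ω)) / q.2.P)
          * ((∑ i ∈ Finset.range q.2.P, h k q.1 (q.2.E.data i ω)) / q.2.P) := by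
      rw [Finset.sum_comm, Finset.sum_div]
      refine Finset.sum_congr rfl fun k _ => ?_
      rw [← Finset.sum_mul]
      ring
    have e2 : (∑ i ∈ Finset.range q.2.P, ∑ k, (∫ x, A k q.1 x ∂Q) * h k q.1 (q.2.E.data i ω))
          / (q.2.P : ℝ)
        = ∑ k, (∫ x, A k q.1 x ∂Q)
          * ((∑ i ∈ Finset.range q.2.P, h k q.1 (q.2.E.data i ω)) / q.2.P) := by
      rw [Finset.sum_comm, Finset.sum_div]
      refine Finset.sum_congr rfl fun k _ => ?_
      rw [← Finset.mul_sum]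
      ring
    rw [e1, e2]
    simp only [sub_mul, Finset.sum_sub_distrib, mul_div_cancel_left₀ _ hP]
    ring

theorem average (hX : Expands Q T n X Xl) :
    Expands Q T n (fun j C _ ω => (∑ i ∈ Finset.range C.P, X j C i ω) / C.P)
      (fun j _ => ∫ x, Xl j x ∂Q) where
  adapted j C _ := by
    simp only [div_eq_mul_inv]
    exact Measurable.mul_const
      (@Finset.measurable_fun_sum _ _ _ _ _ _ (_) _ _ fun i _ => hX.adapted j C i) _
  limit_adapted _ := measurable_const
  regular := by
    have := hQ.prob
    exact hX.regular.integral
  expansion := by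
    have := hQ.prob
    obtain ⟨h, hh, h0, hr⟩ := hX.exists_average
    refine ⟨Unit, inferInstance, fun _ _ _ => 1, fun _ => h, fun _ => Regular.fixed_const 1,
      fun _ => hh, fun _ => h0, ?_⟩
    simpa using hr.reindex fun q : ι × Config M Pr' × ℕ => (q.1, q.2.1)

end Expands

end Expansions

/-! ### Smooth random functions with fresh noise -/

section Kernels

variable {d dO : ℕ} {𝓦 : Type*} [MeasurableSpace 𝓦] {ι θ : Type*}

/-- A family of random functions `g_j(x, w)`, with "partial derivatives" `G_{j,a}(x, w)`: moment
bounds of polynomial growth, for fixed arguments `x`, for the function and its derivatives, their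
increments and Taylor remainder, and their differences between consecutive resolutions. -/
structure SmoothKernel (T : LevelPairs ι θ) (ν : Measure 𝓦) (g : ι → Vec d → 𝓦 → ℝ)
    (G : Fin d → ι → Vec d → 𝓦 → ℝ) (m : ℕ) : Prop where
  meas : ∀ j, Measurable fun q : Vec d × 𝓦 => g j q.1 q.2
  meas_deriv : ∀ a j, Measurable fun q : Vec d × 𝓦 => G a j q.1 q.2
  growth : LpO ν (fun q : ι × Vec d => g q.1 q.2) (fun q => (1 + ‖q.2‖₊) ^ m)
  deriv_growth : ∀ a, LpO ν (fun q : ι × Vec d => G a q.1 q.2) (fun q => (1 + ‖q.2‖₊) ^ m)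
  lip : LpO ν (fun (q : ι × Vec d × Vec d) w => g q.1 q.2.2 w - g q.1 q.2.1 w)
    (fun q => (1 + ‖q.2.1‖₊ + ‖q.2.2‖₊) ^ m * ‖q.2.2 - q.2.1‖₊)
  deriv_lip : ∀ a, LpO ν (fun (q : ι × Vec d × Vec d) w => G a q.1 q.2.2 w - G a q.1 q.2.1 w)
    (fun q => (1 + ‖q.2.1‖₊ + ‖q.2.2‖₊) ^ m * ‖q.2.2 - q.2.1‖₊)
  taylor : LpO ν (fun (q : ι × Vec d × Vec d) w => g q.1 q.2.2 w - g q.1 q.2.1 w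
      - ∑ a, G a q.1 q.2.1 w * (q.2.2 a - q.2.1 a))
    (fun q => (1 + ‖q.2.1‖₊ + ‖q.2.2‖₊) ^ m * ‖q.2.2 - q.2.1‖₊ ^ 2)
  pair : LpO ν (fun (q : θ × Vec d) w => g (T.fine q.1) q.2 w - g (T.coarse q.1) q.2 w)
    (fun q => (1 + ‖q.2‖₊) ^ m * T.δ q.1)
  deriv_pair : ∀ a, LpO ν (fun (q : θ × Vec d) w =>
      G a (T.fine q.1) q.2 w - G a (T.coarse q.1) q.2 w)
    (fun q => (1 + ‖q.2‖₊) ^ m * T.δ q.1)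

variable {M : FilterModel d dO 𝓦} {Ω' : Type*} [MeasurableSpace Ω'] {Pr' : Measure Ω'}
  [IsProbabilityMeasure Pr'] {Q : Measure (ParticleData d dO 𝓦)} [hQ : IsParticleLaw M Pr' Q]
  {T : LevelPairs ι θ}

theorem LpO.one_add_pow {Ω Λ : Type*} [MeasurableSpace Ω] {μ : Measure Ω} [IsProbabilityMeasure μ]
    {X : Λ → Ω → ℝ} (h : LpO μ X 1) (m : ℕ) : LpO μ (fun a ω => (1 + X a ω) ^ m) 1 :=
  (((LpO.const (μ := μ) (c := fun _ : Λ => (1 : ℝ)) 1 (by simp)).add h).pow m).le (by simp)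

theorem IsParticleLaw.indepFun (Pr' : Measure Ω') [hQ : IsParticleLaw M Pr' Q] {n : ℕ} {E : Type*}
    [MeasurableSpace E] {f : ParticleData d dO 𝓦 → E} (hf : Measurable[pastData d dO 𝓦 n] f) :
    IndepFun f (fun x => x.2.1 n) Q := by
  rw [IndepFun_iff_Indep]
  exact indep_of_indep_of_le_left (hQ.indep n) hf.comap_le

theorem measurable_noise_coord (n : ℕ) : Measurable fun x : ParticleData d dO 𝓦 => x.2.1 n :=
  (measurable_pi_apply n).comp (measurable_fst.comp measurable_snd)

-- The difference of two resolutions is split in two: first the argument changes in the fine kernel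
-- (`lip`), then the kernel changes at the coarse argument (`pair`). The hypotheses are listed
-- separately from `SmoothKernel` because the lemma serves both for a kernel and for its partial
-- derivatives.
include hQ in
theorem Regular.comp_kernel {n m : ℕ} {g : ι → Vec d → 𝓦 → ℝ}
    (meas : ∀ j, Measurable fun q : Vec d × 𝓦 => g j q.1 q.2)
    (growth : LpO (M.noiseLaw n) (fun q : ι × Vec d => g q.1 q.2) (fun q => (1 + ‖q.2‖₊) ^ m))
    (lip : LpO (M.noiseLaw n) (fun (q : ι × Vec d × Vec d) w => g q.1 q.2.2 w - g q.1 q.2.1 w)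
      (fun q => (1 + ‖q.2.1‖₊ + ‖q.2.2‖₊) ^ m * ‖q.2.2 - q.2.1‖₊))
    (pair : LpO (M.noiseLaw n)
      (fun (q : θ × Vec d) w => g (T.fine q.1) q.2 w - g (T.coarse q.1) q.2 w)
      (fun q => (1 + ‖q.2‖₊) ^ m * T.δ q.1))
    {V : ι → ParticleData d dO 𝓦 → Vec d} (hV : ∀ a, Regular Q T fun j x => V j x a)
    (had : ∀ j, Measurable[pastData d dO 𝓦 n] (V j)) :
    Regular Q T fun j x => g j (V j x) (x.2.1 n) := by
  have := hQ.prob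
  have := hQ.prob_noise n
  have hVm : ∀ j, Measurable (V j) := fun j => (had j).mono (pastData_le n) le_rfl
  have hw := measurable_noise_coord (d := d) (dO := dO) (𝓦 := 𝓦) n
  have hnorm : LpO Q (fun j x => ‖V j x‖) 1 := LpO.norm_vec hVm fun a => (hV a).bdd
  have hdiff : LpO Q (fun τ x => ‖V (T.fine τ) x - V (T.coarse τ) x‖) T.δ :=
    LpO.norm_vec (fun τ => (hVm _).sub (hVm _)) fun a => (hV a).pair
  refine ⟨fun j => (meas j).comp ((hVm j).prodMk hw), ?_, ?_⟩
  · refine LpO.comp_indep (Λ₀ := ι) (b := fun _ x => (1 + ‖x‖₊) ^ m) growth meas id hVm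
      (fun _ => hw) (fun _ => hQ.map_noise n) (fun j => IsParticleLaw.indepFun (M := M) Pr' (had j)) ?_
    simpa using hnorm.one_add_pow m
  · have h1 : LpO Q (fun τ x => g (T.fine τ) (V (T.fine τ) x) (x.2.1 n)
        - g (T.fine τ) (V (T.coarse τ) x) (x.2.1 n)) T.δ := by
      refine LpO.comp_indep (Λ₀ := ι) (Z := Vec d × Vec d)
        (g := fun j z w => g j z.2 w - g j z.1 w)
        (b := fun _ z => (1 + ‖z.1‖₊ + ‖z.2‖₊) ^ m * ‖z.2 - z.1‖₊) lip
        (fun j => ?_) T.fine (ζ := fun τ x => (V (T.coarse τ) x, V (T.fine τ) x))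
        (fun τ => (hVm _).prodMk (hVm _))
        (fun _ => hw) (fun _ => hQ.map_noise n)
        (fun j => IsParticleLaw.indepFun (M := M) Pr' (@Measurable.prodMk _ _ _ _ _ (_) _ _ (had _) (had _)))
        ?_
      · exact ((meas j).comp (by fun_prop : Measurable fun q : (Vec d × Vec d) × 𝓦 =>
          (q.1.2, q.2))).sub ((meas j).comp (by fun_prop : Measurable
          fun q : (Vec d × Vec d) × 𝓦 => (q.1.1, q.2)))
      · have h2 : LpO Q (fun τ x => (1 + (‖V (T.coarse τ) x‖ + ‖V (T.fine τ) x‖)) ^ m) 1 :=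
          ((hnorm.reindex T.coarse).add (hnorm.reindex T.fine)).one_add_pow m
        refine (h2.mul_one_left hdiff).congr fun τ x => ?_
        push_cast
        rw [add_assoc]
    have h2 : LpO Q (fun τ x => g (T.fine τ) (V (T.coarse τ) x) (x.2.1 n)
        - g (T.coarse τ) (V (T.coarse τ) x) (x.2.1 n)) T.δ := by
      refine LpO.comp_indep (Λ₀ := θ) (Z := Vec d)
        (g := fun τ z w => g (T.fine τ) z w - g (T.coarse τ) z w)
        (b := fun τ z => (1 + ‖z‖₊) ^ m * T.δ τ) pair
        (fun j => (meas _).sub (meas _)) id (ζ := fun τ x => V (T.coarse τ) x)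
        (fun τ => hVm _) (fun _ => hw) (fun _ => hQ.map_noise n)
        (fun j => IsParticleLaw.indepFun (M := M) Pr' (had _)) ?_
      have h3 := ((hnorm.reindex T.coarse).one_add_pow m).mul_one_left
        (LpO.const (μ := Q) (c := fun τ => (T.δ τ : ℝ)) (ρ := T.δ) 1 (by simp))
      simpa using h3
    exact (h1.add h2).congr fun τ x => by ring

theorem measurable_kernel_comp {n : ℕ} {g : Vec d → 𝓦 → ℝ}
    (meas : Measurable fun q : Vec d × 𝓦 => g q.1 q.2)
    {V : ParticleData d dO 𝓦 → Vec d} (had : Measurable[pastData d dO 𝓦 n] V) :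
    Measurable[pastData d dO 𝓦 (n + 1)] fun x => g (V x) (x.2.1 n) :=
  meas.comp (@Measurable.prodMk _ _ _ _ _ (_) _ _
    (had.mono (pastData_mono n.le_succ) le_rfl) (measurable_pastData_noise n.lt_succ_self))

/-- Application of a smooth random function, with fresh noise, to the particles. -/
theorem Expands.kernel {n m : ℕ} {g : ι → Vec d → 𝓦 → ℝ} {G : Fin d → ι → Vec d → 𝓦 → ℝ}
    (K : SmoothKernel T (M.noiseLaw n) g G m) {V : ι → Config M Pr' → ℕ → Ω' → Vec d}
    {Vl : ι → ParticleData d dO 𝓦 → Vec d}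
    (hV : ∀ a, Expands Q T n (fun j C i ω => V j C i ω a) (fun j x => Vl j x a)) :
    Expands Q T (n + 1) (fun j C i ω => g j (V j C i ω) (C.E.noise (n, i) ω))
      (fun j x => g j (Vl j x) (x.2.1 n)) := by
  have := hQ.prob
  have := hQ.prob_noise n
  have had : ∀ j, Measurable[pastData d dO 𝓦 n] (Vl j) := fun j =>
    measurable_vec fun a => (hV a).limit_adapted j
  have hVad : ∀ j C i, Measurable[C.E.past n] (V j C i) := fun j C i =>
    measurable_vec fun a => (hV a).adapted j C i
  have hVm : ∀ j (C : Config M Pr') i, Measurable (V j C i) := fun j C i =>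
    (hVad j C i).mono (C.E.past_le n) le_rfl
  have hVlm : ∀ j, Measurable (Vl j) := fun j => (had j).mono (pastData_le n) le_rfl
  have hg := of_data (M := M) (Pr' := Pr') (n := n + 1) (Regular.comp_kernel (Pr' := Pr') K.meas K.growth K.lip K.pair
    (fun a => (hV a).regular) had) fun j => measurable_kernel_comp (K.meas j) (had j)
  have hG := fun a => of_data (M := M) (Pr' := Pr') (n := n + 1) (Regular.comp_kernel (Pr' := Pr') (K.meas_deriv a)
    (K.deriv_growth a) (K.deriv_lip a) (K.deriv_pair a)
    (fun a => (hV a).regular) had) fun j => measurable_kernel_comp (K.meas_deriv a j) (had j)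
  have hD := fun a => (hV a).sub (of_data (M := M) (Pr' := Pr') (hV a).regular (hV a).limit_adapted)
  -- The linearization of `g` at the limit state, assembled from the closure properties. The limit
  -- of `V - Vl` is zero, so the limit of the whole is `g` at `Vl`.
  have hlin := (hg.add (Expands.sum Finset.univ fun a _ =>
    (hG a).mul ((hD a).mono n.le_succ))).congr (fun _ _ _ _ => rfl)
      (Yl := fun j x => g j (Vl j x) (x.2.1 n)) (by simp)
  refine hlin.add_small (fun j C i => (K.meas j).comp (@Measurable.prodMk _ _ _ _ _ (_) _ _
    ((hVad j C i).mono (C.E.past_mono n.le_succ) le_rfl)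
    (C.E.measurable_past_noise n.lt_succ_self i))) ?_
  have hnl : LpO Pr' (fun (q : ι × Config M Pr' × ℕ) ω => ‖Vl q.1 (q.2.1.E.data q.2.2 ω)‖) 1 :=
    LpO.norm_vec (fun q => (hVlm _).comp (q.2.1.E.measurable_data _)) fun a => (hV a).limit_bdd
  have hn : LpO Pr' (fun (q : ι × Config M Pr' × ℕ) ω => ‖V q.1 q.2.1 q.2.2 ω‖) 1 :=
    LpO.norm_vec (fun q => hVm _ _ _) fun a => (hV a).bdd
  have hdiff : LpO Pr' (fun (q : ι × Config M Pr' × ℕ) ω =>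
      ‖V q.1 q.2.1 q.2.2 ω - Vl q.1 (q.2.1.E.data q.2.2 ω)‖) (fun q => q.2.1.rate) :=
    LpO.norm_vec (fun q => (hVm _ _ _).sub ((hVlm _).comp (q.2.1.E.measurable_data _)))
      fun a => (hV a).diff
  -- The Taylor remainder is quadratic in `V - Vl`, which is of order `rate`. Both states are known
  -- before the noise of time `n`, so the bound for fixed arguments applies.
  have key : LpO Pr' (fun (q : ι × Config M Pr' × ℕ) ω =>
      g q.1 (V q.1 q.2.1 q.2.2 ω) (q.2.1.E.noise (n, q.2.2) ω)
      - g q.1 (Vl q.1 (q.2.1.E.data q.2.2 ω)) (q.2.1.E.noise (n, q.2.2) ω)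
      - ∑ a, G a q.1 (Vl q.1 (q.2.1.E.data q.2.2 ω)) (q.2.1.E.noise (n, q.2.2) ω)
        * (V q.1 q.2.1 q.2.2 ω a - Vl q.1 (q.2.1.E.data q.2.2 ω) a))
      (fun q => q.2.1.rate * q.2.1.rate) := by
    refine LpO.comp_indep (Λ₀ := ι) (Z := Vec d × Vec d)
      (g := fun j z w => g j z.2 w - g j z.1 w - ∑ a, G a j z.1 w * (z.2 a - z.1 a))
      (b := fun _ z => (1 + ‖z.1‖₊ + ‖z.2‖₊) ^ m * ‖z.2 - z.1‖₊ ^ 2) K.taylor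
      (fun j => ?_) (fun q : ι × Config M Pr' × ℕ => q.1)
      (ζ := fun q ω => (Vl q.1 (q.2.1.E.data q.2.2 ω), V q.1 q.2.1 q.2.2 ω))
      (w := fun q => q.2.1.E.noise (n, q.2.2))
      (fun q => ((hVlm _).comp (q.2.1.E.measurable_data _)).prodMk (hVm _ _ _))
      (fun q => q.2.1.E.measurable_noise _) (fun q => q.2.1.E.law_noise _)
      (fun q => q.2.1.E.indepFun_noise q.2.2 (@Measurable.prodMk _ _ _ _ _ (_) _ _
        (q.2.1.E.measurable_comp_data q.2.2 (had q.1)) (hVad _ _ _))) ?_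
    · refine Measurable.sub (((K.meas j).comp (by fun_prop : Measurable
        fun q : (Vec d × Vec d) × 𝓦 => (q.1.2, q.2))).sub ((K.meas j).comp (by fun_prop : Measurable
        fun q : (Vec d × Vec d) × 𝓦 => (q.1.1, q.2)))) ?_
      refine Finset.measurable_fun_sum _ fun a _ => Measurable.mul
        ((K.meas_deriv a j).comp (by fun_prop : Measurable
          fun q : (Vec d × Vec d) × 𝓦 => (q.1.1, q.2))) ?_
      exact ((measurable_coord a).comp (measurable_snd.comp measurable_fst)).sub
        ((measurable_coord a).comp (measurable_fst.comp measurable_fst))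
    · have h2 := (hnl.add hn).one_add_pow m
      refine ((h2.mul_one_left (hdiff.mul hdiff))).congr fun q ω => ?_
      push_cast
      rw [add_assoc, sq]
  refine key.congr fun q ω => ?_
  simp only [EnsembleInput.data]
  ring

end Kernels

/-! ### The Kalman gain -/

section LinearAlgebra

variable {n m k : ℕ}

/-- The quadratic form attains a positive minimum on the compact unit sphere, and both sides are
homogeneous of degree two. -/
theorem exists_quadratic_lower_bound {Γ : Matrix (Fin n) (Fin n) ℝ} (hΓ : Γ.PosDef) :
    ∃ γ : ℝ, 0 < γ ∧ ∀ x : Fin n → ℝ, γ * ‖x‖ ^ 2 ≤ x ⬝ᵥ (Γ *ᵥ x) := by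
  rcases isEmpty_or_nonempty (Fin n) with h | h
  · refine ⟨1, one_pos, fun x => ?_⟩
    simp [Subsingleton.elim x 0]
  have hc : Continuous fun x : Fin n → ℝ => x ⬝ᵥ (Γ *ᵥ x) := by fun_prop
  have hne : (Metric.sphere (0 : Fin n → ℝ) 1).Nonempty :=
    NormedSpace.sphere_nonempty.2 zero_le_one
  obtain ⟨u, hu, hmin⟩ := (isCompact_sphere (0 : Fin n → ℝ) 1).exists_isMinOn hne hc.continuousOn
  have hu0 : u ≠ 0 := by
    rintro rfl
    simp at hu
  have hpos : 0 < u ⬝ᵥ (Γ *ᵥ u) := by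
    have := hΓ.dotProduct_mulVec_pos hu0
    simpa using this
  refine ⟨_, hpos, fun x => ?_⟩
  rcases eq_or_ne x 0 with rfl | hx
  · simp
  have hx' : ‖x‖ ≠ 0 := norm_ne_zero_iff.2 hx
  have h1 : ‖x‖⁻¹ • x ∈ Metric.sphere (0 : Fin n → ℝ) 1 := by
    simp [norm_smul, hx']
  have h2 := hmin h1
  simp only [Set.mem_ofPred_eq, Matrix.mulVec_smul, dotProduct_smul, smul_dotProduct,
    smul_eq_mul] at h2
  have h3 : (u ⬝ᵥ (Γ *ᵥ u)) * ‖x‖ ^ 2 ≤ (‖x‖⁻¹ * (‖x‖⁻¹ * (x ⬝ᵥ (Γ *ᵥ x)))) * ‖x‖ ^ 2 :=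
    mul_le_mul_of_nonneg_right h2 (by positivity)
  refine h3.trans (le_of_eq ?_)
  field_simp

/-- For the column x = (S + Γ)⁻¹ e_j one has γ‖x‖² ≤ x·Γx ≤ x·(S + Γ)x = x_j ≤ ‖x‖. The bound does
not involve `S`, so the random inverse in the gain needs no moment estimate. -/
theorem exists_inv_add_bound {Γ : Matrix (Fin n) (Fin n) ℝ} (hΓ : Γ.PosDef) :
    ∃ K : ℝ≥0, ∀ S : Matrix (Fin n) (Fin n) ℝ, S.PosSemidef → ∀ i j, |(S + Γ)⁻¹ i j| ≤ K := by
  obtain ⟨γ, hγ, hb⟩ := exists_quadratic_lower_bound hΓ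
  refine ⟨⟨γ⁻¹, by positivity⟩, fun S hS i j => ?_⟩
  have hA : (S + Γ).PosDef := by
    rw [add_comm]
    exact hΓ.add_posSemidef hS
  set x : Fin n → ℝ := (S + Γ)⁻¹ *ᵥ Pi.single j 1 with hx
  have hxe : ∀ i, x i = (S + Γ)⁻¹ i j := fun i => by simp [hx]
  have h1 : (S + Γ) *ᵥ x = Pi.single j 1 := by
    rw [hx, Matrix.mulVec_mulVec, Matrix.mul_nonsing_inv _
      ((Matrix.isUnit_iff_isUnit_det _).1 hA.isUnit), Matrix.one_mulVec]
  have h2 : x ⬝ᵥ ((S + Γ) *ᵥ x) = x j := by rw [h1]; simp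
  have h3 : 0 ≤ x ⬝ᵥ (S *ᵥ x) := by
    have := hS.dotProduct_mulVec_nonneg x
    simpa using this
  rw [Matrix.add_mulVec, dotProduct_add] at h2
  have h4 := hb x
  have h5 : x j ≤ ‖x‖ := (le_abs_self _).trans (norm_le_pi_norm x j)
  have h6 : ‖x‖ ≤ γ⁻¹ := by
    rcases (norm_nonneg x).eq_or_lt with h | h
    · rw [← h]; positivity
    · rw [le_inv_comm₀ h hγ, ← one_div, le_div_iff₀ h]
      nlinarith
  rw [← hxe i]
  exact (norm_le_pi_norm x i).trans h6

/-- By Cramer's rule the entries are adjugate entries times the inverse determinant. The convention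
for singular matrices is compatible with this formula, hence invertibility is not required. -/
theorem measurable_matrix_inv {Ω : Type*} {_ : MeasurableSpace Ω}
    {A : Ω → Matrix (Fin n) (Fin n) ℝ} (h : ∀ i j, Measurable fun ω => A ω i j) (i j : Fin n) :
    Measurable fun ω => (A ω)⁻¹ i j := by
  have hdet : ∀ {B : Ω → Matrix (Fin n) (Fin n) ℝ}, (∀ i j, Measurable fun ω => B ω i j) →
      Measurable fun ω => (B ω).det := by
    intro B hB
    simp only [Matrix.det_apply']
    exact Finset.measurable_fun_sum _ fun σ _ =>
      (Finset.measurable_fun_prod _ fun i _ => hB _ _).const_mul _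
  simp only [Matrix.inv_def, Matrix.smul_apply, smul_eq_mul, Ring.inverse_eq_inv', Matrix.adjugate_apply]
  refine (hdet h).inv.mul (hdet fun a b => ?_)
  simp only [Matrix.updateRow_apply]
  split_ifs
  · exact measurable_const
  · exact h a b

theorem measurable_matrix_mul {Ω : Type*} {_ : MeasurableSpace Ω}
    {A : Ω → Matrix (Fin n) (Fin m) ℝ} {B : Ω → Matrix (Fin m) (Fin k) ℝ}
    (hA : ∀ i j, Measurable fun ω => A ω i j) (hB : ∀ i j, Measurable fun ω => B ω i j)
    (i : Fin n) (j : Fin k) : Measurable fun ω => (A ω * B ω) i j := by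
  simp only [Matrix.mul_apply]
  exact Finset.measurable_fun_sum _ fun l _ => (hA _ _).mul (hB _ _)

theorem LpO.matrix_mul {Ω Λ : Type*} [MeasurableSpace Ω] {μ : Measure Ω} [IsProbabilityMeasure μ]
    {A : Λ → Ω → Matrix (Fin n) (Fin m) ℝ} {B : Λ → Ω → Matrix (Fin m) (Fin k) ℝ}
    {ρ ρ' : Λ → ℝ≥0} (hA : ∀ i j, LpO μ (fun a ω => A a ω i j) ρ)
    (hB : ∀ i j, LpO μ (fun a ω => B a ω i j) ρ') (i : Fin n) (j : Fin k) :
    LpO μ (fun a ω => (A a ω * B a ω) i j) (fun a => ρ a * ρ' a) := by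
  simp only [Matrix.mul_apply]
  exact LpO.sum _ fun l _ => (hA _ _).mul (hB _ _)

theorem LpO.matrix_const {Ω Λ : Type*} [MeasurableSpace Ω] {μ : Measure Ω}
    [IsProbabilityMeasure μ] (A : Matrix (Fin n) (Fin m) ℝ) (i : Fin n) (j : Fin m) :
    LpO μ (fun (_ : Λ) _ => A i j) 1 :=
  LpO.const ‖A i j‖₊ (by simp)

theorem Regular.matrix_mul {𝓧 ι θ : Type*} [MeasurableSpace 𝓧] {Q : Measure 𝓧}
    [IsProbabilityMeasure Q] {T : LevelPairs ι θ} {A : ι → 𝓧 → Matrix (Fin n) (Fin m) ℝ}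
    {B : ι → 𝓧 → Matrix (Fin m) (Fin k) ℝ} (hA : ∀ i j, Regular Q T fun l x => A l x i j)
    (hB : ∀ i j, Regular Q T fun l x => B l x i j) (i : Fin n) (j : Fin k) :
    Regular Q T fun l x => (A l x * B l x) i j := by
  simp only [Matrix.mul_apply]
  exact Regular.sum _ fun l _ => (hA _ _).mul (hB _ _)

variable {d dO : ℕ} {𝓦 : Type*} [MeasurableSpace 𝓦] (M : FilterModel d dO 𝓦)

theorem posSemidef_observed {C : Matrix (Fin d) (Fin d) ℝ} (hC : C.PosSemidef) :
    (M.H * C * M.Hᵀ).PosSemidef := by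
  have := hC.mul_mul_conjTranspose_same M.H
  rwa [Matrix.conjTranspose_eq_transpose_of_trivial] at this

theorem isUnit_innovation {C : Matrix (Fin d) (Fin d) ℝ} (hC : C.PosSemidef) :
    IsUnit (M.H * C * M.Hᵀ + M.Γ).det := by
  have h : (M.H * C * M.Hᵀ + M.Γ).PosDef := by
    rw [add_comm]
    exact M.posDef_Γ.add_posSemidef (posSemidef_observed M hC)
  exact (Matrix.isUnit_iff_isUnit_det _).1 h.isUnit

/-- The resolvent identity for the two innovation covariances. -/
theorem inv_sub_inv_innovation {C D : Matrix (Fin d) (Fin d) ℝ} (hC : C.PosSemidef)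
    (hD : D.PosSemidef) :
    (M.H * C * M.Hᵀ + M.Γ)⁻¹ - (M.H * D * M.Hᵀ + M.Γ)⁻¹
      = -((M.H * D * M.Hᵀ + M.Γ)⁻¹ * (M.H * (C - D) * M.Hᵀ) * (M.H * C * M.Hᵀ + M.Γ)⁻¹) := by
  set S := M.H * C * M.Hᵀ + M.Γ with hS
  set S' := M.H * D * M.Hᵀ + M.Γ with hS'
  have e : M.H * (C - D) * M.Hᵀ = S - S' := by
    rw [hS, hS', Matrix.mul_sub, Matrix.sub_mul]; abel
  rw [e, Matrix.mul_sub, Matrix.sub_mul, Matrix.nonsing_inv_mul _ (isUnit_innovation M hD),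
    Matrix.mul_assoc S'⁻¹ S, Matrix.mul_nonsing_inv _ (isUnit_innovation M hC)]
  simp

/-- The increment of the Kalman gain. -/
theorem gain_sub_gain {C D : Matrix (Fin d) (Fin d) ℝ} (hC : C.PosSemidef)
    (hD : D.PosSemidef) :
    M.gain C - M.gain D = (1 - M.gain D * M.H) * (C - D) * (M.Hᵀ * (M.H * C * M.Hᵀ + M.Γ)⁻¹) := by
  unfold FilterModel.gain
  set S := M.H * C * M.Hᵀ + M.Γ with hS
  set S' := M.H * D * M.Hᵀ + M.Γ with hS'
  have hSu : S * S⁻¹ = 1 := Matrix.mul_nonsing_inv _ (isUnit_innovation M hC)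
  have hSu' : S'⁻¹ * S' = 1 := Matrix.nonsing_inv_mul _ (isUnit_innovation M hD)
  have e : M.H * (C - D) * M.Hᵀ = S - S' := by
    rw [hS, hS', Matrix.mul_sub, Matrix.sub_mul]; abel
  have e2 : (1 - D * M.Hᵀ * S'⁻¹ * M.H) * (C - D) * (M.Hᵀ * S⁻¹)
      = (C - D) * M.Hᵀ * S⁻¹ - D * M.Hᵀ * S'⁻¹ * (M.H * (C - D) * M.Hᵀ) * S⁻¹ := by
    simp only [Matrix.sub_mul, Matrix.mul_sub, Matrix.one_mul, Matrix.mul_assoc]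
    abel
  have e3 : S'⁻¹ * (S - S') * S⁻¹ = S'⁻¹ - S⁻¹ := by
    rw [Matrix.mul_sub, Matrix.sub_mul, hSu', Matrix.mul_assoc, hSu]
    simp
  have e4 : D * M.Hᵀ * S'⁻¹ * (S - S') * S⁻¹ = D * M.Hᵀ * (S'⁻¹ - S⁻¹) := by
    rw [← e3]
    simp only [Matrix.mul_assoc]
  rw [e2, e, e4, Matrix.sub_mul, Matrix.sub_mul, Matrix.mul_sub]
  abel

/-- The resolvent identity is inserted in the last factor of `gain_sub_gain`. The result is an exact
expansion: a term linear in `C - D` with coefficients depending on `D` alone, and a term quadratic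
in `C - D`. -/
theorem gain_sub_gain_linear {C D : Matrix (Fin d) (Fin d) ℝ} (hC : C.PosSemidef)
    (hD : D.PosSemidef) :
    M.gain C = M.gain D + (1 - M.gain D * M.H) * (C - D) * (M.Hᵀ * (M.H * D * M.Hᵀ + M.Γ)⁻¹)
      - (1 - M.gain D * M.H) * (C - D) * (M.Hᵀ * ((M.H * D * M.Hᵀ + M.Γ)⁻¹
        * (M.H * (C - D) * M.Hᵀ) * (M.H * C * M.Hᵀ + M.Γ)⁻¹)) := by
  have h1 := gain_sub_gain M hC hD
  have h2 := inv_sub_inv_innovation M hC hD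
  rw [sub_eq_iff_eq_add] at h1 h2
  have h3 := congrArg (fun Z => (1 - M.gain D * M.H) * (C - D) * (M.Hᵀ * Z)) h2
  simp only [Matrix.mul_add, Matrix.mul_neg] at h3
  rw [h1, h3]
  abel

theorem measurable_innovation_inv {Ω : Type*} {_ : MeasurableSpace Ω}
    {C : Ω → Matrix (Fin d) (Fin d) ℝ} (h : ∀ a b, Measurable fun ω => C ω a b)
    (p q : Fin dO) : Measurable fun ω => (M.H * C ω * M.Hᵀ + M.Γ)⁻¹ p q := by
  refine measurable_matrix_inv (A := fun ω => M.H * C ω * M.Hᵀ + M.Γ) (fun i j => ?_) p q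
  simp only [Matrix.add_apply]
  exact (measurable_matrix_mul (A := fun ω => M.H * C ω) (B := fun _ => M.Hᵀ)
    (measurable_matrix_mul (A := fun _ => M.H) (B := C) (fun _ _ => measurable_const) h)
    (fun _ _ => measurable_const) i j).add_const _

theorem measurable_gain {Ω : Type*} {_ : MeasurableSpace Ω}
    {C : Ω → Matrix (Fin d) (Fin d) ℝ} (h : ∀ a b, Measurable fun ω => C ω a b)
    (p : Fin d) (q : Fin dO) : Measurable fun ω => M.gain (C ω) p q := by
  unfold FilterModel.gain
  exact measurable_matrix_mul (A := fun ω => C ω * M.Hᵀ)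
    (B := fun ω => (M.H * C ω * M.Hᵀ + M.Γ)⁻¹)
    (measurable_matrix_mul (A := C) (B := fun _ => M.Hᵀ) h fun _ _ => measurable_const)
    (measurable_innovation_inv M h) p q

end LinearAlgebra

section GainExpansion

variable {d dO : ℕ} {𝓦 : Type*} [MeasurableSpace 𝓦] {ι θ : Type*} {M : FilterModel d dO 𝓦}

theorem LpO.innovation_inv {Ω Λ : Type*} [MeasurableSpace Ω] {μ : Measure Ω}
    [IsProbabilityMeasure μ] {C : Λ → Ω → Matrix (Fin d) (Fin d) ℝ}
    (h : ∀ a b l, Measurable fun ω => C l ω a b) (hC : ∀ l ω, (C l ω).PosSemidef)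
    (p q : Fin dO) : LpO μ (fun l ω => (M.H * C l ω * M.Hᵀ + M.Γ)⁻¹ p q) 1 := by
  obtain ⟨K, hK⟩ := exists_inv_add_bound M.posDef_Γ
  refine (LpO.const (μ := μ) (Λ := Λ) (c := fun _ => (K : ℝ)) K (by simp)).of_abs_le
    (fun l => ?_) fun l => ae_of_all _ fun ω => ?_
  · exact (measurable_innovation_inv M (fun a b => h a b l) p q).aestronglyMeasurable
  · rw [NNReal.abs_eq]
    exact hK _ (posSemidef_observed M (hC l ω)) p q

variable {𝓧 : Type*} [MeasurableSpace 𝓧] {T : LevelPairs ι θ}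

theorem Regular.innovation_inv {Q : Measure 𝓧} [IsProbabilityMeasure Q]
    {c : ι → Matrix (Fin d) (Fin d) ℝ} (hc : ∀ a b, Regular Q T fun j _ => c j a b)
    (hpsd : ∀ j, (c j).PosSemidef) (p q : Fin dO) :
    Regular Q T fun j _ => (M.H * c j * M.Hᵀ + M.Γ)⁻¹ p q where
  meas _ := measurable_const
  bdd := LpO.innovation_inv (C := fun j _ => c j) (fun _ _ _ => measurable_const)
    (fun j _ => hpsd j) p q
  pair := by
    have hb : ∀ p q, LpO Q (fun (j : ι) (_ : 𝓧) => (M.H * c j * M.Hᵀ + M.Γ)⁻¹ p q) 1 :=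
      LpO.innovation_inv (C := fun j _ => c j) (fun _ _ _ => measurable_const)
        (fun j _ => hpsd j)
    have hd : ∀ a b, LpO Q (fun τ (_ : 𝓧) => (c (T.fine τ) - c (T.coarse τ)) a b) T.δ :=
      fun a b => (hc a b).pair
    have h1 := LpO.matrix_mul (LpO.matrix_mul (fun p q => (hb p q).reindex T.coarse)
      (LpO.matrix_mul (LpO.matrix_mul (LpO.matrix_const M.H) hd) (LpO.matrix_const M.Hᵀ)))
      (fun p q => (hb p q).reindex T.fine) p q
    refine (h1.neg.le (by simp)).congr fun τ _ => ?_
    rw [← Matrix.sub_apply, inv_sub_inv_innovation M (hpsd _) (hpsd _), Matrix.neg_apply]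

theorem Regular.gain {Q : Measure 𝓧} [IsProbabilityMeasure Q]
    {c : ι → Matrix (Fin d) (Fin d) ℝ} (hc : ∀ a b, Regular Q T fun j _ => c j a b)
    (hpsd : ∀ j, (c j).PosSemidef) (p : Fin d) (q : Fin dO) :
    Regular Q T fun j _ => M.gain (c j) p q :=
  Regular.matrix_mul (Regular.matrix_mul hc fun a b => Regular.fixed_const (M.Hᵀ a b))
    (Regular.innovation_inv hc hpsd) p q

variable {Ω' : Type*} [MeasurableSpace Ω'] {Pr' : Measure Ω'}
  [IsProbabilityMeasure Pr'] {Q : Measure (ParticleData d dO 𝓦)} [hQ : IsParticleLaw M Pr' Q]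
  {n : ℕ}

theorem Expands.matrix_mul {a b c : ℕ} {A : ι → Config M Pr' → ℕ → Ω' → Matrix (Fin a) (Fin b) ℝ}
    {B : ι → Config M Pr' → ℕ → Ω' → Matrix (Fin b) (Fin c) ℝ}
    {Al : ι → ParticleData d dO 𝓦 → Matrix (Fin a) (Fin b) ℝ}
    {Bl : ι → ParticleData d dO 𝓦 → Matrix (Fin b) (Fin c) ℝ}
    (hA : ∀ p q, Expands Q T n (fun j C i ω => A j C i ω p q) (fun j x => Al j x p q))
    (hB : ∀ p q, Expands Q T n (fun j C i ω => B j C i ω p q) (fun j x => Bl j x p q))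
    (p : Fin a) (q : Fin c) :
    Expands Q T n (fun j C i ω => (A j C i ω * B j C i ω) p q) (fun j x => (Al j x * Bl j x) p q) := by
  simp only [Matrix.mul_apply]
  exact Expands.sum _ fun l _ => (hA _ _).mul (hB _ _)

/-- The Kalman gain of a covariance estimator that is an average of independent variables, up to an
error of order `1 / P`, has the same property. -/
theorem Expands.gain {Cv : ι → Config M Pr' → ℕ → Ω' → Matrix (Fin d) (Fin d) ℝ}
    {c : ι → Matrix (Fin d) (Fin d) ℝ}
    (hC : ∀ a b, Expands Q T n (fun j C i ω => Cv j C i ω a b) (fun j _ => c j a b))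
    (hCpsd : ∀ j C i ω, (Cv j C i ω).PosSemidef) (hpsd : ∀ j, (c j).PosSemidef)
    (p : Fin d) (q : Fin dO) :
    Expands Q T n (fun j C i ω => M.gain (Cv j C i ω) p q) (fun j _ => M.gain (c j) p q) := by
  have := hQ.prob
  have hc : ∀ a b, Regular Q T fun j _ => c j a b := fun a b => (hC a b).regular
  have hK := Regular.gain (M := M) hc hpsd
  have h1KH : ∀ a b, Regular Q T fun j _ => (1 - M.gain (c j) * M.H : Matrix (Fin d) (Fin d) ℝ) a b := fun a b =>
    (Regular.fixed_const ((1 : Matrix (Fin d) (Fin d) ℝ) a b)).sub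
      (Regular.matrix_mul hK (fun a b => Regular.fixed_const (M.H a b)) a b)
  have hS := Regular.matrix_mul (fun a b => Regular.fixed_const (Q := Q) (T := T) (M.Hᵀ a b))
    (Regular.innovation_inv (M := M) hc hpsd)
  have hD : ∀ a b, Expands Q T n (fun j C i ω => (Cv j C i ω - c j) a b)
      (fun j _ => (0 : Matrix (Fin d) (Fin d) ℝ) a b) := fun a b =>
    ((hC a b).sub (Expands.const (Pr' := Pr') (M := M) (hc a b))).congr (by simp) (by simp)
  -- The linear part of `gain_sub_gain_linear` around the deterministic limit `c j`. The fluctuation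
  -- of the covariance has limit zero, so the limit is the gain of `c j`.
  have hlin := fun p q => (Expands.const (n := n) (Pr' := Pr') (M := M) (hK p q)).add
    (Expands.matrix_mul
      (A := fun j C i ω => (1 - M.gain (c j) * M.H) * (Cv j C i ω - c j))
      (Al := fun j _ => (1 - M.gain (c j) * M.H) * (0 : Matrix (Fin d) (Fin d) ℝ))
      (B := fun j _ _ _ => M.Hᵀ * (M.H * c j * M.Hᵀ + M.Γ)⁻¹)
      (Bl := fun j _ => M.Hᵀ * (M.H * c j * M.Hᵀ + M.Γ)⁻¹)
      (Expands.matrix_mul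
        (A := fun j _ _ _ => 1 - M.gain (c j) * M.H) (Al := fun j _ => 1 - M.gain (c j) * M.H)
        (B := fun j C i ω => Cv j C i ω - c j) (Bl := fun _ _ => 0)
        (fun a b => Expands.const (Pr' := Pr') (M := M) (h1KH a b)) hD)
      (fun a b => Expands.const (Pr' := Pr') (M := M) (hS a b)) p q)
  have hlin' := (hlin p q).congr (fun _ _ _ _ => rfl) (Yl := fun j _ => M.gain (c j) p q) (by simp)
  refine hlin'.add_small (fun j C i => measurable_gain M (fun a b => (hC a b).adapted j C i) p q) ?_
  have hDo : ∀ a b, LpO Pr' (fun (q : ι × Config M Pr' × ℕ) ω =>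
      (Cv q.1 q.2.1 q.2.2 ω - c q.1) a b) (fun q => q.2.1.rate) := fun a b => (hC a b).diff
  have b1 : ∀ a b, LpO Pr' (fun (q : ι × Config M Pr' × ℕ) _ => (1 - M.gain (c q.1) * M.H : Matrix (Fin d) (Fin d) ℝ) a b) 1 :=
    fun a b => (Expands.const (n := n) (Pr' := Pr') (M := M) (h1KH a b)).bdd
  have b2 : ∀ a b, LpO Pr' (fun (q : ι × Config M Pr' × ℕ) _ =>
      (M.H * c q.1 * M.Hᵀ + M.Γ)⁻¹ a b) 1 :=
    fun a b => (Expands.const (n := n) (Pr' := Pr') (M := M)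
      (Regular.innovation_inv (M := M) hc hpsd a b)).bdd
  have b3 : ∀ a b, LpO Pr' (fun (q : ι × Config M Pr' × ℕ) ω =>
      (M.H * Cv q.1 q.2.1 q.2.2 ω * M.Hᵀ + M.Γ)⁻¹ a b) 1 :=
    LpO.innovation_inv (fun a b q => ((hC a b).adapted q.1 q.2.1 q.2.2).mono
      (q.2.1.E.past_le n) le_rfl) fun q ω => hCpsd _ _ _ _
  -- The quadratic part: two factors are covariance fluctuations of order `rate`, all others are
  -- bounded, including the random inverse.
  have hrem := LpO.matrix_mul (LpO.matrix_mul b1 hDo) (LpO.matrix_mul (LpO.matrix_const M.Hᵀ)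
    (LpO.matrix_mul (LpO.matrix_mul b2 (LpO.matrix_mul (LpO.matrix_mul (LpO.matrix_const M.H) hDo)
      (LpO.matrix_const M.Hᵀ))) b3)) p q
  refine (hrem.neg.le (by simp)).congr fun q' ω => ?_
  rw [gain_sub_gain_linear M (hCpsd _ _ _ _) (hpsd q'.1)]
  simp only [Matrix.sub_apply, Matrix.add_apply]
  ring

end GainExpansion

/-! ### Mean-field states as functions of the data of one particle -/

section MeanField

variable {d dO : ℕ} {𝓦 : Type*} [MeasurableSpace 𝓦] (M : FilterModel d dO 𝓦)

/-- The filtering problem in which the exact dynamics is replaced by the solver of resolution `N`. -/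
def FilterModel.withSolver (N : ℕ) : FilterModel d dO 𝓦 where
  initLaw := M.initLaw
  noiseLaw := M.noiseLaw
  exact n := M.solver n N
  solver := M.solver
  cost := M.cost
  H := M.H
  Γ := M.Γ
  y := M.y
  posDef_Γ := M.posDef_Γ
  measurable_exact n := M.measurable_solver n N
  measurable_solver := M.measurable_solver
  measurable_cost := M.measurable_cost

variable {M}

/-- Only the dynamics is changed, not the laws of the inputs, so the same noises drive both models.
-/
def ReferenceNoise.withSolver {Ω : Type*} [MeasurableSpace Ω] {Pr : Measure Ω}
    (R : ReferenceNoise M Pr) (N : ℕ) : ReferenceNoise (M.withSolver N) Pr where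
  u₀ := R.u₀
  w := R.w
  η := R.η
  measurable_u₀ := R.measurable_u₀
  measurable_w := R.measurable_w
  measurable_η := R.measurable_η
  law_u₀ := R.law_u₀
  law_w := R.law_w
  law_η := R.law_η
  indep := R.indep

variable (M)

/-- The mean-field state of a particle. -/
noncomputable def FilterModel.mfState : ℕ → ParticleData d dO 𝓦 → Vec d
  | 0, x => x.1
  | n + 1, x => M.assimilate (M.mfGain n) (M.exact n (FilterModel.mfState n x) (x.2.1 n))
      (M.y (n + 1) + x.2.2 (n + 1))

theorem assimilate_apply (K : Matrix (Fin d) (Fin dO) ℝ) (v : Vec d) (z : Vec dO) (a : Fin d) :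
    M.assimilate K v z a
      = ∑ b, (1 - K * M.H : Matrix (Fin d) (Fin d) ℝ) a b * v b + ∑ q, K a q * z q := by
  simp only [FilterModel.assimilate, PiLp.add_apply]
  rfl

theorem measurable_assimilate {Ω : Type*} {_ : MeasurableSpace Ω}
    {K : Ω → Matrix (Fin d) (Fin dO) ℝ} {v : Ω → Vec d} {z : Ω → Vec dO}
    (hK : ∀ p q, Measurable fun ω => K ω p q) (hv : Measurable v) (hz : Measurable z) :
    Measurable fun ω => M.assimilate (K ω) (v ω) (z ω) := by
  refine measurable_vec fun a => ?_
  simp only [assimilate_apply, Matrix.sub_apply]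
  refine Measurable.add (Finset.measurable_fun_sum _ fun b _ => Measurable.mul ?_
    ((measurable_coord b).comp hv)) (Finset.measurable_fun_sum _ fun q _ =>
      (hK a q).mul ((measurable_coord q).comp hz))
  exact measurable_const.sub (measurable_matrix_mul (A := K) (B := fun _ => M.H) hK
    (fun _ _ => measurable_const) a b)

theorem measurable_mfState (n : ℕ) : Measurable[pastData d dO 𝓦 n] (M.mfState n) := by
  induction n with
  | zero => exact measurable_pastData_init 0
  | succ n ih =>
    refine @measurable_assimilate _ _ _ _ M _ (_) _ _ _ (fun _ _ => measurable_const) ?_ ?_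
    · exact (M.measurable_exact n).comp (@Measurable.prodMk _ _ _ _ _ (_) _ _
        (ih.mono (pastData_mono n.le_succ) le_rfl) (measurable_pastData_noise n.lt_succ_self))
    · exact (measurable_pastData_obs (by omega) le_rfl).const_add _

/-- The quadratic form of the matrix at `x` is the variance of `∑ a, x a * v a`. -/
theorem covMatrix_posSemidef {μ : Measure (Vec d)} [IsProbabilityMeasure μ]
    (h : ∀ a, MemLp (fun x : Vec d => x a) 2 μ) : (covMatrix μ).PosSemidef := by
  refine Matrix.PosSemidef.of_dotProduct_mulVec_nonneg ?_ fun x => ?_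
  · ext a b
    simp [covMatrix, covariance_comm]
  · have : star x ⬝ᵥ (covMatrix μ *ᵥ x) = Var[fun v : Vec d => ∑ a, x a * v a; μ] := by
      rw [← covariance_self (by fun_prop),
        covariance_fun_sum_fun_sum (fun a => (h a).const_mul _) (fun a => (h a).const_mul _)]
      simp only [covMatrix, dotProduct, Matrix.mulVec, Matrix.of_apply, covariance_const_mul_left,
        covariance_const_mul_right, Finset.mul_sum, star_trivial]
      exact Finset.sum_congr rfl fun a _ => Finset.sum_congr rfl fun b _ => by ring
    rw [this]
    exact variance_nonneg _ _

/-- The quadratic form is an empirical variance, nonnegative by the Cauchy–Schwarz inequality. It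
holds for every realization, as the uniform bound on the inverse in the gain requires. -/
theorem sampleCov_posSemidef (P : ℕ) (v : ℕ → Vec d) : (sampleCov P v).PosSemidef := by
  refine Matrix.PosSemidef.of_dotProduct_mulVec_nonneg ?_ fun x => ?_
  · ext a b
    simp only [sampleCov, Matrix.conjTranspose_apply, Matrix.of_apply, star_trivial]
    congr 1
    · congr 1
      exact Finset.sum_congr rfl fun i _ => mul_comm _ _
    · exact mul_comm _ _
  · set f : ℕ → ℝ := fun i => ∑ a, x a * v i a with hf
    have : star x ⬝ᵥ (sampleCov P v *ᵥ x)
        = (∑ i ∈ Finset.range P, f i ^ 2) / P - ((∑ i ∈ Finset.range P, f i) / P) ^ 2 := by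
      have e1 : ∑ i ∈ Finset.range P, f i ^ 2
          = ∑ a, ∑ b, x a * (∑ i ∈ Finset.range P, v i a * v i b) * x b := by
        simp only [hf, sq, Finset.mul_sum, Finset.sum_mul]
        rw [Finset.sum_comm]
        refine Finset.sum_congr rfl fun a _ => ?_
        rw [Finset.sum_comm]
        exact Finset.sum_congr rfl fun b _ => Finset.sum_congr rfl fun i _ => by ring
      have e2 : ∑ i ∈ Finset.range P, f i = ∑ a, x a * ∑ i ∈ Finset.range P, v i a := by
        simp only [hf, Finset.mul_sum]
        rw [Finset.sum_comm]
      rw [e1, e2, sq, Finset.sum_div, Finset.sum_div, Finset.sum_mul_sum, ← Finset.sum_sub_distrib]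
      simp only [sampleCov, dotProduct, Matrix.mulVec, Matrix.of_apply, star_trivial,
        Finset.mul_sum, Finset.sum_div]
      refine Finset.sum_congr rfl fun a _ => ?_
      rw [← Finset.sum_sub_distrib]
      refine Finset.sum_congr rfl fun b _ => ?_
      simp only [← Finset.mul_sum, ← Finset.sum_div]
      ring
    rw [this, sub_nonneg, div_pow]
    rcases Nat.eq_zero_or_pos P with h0 | h0
    · simp [h0]
    have hP : (0 : ℝ) < P := by exact_mod_cast h0
    have := sq_sum_le_card_mul_sum_sq (s := Finset.range P) (f := f)
    rw [Finset.card_range] at this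
    rw [div_le_div_iff₀ (by positivity) hP]
    nlinarith

variable {Ω : Type*} [MeasurableSpace Ω] {Pr : Measure Ω} [IsProbabilityMeasure Pr] {M}

theorem ReferenceNoise.map_predict (R : ReferenceNoise M Pr) {n : ℕ}
    (h : Pr.map (fun ω => M.mfState n (R.data ω)) = M.mfMeasure n) :
    Pr.map (fun ω => M.exact n (M.mfState n (R.data ω)) (R.w n ω))
      = M.mfPredict n (M.mfMeasure n) := by
  have hs := R.measurable_comp_data (measurable_mfState M n)
  have hs' : Measurable fun ω => M.mfState n (R.data ω) :=
    ((measurable_mfState M n).mono (pastData_le n) le_rfl).comp R.measurable_data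
  rw [FilterModel.mfPredict, ← h, ← R.law_w n, ← (indepFun_iff_map_prod_eq_prod_map_map
    hs'.aemeasurable (R.measurable_w n).aemeasurable).1 (R.indepFun_w hs),
    Measure.map_map (M.measurable_exact n) (hs'.prodMk (R.measurable_w n))]
  rfl

/-- This identifies the pathwise recursion with the recursion of measures. The state is independent
of the next driving noise and the prediction is independent of the next observation noise, so both
joint laws are products. -/
theorem ReferenceNoise.map_mfState (R : ReferenceNoise M Pr) (n : ℕ) :
    Pr.map (fun ω => M.mfState n (R.data ω)) = M.mfMeasure n := by
  induction n with
  | zero => exact R.law_u₀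
  | succ n ih =>
    have hp := R.map_predict ih
    have hs := R.measurable_comp_data (measurable_mfState M n)
    have hs' : Measurable fun ω => M.mfState n (R.data ω) :=
      ((measurable_mfState M n).mono (pastData_le n) le_rfl).comp R.measurable_data
    have hv : Measurable fun ω => M.exact n (M.mfState n (R.data ω)) (R.w n ω) :=
      (M.measurable_exact n).comp (hs'.prodMk (R.measurable_w n))
    have hs1 : Measurable[R.past n ⊔ MeasurableSpace.comap (R.w n) inferInstance]
        fun ω => M.mfState n (R.data ω) := hs.mono le_sup_left le_rfl
    have hw1 : Measurable[R.past n ⊔ MeasurableSpace.comap (R.w n) inferInstance] (R.w n) :=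
      (comap_measurable (R.w n)).mono le_sup_right le_rfl
    have hv' : Measurable[R.past n ⊔ MeasurableSpace.comap (R.w n) inferInstance]
        fun ω => M.exact n (M.mfState n (R.data ω)) (R.w n ω) :=
      (M.measurable_exact n).comp (hs1.prodMk hw1)
    rw [FilterModel.mfMeasure, FilterModel.mfUpdate, ← hp, ← R.law_η (n + 1),
      ← (indepFun_iff_map_prod_eq_prod_map_map
        hv.aemeasurable (R.measurable_η _).aemeasurable).1 (R.indepFun_η hv'),
      Measure.map_map _ (hv.prodMk (R.measurable_η _))]
    · rw [hp]
      rfl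
    · exact measurable_assimilate M (fun _ _ => measurable_const) measurable_fst
        (measurable_snd.const_add _)

theorem memLp_obs (Γ : Matrix (Fin dO) (Fin dO) ℝ) (q : Fin dO) (p : ℝ≥0) :
    MemLp (fun z : Vec dO => z q) p (multivariateGaussian 0 Γ) :=
  IsGaussian.memLp_dual _ (EuclideanSpace.proj (𝕜 := ℝ) q) p (by simp)

theorem ReferenceNoise.memLp_η (R : ReferenceNoise M Pr) (n : ℕ) (q : Fin dO) (p : ℝ≥0) :
    MemLp (fun ω => R.η n ω q) p Pr := by
  have := memLp_obs M.Γ q p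
  rw [← R.law_η n] at this
  exact this.comp_of_map (R.measurable_η n).aemeasurable

theorem covMatrix_map_apply {V : Ω → Vec d} (hV : Measurable V)
    (h : ∀ a, MemLp (fun ω => V ω a) 2 Pr) (a b : Fin d) :
    covMatrix (Pr.map V) a b
      = ∫ ω, V ω a * V ω b ∂Pr - (∫ ω, V ω a ∂Pr) * ∫ ω, V ω b ∂Pr := by
  simp only [covMatrix, Matrix.of_apply]
  rw [covariance_map (measurable_coord a).aestronglyMeasurable
    (measurable_coord b).aestronglyMeasurable hV.aemeasurable]
  exact covariance_eq_sub (h a) (h b)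

theorem covMatrix_map_posSemidef {V : Ω → Vec d} (hV : Measurable V)
    (h : ∀ a, MemLp (fun ω => V ω a) 2 Pr) : (covMatrix (Pr.map V)).PosSemidef := by
  have := Measure.isProbabilityMeasure_map (μ := Pr) hV.aemeasurable
  refine covMatrix_posSemidef fun a => ?_
  rw [memLp_map_measure_iff (measurable_coord a).aestronglyMeasurable hV.aemeasurable]
  exact h a

end MeanField

/-! ### First-order expansion of the EnKF particles -/

section EnKFExpansion

variable {d dO : ℕ} {𝓦 : Type*} [MeasurableSpace 𝓦] {M : FilterModel d dO 𝓦}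
  {Ω : Type*} [MeasurableSpace Ω] {Pr : Measure Ω} [IsProbabilityMeasure Pr]
  {Ω' : Type*} [MeasurableSpace Ω'] {Pr' : Measure Ω'} [IsProbabilityMeasure Pr']
  {ι θ : Type*} {T : LevelPairs ι θ}

theorem Expands.perturbed_obs (R : ReferenceNoise M Pr) (n : ℕ) (q : Fin dO) :
    Expands (Pr.map R.data) T (n + 1)
      (fun (_ : ι) (C : Config M Pr') i ω => M.y (n + 1) q + C.E.obs (n + 1, i) ω q)
      (fun _ x => M.y (n + 1) q + x.2.2 (n + 1) q) := by
  have hQ : IsParticleLaw M Pr' (Pr.map R.data) := R.isParticleLaw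
  have hQp := hQ.prob
  have hm : Measurable[pastData d dO 𝓦 (n + 1)]
      fun x : ParticleData d dO 𝓦 => M.y (n + 1) q + x.2.2 (n + 1) q :=
    Measurable.const_add ((measurable_coord q).comp
      (measurable_pastData_obs (n := n + 1) (j := n + 1) (Nat.le_add_left 1 n) le_rfl)) _
  have hm' : Measurable fun x : ParticleData d dO 𝓦 => M.y (n + 1) q + x.2.2 (n + 1) q :=
    hm.mono (pastData_le _) le_rfl
  have hp : ∀ p : ℝ≥0, MemLp (fun ω => M.y (n + 1) q + R.η (n + 1) ω q) p Pr := fun p =>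
    (memLp_const (M.y (n + 1) q)).add (R.memLp_η (n + 1) q p)
  have hp' : ∀ p : ℝ≥0, MemLp (fun x : ParticleData d dO 𝓦 => M.y (n + 1) q + x.2.2 (n + 1) q) p
      (Pr.map R.data) := fun p =>
    (memLp_map_measure_iff hm'.aestronglyMeasurable R.measurable_data.aemeasurable).2 (hp p)
  have hreg : Regular (Pr.map R.data) T
      (fun (_ : ι) (x : ParticleData d dO 𝓦) => M.y (n + 1) q + x.2.2 (n + 1) q) :=
    Regular.fixed hm' hp'
  exact Expands.of_data (M := M) (Pr' := Pr') hreg fun _ => hm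

/-- Induction over time. The prediction is a smooth kernel with fresh noise, the sample covariance
is a polynomial in ensemble averages, the gain is covered by `Expands.gain`, and the update is a sum
of products. The limit is the mean-field state of the model whose dynamics is the solver itself. -/
theorem Expands.enkf (R : ReferenceNoise M Pr) (hinit : ∀ a (p : ℝ≥0), MemLp (fun ω => R.u₀ ω a) p Pr)
    (res : ι → ℕ) {G : ℕ → Fin d → Fin d → ι → Vec d → 𝓦 → ℝ} {m : ℕ}
    (K : ∀ n b, SmoothKernel T (M.noiseLaw n) (fun j x w => M.solver n (res j) x w b) (G n b) m)
    (n : ℕ) : ∀ a, Expands (Pr.map R.data) T n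
      (fun j (C : Config M Pr') i ω => M.enkf (res j) C.P (C.E.drivers ω) n i a)
      (fun j x => (M.withSolver (res j)).mfState n x a) := by
  have hQ : IsParticleLaw M Pr' (Pr.map R.data) := R.isParticleLaw
  have hQp := hQ.prob
  have hmem : ∀ {f : ParticleData d dO 𝓦 → ℝ}, Measurable f → (∀ p : ℝ≥0, MemLp (fun ω => f (R.data ω)) p Pr) →
      ∀ p : ℝ≥0, MemLp f p (Pr.map R.data) := fun hf h p =>
    (memLp_map_measure_iff hf.aestronglyMeasurable R.measurable_data.aemeasurable).2 (h p)
  induction n with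
  | zero =>
    intro a
    have hm : Measurable[pastData d dO 𝓦 0] fun x : ParticleData d dO 𝓦 => x.1 a :=
      (measurable_coord a).comp (measurable_pastData_init 0)
    exact Expands.of_data (Regular.fixed (hm.mono (pastData_le 0) le_rfl)
      (hmem (hm.mono (pastData_le 0) le_rfl) (hinit a))) fun _ => hm
  | succ n ih =>
    let v : ι → Config M Pr' → Ω' → ℕ → Vec d := fun j C ω i =>
      M.solver n (res j) (M.enkf (res j) C.P (C.E.drivers ω) n i) (C.E.noise (n, i) ω)
    let vl : ι → ParticleData d dO 𝓦 → Vec d := fun j x =>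
      M.solver n (res j) ((M.withSolver (res j)).mfState n x) (x.2.1 n)
    have hv : ∀ b, Expands (Pr.map R.data) T (n + 1) (fun j (C : Config M Pr') i ω => v j C ω i b)
        (fun j x => vl j x b) := fun b => Expands.kernel (M := M) (K n b)
      (V := fun j C i ω => M.enkf (res j) C.P (C.E.drivers ω) n i)
      (Vl := fun j x => (M.withSolver (res j)).mfState n x) ih
    have hvl : ∀ j, Measurable (vl j) := fun j => (M.measurable_solver n (res j)).comp
      (((measurable_mfState _ n).mono (pastData_le n) le_rfl).prodMk (measurable_noise_coord n))
    have hvlp : ∀ j a, MemLp (fun x => vl j x a) 2 (Pr.map R.data) := fun j a => by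
      have h := LpO.memLp (X := fun j x => vl j x a) (hv a).regular.bdd j 2
      exact h
    have hpred : ∀ j, (Pr.map R.data).map (vl j) = (M.withSolver (res j)).mfPredict n
        ((M.withSolver (res j)).mfMeasure n) := fun j => by
      rw [Measure.map_map (hvl j) R.measurable_data]
      exact (R.withSolver (res j)).map_predict ((R.withSolver (res j)).map_mfState n)
    -- The average of the products minus the product of the averages; its limit is the covariance of
    -- the mean-field prediction by `covMatrix_map_apply`.
    have hcov : ∀ a b, Expands (Pr.map R.data) T (n + 1)
        (fun j (C : Config M Pr') _ ω => sampleCov C.P (v j C ω) a b)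
        (fun j _ => covMatrix ((Pr.map R.data).map (vl j)) a b) := fun a b => by
      refine ((((hv a).mul (hv b)).average).sub (((hv a).average).mul ((hv b).average))).congr
        (fun j C i ω => ?_) fun j x => ?_
      · simp [sampleCov]
      · rw [covMatrix_map_apply (hvl j) (hvlp j)]
    have hgain := Expands.gain hcov (fun j C i ω => sampleCov_posSemidef _ _)
      (fun j => covMatrix_map_posSemidef (hvl j) (hvlp j))
    have hobs := fun q => Expands.perturbed_obs (T := T) (Pr' := Pr') R n q
    intro a
    have h1KH : ∀ b, Expands (Pr.map R.data) T (n + 1)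
        (fun j (C : Config M Pr') _ ω =>
          (1 - M.gain (sampleCov C.P (v j C ω)) * M.H : Matrix (Fin d) (Fin d) ℝ) a b)
        (fun j _ => (1 - M.gain (covMatrix ((Pr.map R.data).map (vl j))) * M.H :
          Matrix (Fin d) (Fin d) ℝ) a b) := fun b =>
      (Expands.const (n := n + 1) (Pr' := Pr') (M := M)
        (Regular.fixed_const ((1 : Matrix (Fin d) (Fin d) ℝ) a b))).sub
      (Expands.matrix_mul (A := fun j (C : Config M Pr') _ ω => M.gain (sampleCov C.P (v j C ω)))
        (Al := fun j _ => M.gain (covMatrix ((Pr.map R.data).map (vl j))))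
        (B := fun _ _ _ _ => M.H) (Bl := fun _ _ => M.H) hgain
        (fun p q => Expands.const (n := n + 1) (Pr' := Pr') (M := M)
          (Regular.fixed_const (M.H p q))) a b)
    refine ((Expands.sum Finset.univ fun b _ => (h1KH b).mul (hv b)).add
      (Expands.sum Finset.univ fun q _ => (hgain a q).mul (hobs q))).congr
      (fun j C i ω => ?_) fun j x => ?_
    · simp only [FilterModel.enkf]
      rw [assimilate_apply]
      rfl
    · rw [FilterModel.mfState, assimilate_apply, FilterModel.mfGain, hpred]
      rfl

end EnKFExpansion

/-! ### From bounds on partial derivatives to smooth kernels -/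

section Partials

variable {d : ℕ} {𝓦 Λ ι θ : Type*} [MeasurableSpace 𝓦] {ν : Measure 𝓦} [IsProbabilityMeasure ν]

/-- Moments of an increment are controlled by the moments of the derivative along a path. -/
theorem LpO.of_path {X X' : Λ → ℝ → 𝓦 → ℝ} {ρ : Λ → ℝ≥0}
    (hX : ∀ a, ∀ᵐ w ∂ν, (∀ t, HasDerivAt (fun t => X a t w) (X' a t w) t)
      ∧ Continuous fun t => X' a t w)
    (hm : ∀ a, Measurable fun q : ℝ × 𝓦 => X' a q.1 q.2)
    (hmX : ∀ a, AEStronglyMeasurable (fun w => X a 1 w - X a 0 w) ν)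
    (hb : LpO ν (fun q : Λ × Set.Icc (0 : ℝ) 1 => X' q.1 q.2) (fun q => ρ q.1)) :
    LpO ν (fun a w => X a 1 w - X a 0 w) ρ := by
  refine LpO.of_two_le hmX fun p hp => ?_
  obtain ⟨C, hC⟩ := hb.bound p
  refine ⟨C, fun a => ?_⟩
  set lam : Measure ℝ := volume.restrict (Set.Ioc (0 : ℝ) 1) with hlam
  have hlp : IsProbabilityMeasure lam := ⟨by simp [hlam]⟩
  have hp0 : (p : ℝ≥0∞) ≠ 0 := by
    have : (0 : ℝ≥0) < p := lt_of_lt_of_le (by norm_num) hp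
    exact_mod_cast this.ne'
  have hp1 : (1 : ℝ≥0∞) ≤ p := by exact_mod_cast one_le_two.trans hp
  have hpr : 0 < (p : ℝ≥0∞).toReal := ENNReal.toReal_pos hp0 ENNReal.coe_ne_top
  -- The increment is the integral of the derivative over `[0, 1]`, and Jensen's inequality moves
  -- the `p`-th power inside.
  have hpt : ∀ᵐ w ∂ν, ‖X a 1 w - X a 0 w‖ₑ ^ (p : ℝ≥0∞).toReal
      ≤ ∫⁻ t, ‖X' a t w‖ₑ ^ (p : ℝ≥0∞).toReal ∂lam := by
    filter_upwards [hX a] with w hw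
    have h1 : X a 1 w - X a 0 w = ∫ t, X' a t w ∂lam := by
      rw [hlam, ← intervalIntegral.integral_of_le zero_le_one]
      exact (intervalIntegral.integral_eq_sub_of_hasDerivAt (fun t _ => hw.1 t)
        (hw.2.intervalIntegrable 0 1)).symm
    have h2 : ‖X a 1 w - X a 0 w‖ₑ ≤ eLpNorm (fun t => X' a t w) p lam := by
      rw [h1]
      refine (enorm_integral_le_lintegral_enorm _).trans ?_
      rw [← eLpNorm_one_eq_lintegral_enorm]
      exact eLpNorm_le_eLpNorm_of_exponent_le hp1 hw.2.aestronglyMeasurable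
    rw [eLpNorm_eq_lintegral_rpow_enorm_toReal hp0 ENNReal.coe_ne_top] at h2
    calc _ ≤ _ := ENNReal.rpow_le_rpow h2 hpr.le
      _ = _ := by rw [← ENNReal.rpow_mul, one_div, inv_mul_cancel₀ hpr.ne', ENNReal.rpow_one]
  -- Tonelli's theorem exchanges the path parameter and the randomness, so that moments at fixed `t`
  -- suffice.
  have hfub : ∫⁻ w, ‖X a 1 w - X a 0 w‖ₑ ^ (p : ℝ≥0∞).toReal ∂ν
      ≤ ((C * ρ a : ℝ≥0) : ℝ≥0∞) ^ (p : ℝ≥0∞).toReal := by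
    refine (lintegral_mono_ae hpt).trans ?_
    rw [lintegral_lintegral_swap]
    · have hb' : ∀ᵐ t ∂lam, ∫⁻ w, ‖X' a t w‖ₑ ^ (p : ℝ≥0∞).toReal ∂ν
          ≤ ((C * ρ a : ℝ≥0) : ℝ≥0∞) ^ (p : ℝ≥0∞).toReal := by
        filter_upwards [ae_restrict_mem (measurableSet_Ioc (a := (0 : ℝ)) (b := 1))] with t ht
        have := hC (a, ⟨t, Set.Ioc_subset_Icc_self ht⟩)
        simp only [] at this
        rw [eLpNorm_eq_lintegral_rpow_enorm_toReal hp0 ENNReal.coe_ne_top] at this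
        have h3 := ENNReal.rpow_le_rpow this hpr.le
        rwa [← ENNReal.rpow_mul, one_div, inv_mul_cancel₀ hpr.ne', ENNReal.rpow_one] at h3
      refine (lintegral_mono_ae hb').trans ?_
      simp
    · exact ((((hm a).comp measurable_swap).enorm).pow_const _).aemeasurable
  rw [eLpNorm_eq_lintegral_rpow_enorm_toReal hp0 ENNReal.coe_ne_top]
  calc _ ≤ _ := ENNReal.rpow_le_rpow hfub (by positivity)
    _ = _ := by rw [← ENNReal.rpow_mul, one_div, mul_inv_cancel₀ hpr.ne', ENNReal.rpow_one]

/-- Partial derivatives of a random function have a jointly measurable version. -/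
theorem exists_measurable_partial {f : Vec d → 𝓦 → ℝ}
    (hm : Measurable fun q : Vec d × 𝓦 => f q.1 q.2)
    (hf : ∀ᵐ w ∂ν, Differentiable ℝ fun x => f x w) (v : Vec d) :
    ∃ F : Vec d → 𝓦 → ℝ, Measurable (fun q : Vec d × 𝓦 => F q.1 q.2) ∧
      ∀ᵐ w ∂ν, ∀ x, F x w = fderiv ℝ (fun x => f x w) x v := by
  classical
  -- The noises at which differentiability may fail are enclosed in a measurable null set, on which
  -- the version is set to zero.
  obtain ⟨S, hS, hSm, hS0⟩ := exists_measurable_superset_of_null (ae_iff.1 hf)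
  have hgood : ∀ w, w ∉ S → Differentiable ℝ fun x => f x w := fun w hw => by
    by_contra h
    exact hw (hS h)
  refine ⟨fun x w => if w ∈ S then 0 else fderiv ℝ (fun x => f x w) x v, ?_, ?_⟩
  -- Off this null set the directional derivative is the pointwise limit of difference quotients
  -- with step `1 / k`, which are jointly measurable.
  · refine measurable_of_tendsto_metrizable (f := fun (k : ℕ) (q : Vec d × 𝓦) =>
      if q.2 ∈ S then 0 else (k : ℝ) * (f (q.1 + (k : ℝ)⁻¹ • v) q.2 - f q.1 q.2)) (fun k => ?_) ?_
    · refine Measurable.ite (measurable_snd hSm) measurable_const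
        (Measurable.const_mul (Measurable.sub ?_ hm) _)
      exact hm.comp ((measurable_fst.add_const _).prodMk measurable_snd)
    · rw [tendsto_pi_nhds]
      rintro ⟨x, w⟩
      by_cases hw : w ∈ S
      · simp [hw]
      · simp only [hw, if_false]
        have := (hgood w hw x).hasFDerivAt.lim v (c := fun k : ℕ => (k : ℝ)) (l := Filter.atTop)
          (by simpa using tendsto_natCast_atTop_atTop (R := ℝ))
        simpa using this
  · have : ∀ᵐ w ∂ν, w ∉ S := measure_eq_zero_iff_ae_notMem.1 hS0
    filter_upwards [this] with w hw x
    simp [hw]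

theorem fderiv_eq_sum_single {h : Vec d → ℝ} (x v : Vec d) :
    fderiv ℝ h x v = ∑ a, fderiv ℝ h x (EuclideanSpace.single a 1) * v a := by
  conv_lhs => rw [← (EuclideanSpace.basisFun (Fin d) ℝ).sum_repr v]
  rw [map_sum]
  exact Finset.sum_congr rfl fun a _ => by simp [mul_comm]

theorem norm_segment_le (x y : Vec d) {t : ℝ} (ht : t ∈ Set.Icc (0 : ℝ) 1) :
    ‖x + t • (y - x)‖₊ ≤ ‖x‖₊ + ‖y‖₊ := by
  have h : x + t • (y - x) = (1 - t) • x + t • y := by module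
  rw [h]
  refine (nnnorm_add_le _ _).trans ?_
  rw [← NNReal.coe_le_coe]
  push_cast
  rw [norm_smul, norm_smul, Real.norm_of_nonneg ht.1, Real.norm_of_nonneg (by linarith [ht.2])]
  have := norm_nonneg x
  have := norm_nonneg y
  have := ht.1
  have := ht.2
  nlinarith

theorem measurable_segment (x y : Vec d) :
    Measurable fun q : ℝ × 𝓦 => (x + q.1 • (y - x), q.2) := by fun_prop

theorem continuous_segment (x y : Vec d) : Continuous fun t : ℝ => x + t • (y - x) := by fun_prop

theorem hasDerivAt_segment {h : Vec d → ℝ} (hh : ContDiff ℝ 1 h) (x y : Vec d) (t : ℝ) :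
    HasDerivAt (fun t : ℝ => h (x + t • (y - x)))
      (∑ a, fderiv ℝ h (x + t • (y - x)) (EuclideanSpace.single a 1) * (y a - x a)) t := by
  have h1 : HasDerivAt (fun t : ℝ => x + t • (y - x)) (y - x) t := by
    simpa using ((hasDerivAt_id t).smul_const (y - x)).const_add x
  have h2 := ((hh.differentiable (by simp)) (x + t • (y - x))).hasFDerivAt.comp_hasDerivAt t h1
  rw [fderiv_eq_sum_single] at h2
  simp only [PiLp.sub_apply] at h2
  exact h2

variable {f : ι → Vec d → 𝓦 → ℝ} {F : Fin d → ι → Vec d → 𝓦 → ℝ} {m : ℕ}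

/-- `LpO.of_path` along the segment from `x` to `y`, on which the norm is at most `‖x‖ + ‖y‖`. -/
theorem LpO.lip_of_partials (hm : ∀ j, Measurable fun q : Vec d × 𝓦 => f j q.1 q.2)
    (hF : ∀ a j, Measurable fun q : Vec d × 𝓦 => F a j q.1 q.2)
    (hf : ∀ j, ∀ᵐ w ∂ν, ContDiff ℝ 1 fun x => f j x w)
    (hd : ∀ a j, ∀ᵐ w ∂ν, ∀ x, F a j x w
      = fderiv ℝ (fun x => f j x w) x (EuclideanSpace.single a 1))
    (hg : ∀ a, LpO ν (fun q : ι × Vec d => F a q.1 q.2) (fun q => (1 + ‖q.2‖₊) ^ m)) :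
    LpO ν (fun (q : ι × Vec d × Vec d) w => f q.1 q.2.2 w - f q.1 q.2.1 w)
      (fun q => (1 + ‖q.2.1‖₊ + ‖q.2.2‖₊) ^ m * ‖q.2.2 - q.2.1‖₊) := by
  have := LpO.of_path (ν := ν) (Λ := ι × Vec d × Vec d)
    (X := fun q t w => f q.1 (q.2.1 + t • (q.2.2 - q.2.1)) w)
    (X' := fun q t w => ∑ a, F a q.1 (q.2.1 + t • (q.2.2 - q.2.1)) w * (q.2.2 a - q.2.1 a))
    (ρ := fun q => (1 + ‖q.2.1‖₊ + ‖q.2.2‖₊) ^ m * ‖q.2.2 - q.2.1‖₊) ?_ ?_ ?_ ?_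
  · exact this.congr fun q w => by simp
  · rintro ⟨j, x, y⟩
    filter_upwards [hf j, ae_all_iff.2 fun a => hd a j] with w hw hdw
    refine ⟨fun t => ?_, ?_⟩
    · simp only [hdw]
      exact hasDerivAt_segment hw x y t
    · simp only [hdw]
      refine continuous_finsetSum _ fun a _ => Continuous.mul ?_ continuous_const
      exact ((hw.continuous_fderiv (by simp)).clm_apply continuous_const).comp
        (continuous_segment x y)
  · rintro ⟨j, x, y⟩
    exact Finset.measurable_fun_sum _ fun a _ =>
      ((hF a j).comp (measurable_segment x y)).mul_const _
  · rintro ⟨j, x, y⟩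
    exact (((hm j).comp (measurable_const.prodMk measurable_id)).sub
      ((hm j).comp (measurable_const.prodMk measurable_id))).aestronglyMeasurable
  · refine LpO.sum _ fun a _ => ?_
    have h1 := (hg a).reindex fun q : (ι × Vec d × Vec d) × Set.Icc (0 : ℝ) 1 =>
      (q.1.1, q.1.2.1 + (q.2 : ℝ) • (q.1.2.2 - q.1.2.1))
    have h2 := LpO.const (μ := ν)
      (c := fun q : (ι × Vec d × Vec d) × Set.Icc (0 : ℝ) 1 => q.1.2.2 a - q.1.2.1 a)
      (ρ := fun q => ‖q.1.2.2 - q.1.2.1‖₊) 1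
      (fun q => by simpa using abs_coord_le_norm (q.1.2.2 - q.1.2.1) a)
    refine (h1.mul h2).le fun ⟨⟨j, x, y⟩, t⟩ => ?_
    have h3 : 1 + ‖x + (t : ℝ) • (y - x)‖₊ ≤ 1 + ‖x‖₊ + ‖y‖₊ := by
      rw [add_assoc]
      exact add_le_add_right (norm_segment_le x y t.2) 1
    simp only
    gcongr

/-- `LpO.of_path` is applied to t ↦ f(x + t(y - x)) - t Df(x)(y - x). Its derivative is an increment
of the partial derivatives, itself of order ‖y - x‖ by hypothesis, times `y - x`. The factor `2 ^ m`
arises since the norm of the point on the segment is added to that of `x`. -/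
theorem LpO.taylor_of_partials (hm : ∀ j, Measurable fun q : Vec d × 𝓦 => f j q.1 q.2)
    (hF : ∀ a j, Measurable fun q : Vec d × 𝓦 => F a j q.1 q.2)
    (hf : ∀ j, ∀ᵐ w ∂ν, ContDiff ℝ 1 fun x => f j x w)
    (hd : ∀ a j, ∀ᵐ w ∂ν, ∀ x, F a j x w
      = fderiv ℝ (fun x => f j x w) x (EuclideanSpace.single a 1))
    (hg : ∀ a, LpO ν (fun (q : ι × Vec d × Vec d) w => F a q.1 q.2.2 w - F a q.1 q.2.1 w)
      (fun q => (1 + ‖q.2.1‖₊ + ‖q.2.2‖₊) ^ m * ‖q.2.2 - q.2.1‖₊)) :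
    LpO ν (fun (q : ι × Vec d × Vec d) w => f q.1 q.2.2 w - f q.1 q.2.1 w
        - ∑ a, F a q.1 q.2.1 w * (q.2.2 a - q.2.1 a))
      (fun q => (1 + ‖q.2.1‖₊ + ‖q.2.2‖₊) ^ m * ‖q.2.2 - q.2.1‖₊ ^ 2) := by
  have := LpO.of_path (ν := ν) (Λ := ι × Vec d × Vec d)
    (X := fun q t w => f q.1 (q.2.1 + t • (q.2.2 - q.2.1)) w
      - t * ∑ a, F a q.1 q.2.1 w * (q.2.2 a - q.2.1 a))
    (X' := fun q t w => ∑ a, (F a q.1 (q.2.1 + t • (q.2.2 - q.2.1)) w - F a q.1 q.2.1 w)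
      * (q.2.2 a - q.2.1 a))
    (ρ := fun q => 2 ^ m * ((1 + ‖q.2.1‖₊ + ‖q.2.2‖₊) ^ m * ‖q.2.2 - q.2.1‖₊ ^ 2)) ?_ ?_ ?_ ?_
  · exact (this.mono (2 ^ m) fun q => le_rfl).congr fun q w => by simp; ring
  · rintro ⟨j, x, y⟩
    filter_upwards [hf j, ae_all_iff.2 fun a => hd a j] with w hw hdw
    refine ⟨fun t => ?_, ?_⟩
    · simp only [sub_mul, Finset.sum_sub_distrib]
      refine HasDerivAt.sub ?_ (by
        simpa using (hasDerivAt_id t).mul_const (∑ a, F a j x w * (y a - x a)))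
      simp only [hdw]
      exact hasDerivAt_segment hw x y t
    · simp only [hdw]
      refine continuous_finsetSum _ fun a _ => Continuous.mul (Continuous.sub ?_ continuous_const)
        continuous_const
      exact ((hw.continuous_fderiv (by simp)).clm_apply continuous_const).comp
        (continuous_segment x y)
  · rintro ⟨j, x, y⟩
    exact Finset.measurable_fun_sum _ fun a _ =>
      (((hF a j).comp (measurable_segment x y)).sub
        ((hF a j).comp (measurable_const.prodMk measurable_snd))).mul_const _
  · rintro ⟨j, x, y⟩
    have hms : ∀ z : Vec d, Measurable fun w => f j z w := fun z =>
      (hm j).comp (measurable_const.prodMk measurable_id)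
    have hFs : ∀ a, ∀ z : Vec d, Measurable fun w => F a j z w := fun a z =>
      (hF a j).comp (measurable_const.prodMk measurable_id)
    refine Measurable.aestronglyMeasurable ?_
    exact ((hms _).sub (Measurable.const_mul (Finset.measurable_fun_sum _ fun a _ =>
      (hFs a x).mul_const _) _)).sub ((hms _).sub (Measurable.const_mul
        (Finset.measurable_fun_sum _ fun a _ => (hFs a x).mul_const _) _))
  · refine LpO.sum _ fun a _ => ?_
    have h1 := (hg a).reindex fun q : (ι × Vec d × Vec d) × Set.Icc (0 : ℝ) 1 =>
      (q.1.1, q.1.2.1, q.1.2.1 + (q.2 : ℝ) • (q.1.2.2 - q.1.2.1))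
    have h2 := LpO.const (μ := ν)
      (c := fun q : (ι × Vec d × Vec d) × Set.Icc (0 : ℝ) 1 => q.1.2.2 a - q.1.2.1 a)
      (ρ := fun q => ‖q.1.2.2 - q.1.2.1‖₊) 1
      (fun q => by simpa using abs_coord_le_norm (q.1.2.2 - q.1.2.1) a)
    refine (h1.mul h2).le fun ⟨⟨j, x, y⟩, t⟩ => ?_
    simp only
    have h3 : ‖x + (t : ℝ) • (y - x) - x‖₊ ≤ ‖y - x‖₊ := by
      rw [add_sub_cancel_left, nnnorm_smul]
      refine mul_le_of_le_one_left (zero_le) ?_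
      rw [← NNReal.coe_le_coe]
      simpa [abs_of_nonneg t.2.1] using t.2.2
    have h4 : 1 + ‖x‖₊ + ‖x + (t : ℝ) • (y - x)‖₊ ≤ 2 * (1 + ‖x‖₊ + ‖y‖₊) := by
      refine (add_le_add_right (norm_segment_le x y t.2) _).trans ?_
      rw [← NNReal.coe_le_coe]
      push_cast
      linarith [norm_nonneg y]
    calc _ ≤ (2 * (1 + ‖x‖₊ + ‖y‖₊)) ^ m * ‖y - x‖₊ * ‖y - x‖₊ := by gcongr
      _ = _ := by rw [mul_pow]; ring

/-- Random functions that are twice continuously differentiable almost surely, with moment bounds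
for the function and its partial derivatives. -/
theorem SmoothKernel.of_contDiff {T : LevelPairs ι θ} {m : ℕ}
    (hm : ∀ j, Measurable fun q : Vec d × 𝓦 => f j q.1 q.2)
    (hf : ∀ j, ∀ᵐ w ∂ν, ContDiff ℝ 2 fun x => f j x w)
    (h0 : ∀ p : ℝ≥0, 2 ≤ p → ∃ C : ℝ≥0, ∀ j x,
      eLpNorm (fun w => f j x w) p ν ≤ (C * (1 + ‖x‖₊) ^ m : ℝ≥0))
    (h1 : ∀ (a : Fin d) (p : ℝ≥0), 2 ≤ p → ∃ C : ℝ≥0, ∀ j x,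
      eLpNorm (fun w => fderiv ℝ (fun x => f j x w) x (EuclideanSpace.single a 1)) p ν
        ≤ (C * (1 + ‖x‖₊) ^ m : ℝ≥0))
    (h2 : ∀ (a b : Fin d) (p : ℝ≥0), 2 ≤ p → ∃ C : ℝ≥0, ∀ j x,
      eLpNorm (fun w => fderiv ℝ (fun x => fderiv ℝ (fun x => f j x w) x
        (EuclideanSpace.single a 1)) x (EuclideanSpace.single b 1)) p ν
        ≤ (C * (1 + ‖x‖₊) ^ m : ℝ≥0))
    (h0p : ∀ p : ℝ≥0, 2 ≤ p → ∃ C : ℝ≥0, ∀ τ x,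
      eLpNorm (fun w => f (T.fine τ) x w - f (T.coarse τ) x w) p ν
        ≤ (C * ((1 + ‖x‖₊) ^ m * T.δ τ) : ℝ≥0))
    (h1p : ∀ (a : Fin d) (p : ℝ≥0), 2 ≤ p → ∃ C : ℝ≥0, ∀ τ x,
      eLpNorm (fun w => fderiv ℝ (fun x => f (T.fine τ) x w) x (EuclideanSpace.single a 1)
        - fderiv ℝ (fun x => f (T.coarse τ) x w) x (EuclideanSpace.single a 1)) p ν
        ≤ (C * ((1 + ‖x‖₊) ^ m * T.δ τ) : ℝ≥0)) :
    ∃ G : Fin d → ι → Vec d → 𝓦 → ℝ, SmoothKernel T ν f G m := by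
  have hf1 : ∀ j, ∀ᵐ w ∂ν, ContDiff ℝ 1 fun x => f j x w := fun j =>
    (hf j).mono fun w h => h.of_le (by norm_num)
  choose F hFm hF using fun (a : Fin d) (j : ι) => exists_measurable_partial (ν := ν) (hm j)
    ((hf1 j).mono fun w h => h.differentiable (by simp)) (EuclideanSpace.single a 1)
  have hFeq : ∀ a j, ∀ᵐ w ∂ν, (fun x => F a j x w)
      = fun x => fderiv ℝ (fun x => f j x w) x (EuclideanSpace.single a 1) := fun a j =>
    (hF a j).mono fun w h => funext h
  have hF1 : ∀ a j, ∀ᵐ w ∂ν, ContDiff ℝ 1 fun x => F a j x w := fun a j => by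
    filter_upwards [hFeq a j, hf j] with w h h'
    rw [h]
    exact (h'.fderiv_right (m := 1) (by norm_num)).clm_apply contDiff_const
  -- The versions `F` agree with the true derivatives for almost every noise and all points
  -- simultaneously, so they can be differentiated once more.
  choose F₂ hF₂m hF₂ using fun (b a : Fin d) (j : ι) => exists_measurable_partial (ν := ν) (hFm a j)
    ((hF1 a j).mono fun w h => h.differentiable (by simp)) (EuclideanSpace.single b 1)
  have hfs : ∀ j x, Measurable fun w => f j x w := fun j x =>
    (hm j).comp (measurable_const.prodMk measurable_id)
  have hFs : ∀ a j x, Measurable fun w => F a j x w := fun a j x =>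
    (hFm a j).comp (measurable_const.prodMk measurable_id)
  have hF₂s : ∀ b a j x, Measurable fun w => F₂ b a j x w := fun b a j x =>
    (hF₂m b a j).comp (measurable_const.prodMk measurable_id)
  have g1 : ∀ a, LpO ν (fun q : ι × Vec d => F a q.1 q.2) (fun q => (1 + ‖q.2‖₊) ^ m) := fun a => by
    refine LpO.of_two_le (fun q => (hFs _ _ _).aestronglyMeasurable) fun p hp => ?_
    obtain ⟨C, hC⟩ := h1 a p hp
    refine ⟨C, fun q => ?_⟩
    rw [eLpNorm_congr_ae ((hF a q.1).mono fun w h => h q.2)]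
    exact hC q.1 q.2
  have g2 : ∀ a b, LpO ν (fun q : ι × Vec d => F₂ b a q.1 q.2) (fun q => (1 + ‖q.2‖₊) ^ m) :=
    fun a b => by
      refine LpO.of_two_le (fun q => (hF₂s _ _ _ _).aestronglyMeasurable) fun p hp => ?_
      obtain ⟨C, hC⟩ := h2 a b p hp
      refine ⟨C, fun q => ?_⟩
      rw [eLpNorm_congr_ae ((hF₂ b a q.1).and (hFeq a q.1) |>.mono
        fun w h => (h.1 q.2).trans (by rw [h.2]))]
      exact hC q.1 q.2
  have hlip : ∀ a, _ := fun a => LpO.lip_of_partials (hFm a) (fun b => hF₂m b a) (hF1 a)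
    (fun b => hF₂ b a) (g2 a)
  refine ⟨F, ⟨hm, hFm, ?_, g1, LpO.lip_of_partials hm hFm hf1 hF g1, hlip,
    LpO.taylor_of_partials hm hFm hf1 hF hlip, ?_, fun a => ?_⟩⟩
  · refine LpO.of_two_le (fun q => (hfs _ _).aestronglyMeasurable) fun p hp => ?_
    exact (h0 p hp).imp fun C hC q => hC q.1 q.2
  · refine LpO.of_two_le (fun q => ((hfs _ _).sub (hfs _ _)).aestronglyMeasurable) fun p hp => ?_
    exact (h0p p hp).imp fun C hC q => hC q.1 q.2
  · refine LpO.of_two_le (fun q => ((hFs _ _ _).sub (hFs _ _ _)).aestronglyMeasurable)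
      fun p hp => ?_
    obtain ⟨C, hC⟩ := h1p a p hp
    refine ⟨C, fun q => ?_⟩
    rw [eLpNorm_congr_ae ((hF a (T.fine q.1)).and (hF a (T.coarse q.1)) |>.mono
      fun w h => congr_arg₂ _ (h.1 q.2) (h.2 q.2))]
    exact hC q.1 q.2

end Partials

/-! ### Observables as kernels that ignore the noise -/

section Observables

variable {d : ℕ} {𝓦 ι θ : Type*} [MeasurableSpace 𝓦]

theorem fderiv_fderiv_apply {φ : Vec d → ℝ} (hφ : ContDiff ℝ 2 φ) (x v w : Vec d) :
    fderiv ℝ (fun x => fderiv ℝ φ x v) x w = iteratedFDeriv ℝ 2 φ x ![w, v] := by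
  have h : DifferentiableAt ℝ (fderiv ℝ φ) x :=
    ((hφ.fderiv_right (m := 1) (by norm_num)).differentiable (by simp)) x
  rw [iteratedFDeriv_two_apply, fderiv_clm_apply h (differentiableAt_const v)]
  simp

theorem LpO.const_bound {Λ : Type*} {ν : Measure 𝓦} [IsProbabilityMeasure ν] {c : Λ → ℝ}
    {ρ : Λ → ℝ≥0} {K : ℝ} (h : ∀ a, |c a| ≤ K * ρ a) (p : ℝ≥0) :
    ∃ C : ℝ≥0, ∀ a, eLpNorm (fun _ => c a) p ν ≤ (C * ρ a : ℝ≥0) :=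
  (LpO.const (μ := ν) K.toNNReal fun a => (h a).trans
    (mul_le_mul_of_nonneg_right (Real.le_coe_toNNReal K) (ρ a).2)).bound p

/-- An observable depends neither on the noise nor on the resolution; the differences between
resolutions vanish. Thus `Expands.kernel` also handles the evaluation of `φ` at the particles. -/
theorem IsC2Poly.smoothKernel {φ : Vec d → ℝ} (hφ : IsC2Poly φ) (T : LevelPairs ι θ)
    (ν : Measure 𝓦) [IsProbabilityMeasure ν] :
    ∃ (G : Fin d → ι → Vec d → 𝓦 → ℝ) (m : ℕ), SmoothKernel T ν (fun _ x _ => φ x) G m := by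
  obtain ⟨hφ, C, m, hC⟩ := hφ
  have key : ∀ (k : ℕ), k ≤ 2 → ∀ (v : Fin k → Vec d), (∀ i, ‖v i‖ ≤ 1) → ∀ x,
      |iteratedFDeriv ℝ k φ x v| ≤ C * (((1 + ‖x‖₊) ^ m : ℝ≥0) : ℝ) := fun k hk v hv x => by
    refine ((iteratedFDeriv ℝ k φ x).le_opNorm v).trans ?_
    refine (mul_le_of_le_one_right (norm_nonneg _) (Finset.prod_le_one
      (fun _ _ => norm_nonneg _) fun i _ => hv i)).trans ?_
    simpa using hC k hk x
  have he : ∀ a : Fin d, ‖(EuclideanSpace.single a 1 : Vec d)‖ ≤ 1 := fun a => by simp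
  suffices h : ∃ G : Fin d → ι → Vec d → 𝓦 → ℝ, SmoothKernel T ν (fun _ x _ => φ x) G m from
    h.imp fun G hG => ⟨m, hG⟩
  refine SmoothKernel.of_contDiff (fun j => hφ.continuous.measurable.comp measurable_fst) (fun j => ae_of_all _ fun w => hφ)
    (fun p _ => ?_) (fun a p _ => ?_) (fun a b p _ => ?_) (fun p _ => ⟨0, by simp⟩)
    (fun a p _ => ⟨0, by simp⟩)
  · obtain ⟨D, hD⟩ := LpO.const_bound (ν := ν) (c := φ) (ρ := fun x => (1 + ‖x‖₊) ^ m) (K := C)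
      (fun x => by simpa using key 0 (by norm_num) ![] (by simp) x) p
    exact ⟨D, fun _ => hD⟩
  · obtain ⟨D, hD⟩ := LpO.const_bound (ν := ν)
      (c := fun x => fderiv ℝ φ x (EuclideanSpace.single a 1)) (ρ := fun x => (1 + ‖x‖₊) ^ m)
      (K := C) (fun x => by
        simpa using key 1 (by norm_num) (fun _ => EuclideanSpace.single a 1) (fun _ => he a) x) p
    exact ⟨D, fun _ => hD⟩
  · obtain ⟨D, hD⟩ := LpO.const_bound (ν := ν)
      (c := fun x => fderiv ℝ (fun x => fderiv ℝ φ x (EuclideanSpace.single a 1)) x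
        (EuclideanSpace.single b 1)) (ρ := fun x => (1 + ‖x‖₊) ^ m) (K := C) (fun x => by
        rw [fderiv_fderiv_apply hφ]
        exact key 2 le_rfl _ (fun i => by fin_cases i <;> simp) x) p
    exact ⟨D, fun _ => hD⟩

end Observables

/-! ### Constants uniform over all resolutions -/

section Uniformity

/-- A bound that holds along every sequence of selections from finite blocks holds uniformly. -/
theorem exists_uniform_of_sequences {X : Type*} (blk : ℕ → Finset X) (hne : ∀ l, (blk l).Nonempty)
    {A : X → ℝ≥0 → Prop} (hA : ∀ x c c', c ≤ c' → A x c → A x c')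
    (h : ∀ σ : ℕ → X, (∀ l, σ l ∈ blk l) → ∃ c, ∀ l, A (σ l) c) :
    ∃ c, ∀ l, ∀ x ∈ blk l, A x c := by
  -- `f x` is the best constant for `x`. The worst elements of the blocks form a sequence, which has
  -- some constant `c`, so every `f x` is at most `c`. The infimum need not be attained, hence `c +
  -- 1` below.
  set f : X → ℝ≥0∞ := fun x => ⨅ (c : ℝ≥0) (_ : A x c), (c : ℝ≥0∞) with hf
  choose σ hσ hmax using fun l => Finset.exists_max_image (blk l) f (hne l)
  obtain ⟨c, hc⟩ := h σ hσ
  refine ⟨c + 1, fun l x hx => ?_⟩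
  have h1 : f x < ((c + 1 : ℝ≥0) : ℝ≥0∞) := by
    refine ((hmax l x hx).trans (iInf₂_le c (hc l))).trans_lt ?_
    exact_mod_cast lt_add_one c
  obtain ⟨c', hc'⟩ := iInf_lt_iff.1 h1
  obtain ⟨hA', hlt⟩ := iInf_lt_iff.1 hc'
  exact hA x c' _ (by exact_mod_cast hlt.le) hA'

theorem EquivBy.mono {κ κ' a b : ℝ} (h : EquivBy κ a b) (hκ : κ ≤ κ') (ha : 0 ≤ a) (hb : 0 ≤ b) :
    EquivBy κ' a b :=
  ⟨h.1.trans (mul_le_mul_of_nonneg_right hκ hb), h.2.trans (mul_le_mul_of_nonneg_right hκ ha)⟩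

/-- Positive resolutions. -/
abbrev Resolution := {N : ℕ // 1 ≤ N}

/-- The pairs of resolutions that may occur on consecutive levels. -/
def consecutivePairs (s κ : ℝ) : Set (ℕ × ℕ) :=
  {q | 1 ≤ q.1 ∧ 1 ≤ q.2 ∧ ∃ l : ℕ, EquivBy κ q.1 ((2 : ℝ) ^ (s * l))
    ∧ EquivBy κ q.2 ((2 : ℝ) ^ (s * (l + 1 : ℕ)))}

/-- Consecutive resolutions, with the strong rate of convergence `β / 2`. -/
noncomputable def resolutionPairs (β s κ : ℝ) : LevelPairs Resolution (consecutivePairs s κ) where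
  fine τ := ⟨τ.1.2, τ.2.2.1⟩
  coarse τ := ⟨τ.1.1, τ.2.1⟩
  δ τ := (τ.1.1 : ℝ≥0) ^ (-β / 2)

variable {d dO : ℕ} {𝓦 : Type*} [MeasurableSpace 𝓦] {Ω : Type*} [MeasurableSpace Ω]
  {M : FilterModel d dO 𝓦} {Pr : Measure Ω} {R : ReferenceNoise M Pr} {β : ℝ}

theorem DerivBounds.mono {n : ℕ} {p : ℝ} {c c' : ℝ≥0} {ψ : Vec d → 𝓦 → Vec d}
    (h : DerivBounds R n p c ψ) (hc : c ≤ c') : DerivBounds R n p c' ψ where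
  first k hk i u hu := (h.first k hk i u hu).trans (by gcongr)
  second i u hu := (h.second i u hu).trans (by gcongr)

/-- The dyadic blocks cover all positive integers, and every selection from them is comparable to
2^l, hence an admissible sequence. -/
theorem Assumption2.uniform_bounds (h2 : Assumption2 R β) (n : ℕ) {p : ℝ} (hp : 2 ≤ p) :
    ∃ c : ℝ≥0, ∀ N : ℕ, 1 ≤ N → DerivBounds R n p c (M.solver n N) := by
  obtain ⟨c, hc⟩ := exists_uniform_of_sequences (fun l => Finset.Ico (2 ^ l) (2 ^ (l + 1)))
    (fun l => ⟨2 ^ l, by simp [pow_succ]⟩)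
    (A := fun N c => DerivBounds R n p c (M.solver n N)) (fun N c c' hc h => h.mono hc)
    fun σ hσ => by
      simp only [Finset.mem_Ico] at hσ
      obtain ⟨c, -, hc, -⟩ := h2.bounds σ ⟨fun l => Nat.one_le_two_pow.trans (hσ l).1, 1,
        one_pos, 2, fun l => by
          have h1 : ((2 ^ l : ℕ) : ℝ) ≤ σ l := by exact_mod_cast (hσ l).1
          have h2 : (σ l : ℝ) ≤ ((2 ^ (l + 1) : ℕ) : ℝ) := by exact_mod_cast (hσ l).2.le
          push_cast [pow_succ] at h1 h2
          rw [one_mul, Real.rpow_natCast]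
          have h3 : (0 : ℝ) < 2 ^ l := by positivity
          exact ⟨by linarith, by linarith⟩⟩ n p hp
      exact ⟨c, hc⟩
  refine ⟨c, fun N hN => hc (Nat.log 2 N) N ?_⟩
  exact Finset.mem_Ico.2 ⟨Nat.pow_log_le_self 2 (by omega), Nat.lt_pow_succ_log_self (by norm_num) N⟩

/-- The strong convergence bound for one pair of resolutions. -/
def StrongBound (R : ReferenceNoise M Pr) (β : ℝ) (n : ℕ) (p : ℝ) (q : ℕ × ℕ) (c : ℝ≥0) : Prop :=
  ∀ k : ℕ, k ≤ 1 → ∀ (i : Fin k → Fin d) (u : Ω → Vec d), R.MemLpAt n p u →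
    eLpNorm (fun ω => partialDeriv i (fun x => M.solver n q.2 x (R.w n ω)) (u ω)
        - partialDeriv i (fun x => M.solver n q.1 x (R.w n ω)) (u ω)) (ENNReal.ofReal p) Pr
      ≤ c * (1 + eLpNorm u (ENNReal.ofReal p) Pr) * ENNReal.ofReal ((q.1 : ℝ) ^ (-β / 2))

/-- The assumption compares consecutive members of a single sequence, whereas arbitrary pairs share
no member. Pairs whose index has one fixed parity can be laid end to end, coarse member at `l` and
fine member at `l + 1`, and form one exponentially growing sequence. -/
theorem exists_strongBound_of_parity (h2 : Assumption2 R β) (n : ℕ) {p : ℝ} (hp : 2 ≤ p)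
    {s κ : ℝ} (hs : 0 < s) {σ : ℕ → ℕ × ℕ} (hσ1 : ∀ l, 1 ≤ (σ l).1 ∧ 1 ≤ (σ l).2)
    (hσ : ∀ l : ℕ, EquivBy κ (σ l).1 ((2 : ℝ) ^ (s * l))
      ∧ EquivBy κ (σ l).2 ((2 : ℝ) ^ (s * (l + 1 : ℕ)))) (e : ℕ) :
    ∃ c, ∀ l, l % 2 = e → StrongBound R β n p (σ l) c := by
  -- For `e = 1` position `0` belongs to no pair; the coarse resolution fills it with the right
  -- size.
  set N : ℕ → ℕ := fun l => if l % 2 = e ∨ l = 0 then (σ l).1 else (σ (l - 1)).2 with hN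
  have hexp : IsExpGrowing N := by
    refine ⟨fun l => ?_, s, hs, κ, fun l => ?_⟩
    · simp only [hN]
      split_ifs
      exacts [(hσ1 l).1, (hσ1 _).2]
    · simp only [hN]
      split_ifs with h
      · exact (hσ l).1
      · have hl : l - 1 + 1 = l := by omega
        simpa only [hl] using (hσ (l - 1)).2
  obtain ⟨c, -, -, hc⟩ := h2.bounds N hexp n p hp
  refine ⟨c, fun l hl k hk i u hu => ?_⟩
  have h := hc l k hk i u hu
  have e1 : N l = (σ l).1 := by simp [hN, hl]
  have e2 : N (l + 1) = (σ l).2 := by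
    have : ¬((l + 1) % 2 = e ∨ l + 1 = 0) := by omega
    simp only [hN, this, if_false, Nat.add_sub_cancel]
  rwa [e1, e2] at h

/-- For each level only finitely many pairs are admissible, so `exists_uniform_of_sequences`
applies. A selection of pairs is treated separately on even and on odd levels. -/
theorem Assumption2.uniform_strongBound (h2 : Assumption2 R β) (n : ℕ) {p : ℝ} (hp : 2 ≤ p)
    {s : ℝ} (hs : 0 < s) (κ : ℝ) :
    ∃ c : ℝ≥0, ∀ q ∈ consecutivePairs s κ, StrongBound R β n p q c := by
  classical
  -- A constant of at least `2` makes every block nonempty: the ceilings of the prescribed sizes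
  -- belong to it.
  set K : ℝ := max κ 2 with hK
  set B : ℕ → Set (ℕ × ℕ) := fun l => {q | 1 ≤ q.1 ∧ 1 ≤ q.2 ∧ EquivBy K q.1 ((2 : ℝ) ^ (s * l))
    ∧ EquivBy K q.2 ((2 : ℝ) ^ (s * (l + 1 : ℕ)))} with hB
  have hfin : ∀ l, (B l).Finite := fun l => by
    refine (Set.finite_Iic (⌊K * (2 : ℝ) ^ (s * l)⌋₊, ⌊K * (2 : ℝ) ^ (s * (l + 1 : ℕ))⌋₊)).subset ?_
    rintro ⟨a, b⟩ ⟨-, -, ha, hb⟩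
    exact ⟨Nat.le_floor ha.1, Nat.le_floor hb.1⟩
  have hceil : ∀ x : ℝ, 1 ≤ x → 1 ≤ ⌈x⌉₊ ∧ EquivBy K (⌈x⌉₊ : ℝ) x := fun x hx => by
    have h1 := Nat.le_ceil x
    have h2 := Nat.ceil_lt_add_one (zero_le_one.trans hx)
    have h3 : (2 : ℝ) ≤ K := le_max_right _ _
    refine ⟨Nat.one_le_ceil_iff.2 (by linarith), ?_, ?_⟩ <;> nlinarith
  have hpow : ∀ l : ℕ, (1 : ℝ) ≤ (2 : ℝ) ^ (s * l) := fun l =>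
    Real.one_le_rpow (by norm_num) (by positivity)
  have hmem : ∀ l, ∀ q, q ∈ (hfin l).toFinset ↔ q ∈ B l := fun l q => (hfin l).mem_toFinset
  obtain ⟨c, hc⟩ := exists_uniform_of_sequences (fun l => (hfin l).toFinset)
    (fun l => ⟨(⌈(2 : ℝ) ^ (s * l)⌉₊, ⌈(2 : ℝ) ^ (s * (l + 1 : ℕ))⌉₊), (hmem _ _).2
      ⟨(hceil _ (hpow l)).1, (hceil _ (hpow (l + 1))).1, (hceil _ (hpow l)).2,
        (hceil _ (hpow (l + 1))).2⟩⟩)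
    (A := fun q c => StrongBound R β n p q c)
    (fun q c c' hcc h k hk i u hu => (h k hk i u hu).trans (by gcongr))
    fun σ hσ => by
      have hσ' : ∀ l, σ l ∈ B l := fun l => (hmem _ _).1 (hσ l)
      have h1 : ∀ l, 1 ≤ (σ l).1 ∧ 1 ≤ (σ l).2 := fun l => ⟨(hσ' l).1, (hσ' l).2.1⟩
      obtain ⟨c0, hc0⟩ := exists_strongBound_of_parity h2 n hp hs h1 (fun l => (hσ' l).2.2) 0
      obtain ⟨c1, hc1⟩ := exists_strongBound_of_parity h2 n hp hs h1 (fun l => (hσ' l).2.2) 1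
      refine ⟨max c0 c1, fun l k hk i u hu => ?_⟩
      rcases Nat.mod_two_eq_zero_or_one l with hl | hl
      · refine (hc0 l hl k hk i u hu).trans ?_
        have := le_max_left c0 c1
        gcongr
      · refine (hc1 l hl k hk i u hu).trans ?_
        have := le_max_right c0 c1
        gcongr
  refine ⟨c, fun q ⟨hq1, hq2, l, ha, hb⟩ => hc l q ((hmem _ _).2 ⟨hq1, hq2, ?_, ?_⟩)⟩
  · exact ha.mono (le_max_left _ _) (by positivity) (by positivity)
  · exact hb.mono (le_max_left _ _) (by positivity) (by positivity)

end Uniformity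

/-! ### The numerical solvers are smooth kernels -/

section SolverKernel

variable {d dO : ℕ} {𝓦 : Type*} [MeasurableSpace 𝓦] {Ω : Type*} [MeasurableSpace Ω]
  {M : FilterModel d dO 𝓦} {Pr : Measure Ω} [IsProbabilityMeasure Pr] {R : ReferenceNoise M Pr}
  {β : ℝ}

theorem partialDeriv_zero (i : Fin 0 → Fin d) (ψ : Vec d → Vec d) (x : Vec d) :
    partialDeriv i ψ x = ψ x := by
  simp [partialDeriv]

theorem fderiv_coord {ψ : Vec d → Vec d} (x v : Vec d) (hψ : DifferentiableAt ℝ ψ x) (b : Fin d) :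
    fderiv ℝ (fun x => ψ x b) x v = (fderiv ℝ ψ x v) b :=
  congr_arg (fun L => L v)
    ((EuclideanSpace.proj (𝕜 := ℝ) b).hasFDerivAt.comp x hψ.hasFDerivAt).fderiv

theorem partialDeriv_one {ψ : Vec d → Vec d} (hψ : ContDiff ℝ 2 ψ) (a : Fin d) (x : Vec d)
    (b : Fin d) : fderiv ℝ (fun x => ψ x b) x (EuclideanSpace.single a 1)
      = partialDeriv (fun _ : Fin 1 => a) ψ x b := by
  rw [fderiv_coord _ _ ((hψ.differentiable (by simp)) x)]
  simp [partialDeriv]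

theorem partialDeriv_two {ψ : Vec d → Vec d} (hψ : ContDiff ℝ 2 ψ) (a c : Fin d) (x : Vec d)
    (b : Fin d) : fderiv ℝ (fun x => fderiv ℝ (fun x => ψ x b) x (EuclideanSpace.single a 1)) x
        (EuclideanSpace.single c 1)
      = partialDeriv ![c, a] ψ x b := by
  have h : Differentiable ℝ (fderiv ℝ ψ) :=
    (hψ.fderiv_right (m := 1) (by norm_num)).differentiable (by simp)
  have h1 : (fun x => fderiv ℝ (fun x => ψ x b) x (EuclideanSpace.single a 1))
      = fun x => (fderiv ℝ ψ x (EuclideanSpace.single a 1)) b :=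
    funext fun x => fderiv_coord _ _ ((hψ.differentiable (by simp)) x) b
  rw [h1, fderiv_coord _ _ ((h x).clm_apply (differentiableAt_const _)),
    fderiv_clm_apply (h x) (differentiableAt_const _)]
  simp [partialDeriv, iteratedFDeriv_two_apply]

theorem ReferenceNoise.memLpAt_const (R : ReferenceNoise M Pr) (n : ℕ) (p : ℝ) (x : Vec d) :
    R.MemLpAt n p fun _ => x :=
  ⟨aestronglyMeasurable_const, memLp_const x⟩

theorem eLpNorm_const_le {E : Type*} [NormedAddCommGroup E] (p : ℝ≥0∞) (x : E) :
    eLpNorm (fun _ : Ω => x) p Pr ≤ ‖x‖ₑ := by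
  rcases eq_or_ne p 0 with rfl | hp
  · simp
  · rw [eLpNorm_const _ hp (IsProbabilityMeasure.ne_zero Pr)]
    simp

theorem eLpNorm_comp_noise_le (R : ReferenceNoise M Pr) {n : ℕ} {h : 𝓦 → ℝ}
    (hm : AEStronglyMeasurable h (M.noiseLaw n)) {p : ℝ≥0} {V : Ω → Vec d} {b : Fin d}
    (hV : ∀ᵐ ω ∂Pr, h (R.w n ω) = V ω b) {c : ℝ≥0∞} (hc : eLpNorm V (ENNReal.ofReal p) Pr ≤ c) :
    eLpNorm h p (M.noiseLaw n) ≤ c := by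
  rw [← R.law_w n] at hm ⊢
  rw [eLpNorm_map_measure hm (R.measurable_w n).aemeasurable]
  rw [ENNReal.ofReal_coe_nnreal] at hc
  refine (eLpNorm_mono_ae ?_).trans hc
  filter_upwards [hV] with ω hω
  rw [Function.comp_apply, hω, Real.norm_eq_abs]
  exact abs_coord_le_norm _ _

/-- The bounds of the assumption are tested with constant states `u = x`. The norm of a constant is
at most `‖x‖`, which gives moments under the noise law with linear growth in `x`, that is with
exponent `1`. -/
theorem Assumption2.smoothKernel (h2 : Assumption2 R β) (n : ℕ) {s : ℝ} (hs : 0 < s) (κ : ℝ)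
    (b : Fin d) : ∃ G : Fin d → Resolution → Vec d → 𝓦 → ℝ,
      SmoothKernel (resolutionPairs β s κ) (M.noiseLaw n)
        (fun j x w => M.solver n j.1 x w b) G 1 := by
  have hν := R.isProbabilityMeasure_noiseLaw n
  have hmeas : ∀ j : Resolution, Measurable fun q : Vec d × 𝓦 => M.solver n j.1 q.1 q.2 b :=
    fun j => (measurable_coord b).comp (M.measurable_solver n j.1)
  have hsm : ∀ j : Resolution, ∀ᵐ w ∂(M.noiseLaw n), ContDiff ℝ 2 fun x => M.solver n j.1 x w :=
    fun j => h2.smooth_solver n j.1 j.2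
  have hsmΩ : ∀ j : Resolution, ∀ᵐ ω ∂Pr, ContDiff ℝ 2 fun x => M.solver n j.1 x (R.w n ω) :=
    fun j => by
      have := hsm j
      rw [← R.law_w n] at this
      exact ae_of_ae_map (R.measurable_w n).aemeasurable this
  have hsmb : ∀ j : Resolution, ∀ᵐ w ∂(M.noiseLaw n),
      ContDiff ℝ 2 fun x => M.solver n j.1 x w b := fun j => (hsm j).mono fun w hw =>
    (EuclideanSpace.proj (𝕜 := ℝ) b).contDiff.comp hw
  have hm0 : ∀ (j : Resolution) (x : Vec d), Measurable fun w => M.solver n j.1 x w b :=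
    fun j x => (hmeas j).comp (measurable_const.prodMk measurable_id)
  -- These versions serve only to show that the derivatives are measurable functions of the noise.
  choose F hFm hF using fun (a : Fin d) (j : Resolution) =>
    exists_measurable_partial (ν := M.noiseLaw n) (hmeas j)
      ((hsmb j).mono fun w h => h.differentiable (by simp)) (EuclideanSpace.single a 1)
  have hm1 : ∀ (a : Fin d) (j : Resolution) (x : Vec d), AEStronglyMeasurable (fun w =>
      fderiv ℝ (fun x => M.solver n j.1 x w b) x (EuclideanSpace.single a 1)) (M.noiseLaw n) :=
    fun a j x => ((hFm a j).comp (measurable_const.prodMk measurable_id)).aestronglyMeasurable.congr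
      ((hF a j).mono fun w h => h x)
  choose F₂ hF₂m hF₂ using fun (c a : Fin d) (j : Resolution) =>
    exists_measurable_partial (ν := M.noiseLaw n) (hFm a j) (by
      filter_upwards [hF a j, hsmb j] with w h h'
      rw [funext h]
      exact ((h'.fderiv_right (m := 1) (by norm_num)).clm_apply contDiff_const).differentiable
        (by simp)) (EuclideanSpace.single c 1)
  have hm2 : ∀ (a c : Fin d) (j : Resolution) (x : Vec d), AEStronglyMeasurable (fun w =>
      fderiv ℝ (fun x => fderiv ℝ (fun x => M.solver n j.1 x w b) x (EuclideanSpace.single a 1)) x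
        (EuclideanSpace.single c 1)) (M.noiseLaw n) := fun a c j x => by
    refine ((hF₂m c a j).comp (measurable_const.prodMk measurable_id)).aestronglyMeasurable.congr
      (f := fun w => F₂ c a j x w) ?_
    filter_upwards [hF a j, hF₂ c a j] with w h h'
    rw [h' x, funext h]
  have hgrow : ∀ (c : ℝ≥0) (x : Vec d) (q : ℝ≥0∞), (c : ℝ≥0∞) * (1 + eLpNorm (fun _ : Ω => x) q Pr)
      ≤ ((c * (1 + ‖x‖₊) ^ 1 : ℝ≥0) : ℝ≥0∞) := fun c x q => by
    rw [pow_one, ENNReal.coe_mul, ENNReal.coe_add]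
    have := eLpNorm_const_le (Pr := Pr) q x
    gcongr
    · simp
    · exact this
  have hδ : ∀ τ : consecutivePairs s κ, ENNReal.ofReal ((τ.1.1 : ℝ) ^ (-β / 2))
      = (((resolutionPairs β s κ).δ τ : ℝ≥0) : ℝ≥0∞) := fun τ => by
    rw [ENNReal.ofReal, Real.toNNReal_rpow_of_nonneg (Nat.cast_nonneg _)]
    simp [resolutionPairs]
  have hgrowp : ∀ (c : ℝ≥0) (x : Vec d) (q : ℝ≥0∞) (τ : consecutivePairs s κ),
      (c : ℝ≥0∞) * (1 + eLpNorm (fun _ : Ω => x) q Pr)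
        * ENNReal.ofReal ((τ.1.1 : ℝ) ^ (-β / 2))
      ≤ ((c * ((1 + ‖x‖₊) ^ 1 * (resolutionPairs β s κ).δ τ) : ℝ≥0) : ℝ≥0∞) := fun c x q τ => by
    rw [hδ, ← mul_assoc, ENNReal.coe_mul (c * _)]
    gcongr
    exact hgrow c x q
  refine SmoothKernel.of_contDiff hmeas hsmb (fun p hp => ?_) (fun a p hp => ?_)
    (fun a c p hp => ?_) (fun p hp => ?_) (fun a p hp => ?_)
  · obtain ⟨c, hc⟩ := h2.uniform_bounds n (p := p) (by exact_mod_cast hp)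
    refine ⟨c, fun j x => (eLpNorm_comp_noise_le R (hm0 j x).aestronglyMeasurable (b := b) ?_
      ((hc j.1 j.2).first 0 (by norm_num) ![] _ (R.memLpAt_const n p x))).trans (hgrow _ _ _)⟩
    exact ae_of_all _ fun ω => by rw [partialDeriv_zero]
  · obtain ⟨c, hc⟩ := h2.uniform_bounds n (p := p) (by exact_mod_cast hp)
    refine ⟨c, fun j x => (eLpNorm_comp_noise_le R (hm1 a j x) (b := b) ?_
      ((hc j.1 j.2).first 1 le_rfl (fun _ => a) _ (R.memLpAt_const n p x))).trans (hgrow _ _ _)⟩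
    exact (hsmΩ j).mono fun ω hω => partialDeriv_one hω a x b
  · obtain ⟨C, hC⟩ := h2.uniform_bounds n (p := p) (by exact_mod_cast hp)
    refine ⟨C, fun j x => (eLpNorm_comp_noise_le R (hm2 a c j x) (b := b) ?_
      ((hC j.1 j.2).second ![c, a] _ (R.memLpAt_const n _ x))).trans (hgrow _ _ _)⟩
    exact (hsmΩ j).mono fun ω hω => partialDeriv_two hω a c x b
  · obtain ⟨C, hC⟩ := h2.uniform_strongBound n (p := p) (by exact_mod_cast hp) hs κ
    refine ⟨C, fun τ x => (eLpNorm_comp_noise_le R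
      ((hm0 _ x).sub (hm0 _ x)).aestronglyMeasurable (b := b) ?_
      (hC τ.1 τ.2 0 (by norm_num) ![] _ (R.memLpAt_const n p x))).trans (hgrowp _ _ _ _)⟩
    exact ae_of_all _ fun ω => by simp [partialDeriv_zero, resolutionPairs]
  · obtain ⟨C, hC⟩ := h2.uniform_strongBound n (p := p) (by exact_mod_cast hp) hs κ
    refine ⟨C, fun τ x => (eLpNorm_comp_noise_le R ((hm1 a _ x).sub (hm1 a _ x)) (b := b) ?_
      (hC τ.1 τ.2 1 le_rfl (fun _ => a) _ (R.memLpAt_const n p x))).trans (hgrowp _ _ _ _)⟩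
    filter_upwards [hsmΩ ((resolutionPairs β s κ).fine τ), hsmΩ ((resolutionPairs β s κ).coarse τ)]
      with ω h1 h3
    exact congr_arg₂ (· - ·) (partialDeriv_one h1 a x b) (partialDeriv_one h3 a x b)

end SolverKernel

/-! ### Measurability of the ensembles in their inputs -/

section DriversMeasurability

variable {d dO : ℕ} {𝓦 X : Type*} [MeasurableSpace 𝓦]

/-- All components of the random inputs `D` are measurable. -/
structure MeasurableDrivers (m : MeasurableSpace X) (D : X → Drivers d dO 𝓦) : Prop where
  init : ∀ i, Measurable fun x => (D x).init i
  noise : ∀ n i, Measurable fun x => (D x).noise n i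
  obs : ∀ n i, Measurable fun x => (D x).obs n i

variable {m : MeasurableSpace X} {D : X → Drivers d dO 𝓦}

theorem MeasurableDrivers.shift (h : MeasurableDrivers m D) (q : ℕ) :
    MeasurableDrivers m fun x => (D x).shift q :=
  ⟨fun i => h.init (i + q), fun n i => h.noise n (i + q), fun n i => h.obs n (i + q)⟩

theorem measurable_sampleCov {v : X → ℕ → Vec d} (hv : ∀ i, Measurable fun x => v x i) (P : ℕ)
    (a b : Fin d) : Measurable fun x => sampleCov P (v x) a b := by
  have hc : ∀ i a, Measurable fun x => v x i a := fun i a => (measurable_coord a).comp (hv i)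
  simp only [sampleCov, Matrix.of_apply]
  exact ((Finset.measurable_fun_sum _ fun i _ => (hc i a).mul (hc i b)).div_const _).sub
    (((Finset.measurable_fun_sum _ fun i _ => hc i a).div_const _).mul
      ((Finset.measurable_fun_sum _ fun i _ => hc i b).div_const _))

theorem MeasurableDrivers.enkf (h : MeasurableDrivers m D) (M : FilterModel d dO 𝓦) (N P n : ℕ) :
    ∀ i, Measurable fun x => M.enkf N P (D x) n i := by
  induction n with
  | zero => exact h.init
  | succ n ih =>
    have hv : ∀ i, Measurable fun x => M.solver n N (M.enkf N P (D x) n i) ((D x).noise n i) :=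
      fun i => (M.measurable_solver n N).comp ((ih i).prodMk (h.noise n i))
    exact fun i => measurable_assimilate M (measurable_gain M (measurable_sampleCov hv P)) (hv i)
      ((h.obs (n + 1) i).const_add _)

theorem MeasurableDrivers.enkfMean (h : MeasurableDrivers m D) (M : FilterModel d dO 𝓦)
    (N P n : ℕ) {φ : Vec d → ℝ} (hφ : Measurable φ) :
    Measurable fun x => M.enkfMean N P (D x) n φ :=
  (Finset.measurable_fun_sum _ fun i _ => hφ.comp (h.enkf M N P n i)).div_const _

end DriversMeasurability

/-! ### Independent samples on a level -/

section Samples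

variable {d dO : ℕ} {𝓦 : Type*} [MeasurableSpace 𝓦] {M : FilterModel d dO 𝓦}
  {Ω' : Type*} [MeasurableSpace Ω'] {Pr' : Measure Ω'} [IsProbabilityMeasure Pr']

/-- The average is a measurable functional of inputs whose law is the same for all ensembles. This
gives both coarse halves the expectation of an EnKF of the lower level, so that the expectations of
the levels telescope. -/
theorem EnsembleInput.integral_enkfMean_eq (E E' : EnsembleInput M Pr') (N P n : ℕ)
    {φ : Vec d → ℝ} (hφ : Measurable φ) :
    ∫ ω, M.enkfMean N P (E.drivers ω) n φ ∂Pr' = ∫ ω, M.enkfMean N P (E'.drivers ω) n φ ∂Pr' := by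
  let D : (ℕ → Vec d) × (ℕ × ℕ → 𝓦) × (ℕ × ℕ → Vec dO) → Drivers d dO 𝓦 := fun x =>
    ⟨x.1, fun n i => x.2.1 (n, i), fun n i => x.2.2 (n, i)⟩
  have hD : MeasurableDrivers inferInstance D :=
    ⟨fun i => (measurable_pi_apply i).comp measurable_fst,
      fun n i => (measurable_pi_apply (n, i)).comp (measurable_fst.comp measurable_snd),
      fun n i => (measurable_pi_apply (n, i)).comp (measurable_snd.comp measurable_snd)⟩
  have hf := hD.enkfMean M N P n hφ
  have hm : ∀ E : EnsembleInput M Pr', Measurable fun ω => ((fun i => E.init i ω : ℕ → Vec d),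
      (fun a => E.noise a ω : ℕ × ℕ → 𝓦), (fun a => E.obs a ω : ℕ × ℕ → Vec dO)) := fun E =>
    (measurable_pi_lambda _ E.measurable_init).prodMk
      ((measurable_pi_lambda _ E.measurable_noise).prodMk (measurable_pi_lambda _ E.measurable_obs))
  have h := E.map_all_eq E'
  have e : ∀ E : EnsembleInput M Pr', ∫ ω, M.enkfMean N P (E.drivers ω) n φ ∂Pr'
      = ∫ x, M.enkfMean N P (D x) n φ ∂(Pr'.map fun ω => ((fun i => E.init i ω : ℕ → Vec d),
        (fun a => E.noise a ω : ℕ × ℕ → 𝓦), (fun a => E.obs a ω : ℕ × ℕ → Vec dO))) := fun E => by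
    rw [integral_map (hm E).aemeasurable hf.aestronglyMeasurable]
    rfl
  rw [e E, e E', h]

/-- The inputs of the samples with index in `s`. -/
def sampleInputs (s : Set ℕ) : Set ((ℕ × ℕ × ℕ) ⊕ ((ℕ × ℕ × ℕ × ℕ) ⊕ (ℕ × ℕ × ℕ × ℕ))) :=
  {u | Sum.elim (fun a => a.2.1) (Sum.elim (fun a => a.2.1) (fun a => a.2.1)) u ∈ s}

/-- The information contained in the samples with index in `s`. -/
abbrev EnsembleNoise.sampleInfo (S : EnsembleNoise M Pr') (s : Set ℕ) : MeasurableSpace Ω' :=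
  tripleInfo S.init S.noise S.obs (sampleInputs s)

theorem EnsembleNoise.indepFun_sum (S : EnsembleNoise M Pr') {f : ℕ → Ω' → ℝ}
    (hf : ∀ m (s : Set ℕ), m ∈ s → Measurable[S.sampleInfo s] (f m)) (k : ℕ) :
    IndepFun (fun ω => ∑ m ∈ Finset.range k, f m ω) (f k) Pr' := by
  refine indepFun_of_tripleInfo S.measurable_init S.measurable_noise S.measurable_obs S.indep
    (s := sampleInputs (Set.Iio k)) (t := sampleInputs {k}) ?_ ?_ (hf k {k} rfl)
  · rw [Set.disjoint_left]
    intro u h1 h2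
    simp only [sampleInputs, Set.mem_Iio, Set.mem_ofPred_eq, Set.mem_singleton_iff] at h1 h2
    omega
  · exact @Finset.measurable_fun_sum _ _ _ _ _ _ (_) _ _ fun i hi =>
      hf i (Set.Iio k) (by simpa using hi)

theorem EnsembleNoise.measurable_drivers (S : EnsembleNoise M Pr') {s : Set ℕ} (l : ℕ) {m : ℕ}
    (hm : m ∈ s) : MeasurableDrivers (S.sampleInfo s) (S.drivers l m) :=
  ⟨fun _ => measurable_tripleInfo_left hm, fun _ _ => measurable_tripleInfo_mid hm,
    fun _ _ => measurable_tripleInfo_right hm⟩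

/-- Averages over independent samples. -/
theorem LpO.average_samples (S : EnsembleNoise M Pr') {Λ : Type*} {X : Λ → ℕ → Ω' → ℝ} {c e : Λ → ℝ}
    {ρ : Λ → ℝ≥0} (h : LpO Pr' (fun (q : Λ × ℕ) ω => X q.1 q.2 ω - c q.1) (fun q => ρ q.1))
    (he : ∀ a m, ∫ ω, X a m ω ∂Pr' = e a)
    (hm : ∀ a m (s : Set ℕ), m ∈ s → Measurable[S.sampleInfo s] (X a m))
    (k : Λ → ℕ) (hk : ∀ a, 1 ≤ k a) :
    LpO Pr' (fun a ω => (∑ m ∈ Finset.range (k a), X a m ω) / k a - e a)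
      (fun a => ρ a * (NNReal.sqrt (k a))⁻¹) := by
  have hint : ∀ a m, Integrable (X a m) Pr' := fun a m => by
    have := (h.integrable (a, m)).add (integrable_const (c a))
    refine this.congr (ae_of_all _ fun ω => ?_)
    simp
  -- The bound is known around the convenient centre `c`. The distance of the true mean from `c` is
  -- of the same order, so the centre may be changed.
  have hcent : LpO Pr' (fun (q : Λ × ℕ) ω => X q.1 q.2 ω - e q.1) (fun q => ρ q.1) := by
    refine (h.sub h.integral_const).congr fun q ω => ?_
    rw [integral_sub (hint _ _) (integrable_const _), he]
    simp
  have key := hcent.average_indep (Z := fun a m ω => X a m ω - e a) k (fun a m => by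
    rw [integral_sub (hint _ _) (integrable_const _), he]; simp) (fun a n => by
      exact S.indepFun_sum (fun m s hs => (hm a m s hs).sub_const _) n)
  refine key.congr fun a ω => ?_
  have : (k a : ℝ) ≠ 0 := by
    have := hk a
    positivity
  rw [Finset.sum_sub_distrib, Finset.sum_const, Finset.card_range, nsmul_eq_mul]
  field_simp

end Samples

/-! ### Variance and bias of the level samples -/

section LevelEstimates

variable {d dO : ℕ} {𝓦 : Type*} [MeasurableSpace 𝓦] {Ω : Type*} [MeasurableSpace Ω]
  {M : FilterModel d dO 𝓦} {Pr : Measure Ω} [IsProbabilityMeasure Pr] {R : ReferenceNoise M Pr}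
  {Ω' : Type*} [MeasurableSpace Ω'] {Pr' : Measure Ω'} [IsProbabilityMeasure Pr']
  {α β : ℝ} {𝔽 : Set (Vec d → ℝ)}

theorem Assumption1.memLp_init (h1 : Assumption1 R α 𝔽) (a : Fin d) (p : ℝ≥0) :
    MemLp (fun ω => R.u₀ ω a) p Pr := by
  have h := (h1.initial (max p 2 : ℝ≥0) (by exact_mod_cast le_max_right p 2)).2
  rw [ENNReal.ofReal_coe_nnreal] at h
  have h' : MemLp (fun ω => R.u₀ ω a) ((max p 2 : ℝ≥0) : ℝ≥0∞) Pr :=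
    h.mono ((measurable_coord a).comp R.measurable_u₀).aestronglyMeasurable
      (ae_of_all _ fun ω => abs_coord_le_norm _ _)
  exact h'.mono_exponent (by exact_mod_cast le_max_left p 2)

-- The time index `n + 1` comes from regarding `φ` as a kernel driven by the noise of time `n`, on
-- which it does not depend.
variable (Pr') in
theorem exists_expands_observable (h1 : Assumption1 R α 𝔽) (h2 : Assumption2 R β) {s : ℝ}
    (hs : 0 < s) (κ : ℝ) {φ : Vec d → ℝ} (hφ : IsC2Poly φ) (n : ℕ) :
    Expands (Pr.map R.data) (resolutionPairs β s κ) (n + 1)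
      (fun j (C : Config M Pr') i ω => φ (M.enkf j.1 C.P (C.E.drivers ω) n i))
      (fun j x => φ ((M.withSolver j.1).mfState n x)) := by
  have hQ : IsParticleLaw M Pr' (Pr.map R.data) := R.isParticleLaw
  have hν := R.isProbabilityMeasure_noiseLaw n
  choose G hG using fun (n : ℕ) (b : Fin d) => h2.smoothKernel n hs κ b
  obtain ⟨G', m, hG'⟩ := hφ.smoothKernel (resolutionPairs β s κ) (M.noiseLaw n)
  exact Expands.kernel (M := M) hG'
    (V := fun j (C : Config M Pr') i ω => M.enkf j.1 C.P (C.E.drivers ω) n i)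
    (Vl := fun j x => (M.withSolver j.1).mfState n x)
    (Expands.enkf R h1.memLp_init (fun j : Resolution => j.1) hG n)

/-- A coupled sample with coarse ensembles of size `P`. -/
noncomputable def coupledSample (M : FilterModel d dO 𝓦) (q : ℕ × ℕ) (P : ℕ) (D : Drivers d dO 𝓦)
    (n : ℕ) (φ : Vec d → ℝ) : ℝ :=
  M.enkfMean q.2 (2 * P) D n φ
    - (M.enkfMean q.1 P D n φ + M.enkfMean q.1 P (D.shift P) n φ) / 2

/-- The heart of the coupling: the fine particles are the disjoint union of the two coarse
ensembles, so a linear statistic over them is the mean of its two halves. First-order coarse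
fluctuations thereby cancel against the fine ones. -/
theorem emp_two_mul (S : EnsembleNoise M Pr') (l m : ℕ) {P : ℕ} (hP : 0 < P)
    (f : ParticleData d dO 𝓦 → ℝ) (ω : Ω') :
    Config.emp ⟨S.input l m 0, 2 * P, by omega⟩ f ω
      = (Config.emp ⟨S.input l m 0, P, hP⟩ f ω + Config.emp ⟨S.input l m P, P, hP⟩ f ω) / 2 := by
  have hP' : (P : ℝ) ≠ 0 := by positivity
  have e : ∀ i, f ((S.input l m 0).data (P + i) ω) = f ((S.input l m P).data i ω) := fun i => by
    simp only [EnsembleInput.data, EnsembleNoise.input, add_zero, add_comm P i]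
  simp only [Config.emp]
  rw [two_mul, Finset.sum_range_add]
  simp only [e]
  push_cast
  field_simp
  ring

/-- Moment bounds for averages over independent samples on the levels, and for the bias. -/
theorem exists_level_estimates (h1 : Assumption1 R α 𝔽) (h2 : Assumption2 R β)
    (S : EnsembleNoise M Pr') {s : ℝ} (hs : 0 < s) (κ : ℝ) {φ : Vec d → ℝ} (hφ : IsC2Poly φ)
    (n : ℕ) : ∃ e : Resolution → ℕ+ → ℝ,
      LpO Pr' (fun (q : Resolution × ℕ+ × ℕ × ℕ+) ω =>
        (∑ m ∈ Finset.range q.2.2.2, M.enkfMean q.1.1 q.2.1 (S.drivers q.2.2.1 m ω) n φ)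
          / (q.2.2.2 : ℕ) - e q.1 q.2.1)
        (fun q => (NNReal.sqrt (q.2.2.2 : ℕ))⁻¹) ∧
      LpO Pr' (fun (q : consecutivePairs s κ × ℕ+ × ℕ × ℕ+) ω =>
        (∑ m ∈ Finset.range q.2.2.2, coupledSample M q.1.1 q.2.1 (S.drivers q.2.2.1 m ω) n φ)
          / (q.2.2.2 : ℕ) - (e ⟨q.1.1.2, q.1.2.2.1⟩ (2 * q.2.1) - e ⟨q.1.1.1, q.1.2.1⟩ q.2.1))
        (fun q => ((q.1.1.1 : ℝ≥0) ^ (-β / 2) * (NNReal.sqrt (q.2.1 : ℕ))⁻¹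
          + ((q.2.1 : ℕ) : ℝ≥0)⁻¹) * (NNReal.sqrt (q.2.2.2 : ℕ))⁻¹) ∧
      ∃ K : ℝ≥0, ∀ j P, |e j P - ∫ x, φ ((M.withSolver j.1).mfState n x) ∂(Pr.map R.data)|
        ≤ K * ((P : ℕ) : ℝ)⁻¹ := by
  have hQ : IsParticleLaw M Pr' (Pr.map R.data) := R.isParticleLaw
  have hφm : Measurable φ := hφ.1.continuous.measurable
  have hX := exists_expands_observable Pr' h1 h2 hs κ hφ n
  obtain ⟨h, hh, h0, hr⟩ := hX.exists_average
  set c : Resolution → ℝ := fun j => ∫ x, φ ((M.withSolver j.1).mfState n x) ∂(Pr.map R.data)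
    with hc
  replace hr : LpO Pr' (fun (q : Resolution × Config M Pr') ω =>
      M.enkfMean q.1.1 q.2.P (q.2.E.drivers ω) n φ - c q.1 - q.2.emp (h q.1) ω)
      (fun q => q.2.rate * q.2.rate) := hr
  -- The expectation of an EnKF average, computed with one arbitrary ensemble; by `hmean` it is the
  -- same for all.
  set e : Resolution → ℕ+ → ℝ := fun j P =>
    ∫ ω, M.enkfMean j.1 P ((S.input 0 0 0).drivers ω) n φ ∂Pr' with he
  have hbdd : LpO Pr' (fun (q : Resolution × Config M Pr') ω =>
      M.enkfMean q.1.1 q.2.P (q.2.E.drivers ω) n φ) 1 :=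
    hX.average.bdd.reindex fun q : Resolution × Config M Pr' => (q.1, q.2, 0)
  have hmean : ∀ (j : Resolution) (C : Config M Pr'),
      ∫ ω, M.enkfMean j.1 C.P (C.E.drivers ω) n φ ∂Pr' = e j ⟨C.P, C.pos⟩ := fun j C =>
    C.E.integral_enkfMean_eq _ _ _ _ hφm
  have hd0 : ∀ l m ω, (S.input l m 0).drivers ω = S.drivers l m ω := fun l m ω => rfl
  have hdP : ∀ l m P ω, (S.input l m P).drivers ω = (S.drivers l m ω).shift P :=
    fun l m P ω => rfl
  refine ⟨e, ?_, ?_, ?_⟩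
  · have := LpO.average_samples S (Λ := Resolution × ℕ+ × ℕ × ℕ+)
      (X := fun q m ω => M.enkfMean q.1.1 q.2.1 (S.drivers q.2.2.1 m ω) n φ) (c := 0)
      (e := fun q => e q.1 q.2.1) (ρ := 1) ?_ (fun q m => ?_) (fun q m t hm => ?_)
      (fun q => q.2.2.2) (fun q => q.2.2.2.pos)
    · simpa using this
    · have h := hbdd.reindex fun q : (Resolution × ℕ+ × ℕ × ℕ+) × ℕ =>
        (q.1.1, (⟨S.input q.1.2.2.1 q.2 0, q.1.2.1, q.1.2.1.pos⟩ : Config M Pr'))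
      exact h.congr fun q ω => (sub_zero _).symm
    · exact hmean q.1 ⟨S.input q.2.2.1 m 0, q.2.1, q.2.1.pos⟩
    · exact (S.measurable_drivers q.2.2.1 hm).enkfMean M _ _ _ hφm
  · refine LpO.average_samples S (Λ := consecutivePairs s κ × ℕ+ × ℕ × ℕ+)
      (X := fun q m ω => coupledSample M q.1.1 q.2.1 (S.drivers q.2.2.1 m ω) n φ)
      (c := fun q => c ⟨q.1.1.2, q.1.2.2.1⟩ - c ⟨q.1.1.1, q.1.2.1⟩)
      (e := fun q => e ⟨q.1.1.2, q.1.2.2.1⟩ (2 * q.2.1) - e ⟨q.1.1.1, q.1.2.1⟩ q.2.1)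
      (ρ := fun q => (q.1.1.1 : ℝ≥0) ^ (-β / 2) * (NNReal.sqrt (q.2.1 : ℕ))⁻¹
          + ((q.2.1 : ℕ) : ℝ≥0)⁻¹) ?_ (fun q m => ?_) (fun q m t hm => ?_)
      (fun q => q.2.2.2) (fun q => q.2.2.2.pos)
    · let Λ := (consecutivePairs s κ × ℕ+ × ℕ × ℕ+) × ℕ
      let C₂ : Λ → Config M Pr' := fun q =>
        ⟨S.input q.1.2.2.1 q.2 0, 2 * (q.1.2.1 : ℕ), by have := q.1.2.1.pos; omega⟩
      let C₁ : Λ → Config M Pr' := fun q => ⟨S.input q.1.2.2.1 q.2 0, q.1.2.1, q.1.2.1.pos⟩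
      let C₁' : Λ → Config M Pr' := fun q =>
        ⟨S.input q.1.2.2.1 q.2 q.1.2.1, q.1.2.1, q.1.2.1.pos⟩
      let jf : Λ → Resolution := fun q => ⟨q.1.1.1.2, q.1.1.2.2.1⟩
      let jc : Λ → Resolution := fun q => ⟨q.1.1.1.1, q.1.1.2.1⟩
      let ρ : Λ → ℝ≥0 := fun q => (q.1.1.1.1 : ℝ≥0) ^ (-β / 2) * (NNReal.sqrt (q.1.2.1 : ℕ))⁻¹
          + ((q.1.2.1 : ℕ) : ℝ≥0)⁻¹
      have b2 : ∀ q : Λ, (C₂ q).rate * (C₂ q).rate ≤ ρ q := fun q => by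
        rw [Config.rate_mul_rate]
        refine le_trans ?_ le_add_self
        have hp : (0 : ℝ≥0) < ((q.1.2.1 : ℕ) : ℝ≥0) := by exact_mod_cast q.1.2.1.pos
        refine inv_anti₀ hp ?_
        simp only [C₂]
        push_cast
        rw [two_mul]
        exact le_self_add
      have b1 : ∀ q : Λ, (C₁ q).rate * (C₁ q).rate ≤ ρ q := fun q => by
        rw [Config.rate_mul_rate]
        exact le_add_self
      have b1' : ∀ q : Λ, (C₁' q).rate * (C₁' q).rate ≤ ρ q := fun q => by
        rw [Config.rate_mul_rate]
        exact le_add_self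
      -- The only first-order term left: an average of independent centred functions of size `δ`,
      -- hence of order `δ` times P^(-1/2).
      have be : LpO Pr' (fun (q : Λ) ω => (C₂ q).emp (fun x => h (jf q) x - h (jc q) x) ω) ρ := by
        have := LpO.emp (M := M) (Pr' := Pr') (Q := Pr.map R.data)
          (F := fun τ x => h ((resolutionPairs β s κ).fine τ) x
            - h ((resolutionPairs β s κ).coarse τ) x) hh.pair
          (fun τ => (hh.meas _).sub (hh.meas _)) (fun τ => by
            rw [integral_sub (hh.bdd.integrable _) (hh.bdd.integrable _), h0, h0, sub_zero])
          (fun q : Λ => q.1.1) C₂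
        refine this.le fun q => ?_
        refine le_trans (mul_le_mul_right ?_ _) le_self_add
        have hp : (0 : ℝ≥0) < ((q.1.2.1 : ℕ) : ℝ≥0) := by exact_mod_cast q.1.2.1.pos
        refine inv_anti₀ (NNReal.sqrt_pos.2 hp) (NNReal.sqrt_le_sqrt.2 ?_)
        simp only [C₂]
        push_cast
        rw [two_mul]
        exact le_self_add
      have r2 := (hr.reindex fun q : Λ => (jf q, C₂ q)).le b2
      have r1 := (hr.reindex fun q : Λ => (jc q, C₁ q)).le b1
      have r1' := (hr.reindex fun q : Λ => (jc q, C₁' q)).le b1'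
      -- The centred sample equals the fine remainder plus the average of the difference of the two
      -- functions `h`, minus the mean of the two coarse remainders.
      refine ((r2.add be).sub ((r1.add r1').const_mul (1 / 2))).congr fun q ω => ?_
      have hsub : (C₂ q).emp (fun x => h (jf q) x - h (jc q) x) ω
          = (C₂ q).emp (h (jf q)) ω - (C₂ q).emp (h (jc q)) ω := by
        simp only [Config.emp, Finset.sum_sub_distrib, sub_div]
      have htwo : (C₂ q).emp (h (jc q)) ω
          = ((C₁ q).emp (h (jc q)) ω + (C₁' q).emp (h (jc q)) ω) / 2 :=
        emp_two_mul S _ _ q.1.2.1.pos _ ω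
      have hcs : coupledSample M q.1.1.1 q.1.2.1 (S.drivers q.1.2.2.1 q.2 ω) n φ
          = M.enkfMean (jf q).1 (C₂ q).P ((C₂ q).E.drivers ω) n φ
            - (M.enkfMean (jc q).1 (C₁ q).P ((C₁ q).E.drivers ω) n φ
              + M.enkfMean (jc q).1 (C₁' q).P ((C₁' q).E.drivers ω) n φ) / 2 := rfl
      rw [hsub, htwo, hcs]
      change _ = _ - (c (jf q) - c (jc q))
      ring
    · have i2 := hbdd.integrable (⟨q.1.1.2, q.1.2.2.1⟩,
        ⟨S.input q.2.2.1 m 0, 2 * (q.2.1 : ℕ), by have := q.2.1.pos; omega⟩)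
      have i1 := hbdd.integrable (⟨q.1.1.1, q.1.2.1⟩, ⟨S.input q.2.2.1 m 0, q.2.1, q.2.1.pos⟩)
      have i1' := hbdd.integrable (⟨q.1.1.1, q.1.2.1⟩,
        ⟨S.input q.2.2.1 m q.2.1, q.2.1, q.2.1.pos⟩)
      have m2 := hmean ⟨q.1.1.2, q.1.2.2.1⟩
        ⟨S.input q.2.2.1 m 0, 2 * (q.2.1 : ℕ), by have := q.2.1.pos; omega⟩
      have m1 := hmean ⟨q.1.1.1, q.1.2.1⟩ ⟨S.input q.2.2.1 m 0, q.2.1, q.2.1.pos⟩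
      have m1' := hmean ⟨q.1.1.1, q.1.2.1⟩ ⟨S.input q.2.2.1 m q.2.1, q.2.1, q.2.1.pos⟩
      simp only [hd0, hdP] at i2 i1 i1' m2 m1 m1'
      simp only [coupledSample]
      have i3 : Integrable (fun ω => (M.enkfMean q.1.1.1 q.2.1 (S.drivers q.2.2.1 m ω) n φ
          + M.enkfMean q.1.1.1 q.2.1 ((S.drivers q.2.2.1 m ω).shift q.2.1) n φ) / 2) Pr' :=
        (i1.add i1').div_const 2
      rw [integral_sub i2 i3, integral_div, integral_add i1 i1', m2, m1, m1']
      have : (⟨2 * (q.2.1 : ℕ), by have := q.2.1.pos; omega⟩ : ℕ+) = (2 * q.2.1 : ℕ+) := rfl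
      rw [this]
      have : (⟨(q.2.1 : ℕ), q.2.1.pos⟩ : ℕ+) = q.2.1 := rfl
      rw [this]
      ring
    · have hD := S.measurable_drivers q.2.2.1 hm
      exact (hD.enkfMean M _ _ _ hφm).sub
        (((hD.enkfMean M _ _ _ hφm).add ((hD.shift _).enkfMean M _ _ _ hφm)).div_const _)
  · obtain ⟨K, hK⟩ := hr.abs_integral_le
    refine ⟨K, fun j P => ?_⟩
    let C : Config M Pr' := ⟨S.input 0 0 0, P, P.pos⟩
    have hK' := hK (j, C)
    have he0 := LpO.emp (M := M) (Pr' := Pr') (Q := Pr.map R.data) hh.bdd hh.meas h0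
      (fun _ : Unit => j) (fun _ => C)
    -- The linear term has mean zero, so the bias is of order `1 / P` although the fluctuations are
    -- of order P^(-1/2).
    have hemp : ∫ ω, C.emp (h j) ω ∂Pr' = 0 := by
      have hint : ∀ i, Integrable (fun ω => h j (C.E.data i ω)) Pr' := fun i =>
        (hh.bdd.comp_data (M := M) (Pr' := Pr') (fun _ : Unit => j) (fun _ => C.E)
          (fun _ => i)).integrable ()
      simp only [Config.emp]
      rw [integral_div, integral_finsetSum _ fun i _ => hint i]
      simp [integral_comp_data (M := M) (Q := Pr.map R.data) (hh.meas j), h0]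
    have hi : Integrable (fun ω => M.enkfMean j.1 C.P (C.E.drivers ω) n φ) Pr' :=
      hbdd.integrable (j, C)
    have hi' : Integrable (fun ω => M.enkfMean j.1 C.P (C.E.drivers ω) n φ - c j) Pr' :=
      hi.sub (integrable_const _)
    have e1 : ∫ ω, (M.enkfMean j.1 C.P (C.E.drivers ω) n φ - c j - C.emp (h j) ω) ∂Pr' = e j P - c j := by
      rw [integral_sub hi' (he0.integrable ()),
        integral_sub hi (integrable_const _), hemp]
      simp only [sub_zero, integral_const, probReal_univ, one_smul]
      rfl
    rw [← e1]
    refine hK'.trans (le_of_eq ?_)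
    rw [Config.rate_mul_rate]
    simp [C]

end LevelEstimates

/-! ### Mean-field states on the reference space, for all resolutions and the exact dynamics -/

section Dynamics

variable {d dO : ℕ} {𝓦 : Type*} [MeasurableSpace 𝓦] (M : FilterModel d dO 𝓦)

/-- The random maps of resolution `N`, or the exact ones for `none`. -/
def FilterModel.dynamics : Option ℕ → ℕ → Vec d → 𝓦 → Vec d
  | none => M.exact
  | some N => fun n => M.solver n N

theorem FilterModel.measurable_dynamics (j : Option ℕ) (n : ℕ) :
    Measurable fun q : Vec d × 𝓦 => M.dynamics j n q.1 q.2 := by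
  cases j with
  | none => exact M.measurable_exact n
  | some N => exact M.measurable_solver n N

/-- The filtering problem with the dynamics of resolution `N`, or the exact one for `none`. -/
def FilterModel.withDynamics (j : Option ℕ) : FilterModel d dO 𝓦 where
  initLaw := M.initLaw
  noiseLaw := M.noiseLaw
  exact := M.dynamics j
  solver := M.solver
  cost := M.cost
  H := M.H
  Γ := M.Γ
  y := M.y
  posDef_Γ := M.posDef_Γ
  measurable_exact := M.measurable_dynamics j
  measurable_solver := M.measurable_solver
  measurable_cost := M.measurable_cost

variable {M} {Ω : Type*} [MeasurableSpace Ω] {Pr : Measure Ω}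

def ReferenceNoise.withDynamics (R : ReferenceNoise M Pr) (j : Option ℕ) :
    ReferenceNoise (M.withDynamics j) Pr where
  u₀ := R.u₀
  w := R.w
  η := R.η
  measurable_u₀ := R.measurable_u₀
  measurable_w := R.measurable_w
  measurable_η := R.measurable_η
  law_u₀ := R.law_u₀
  law_w := R.law_w
  law_η := R.law_η
  indep := R.indep

/-- The mean-field state on the reference probability space. -/
noncomputable def ReferenceNoise.state (R : ReferenceNoise M Pr) (j : Option ℕ) (n : ℕ) (ω : Ω) :
    Vec d :=
  (M.withDynamics j).mfState n (R.data ω)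

/-- The mean-field prediction on the reference probability space. -/
noncomputable def ReferenceNoise.prediction (R : ReferenceNoise M Pr) (j : Option ℕ) (n : ℕ)
    (ω : Ω) : Vec d :=
  M.dynamics j n (R.state j n ω) (R.w n ω)

theorem ReferenceNoise.measurable_past_state (R : ReferenceNoise M Pr) (j : Option ℕ) (n : ℕ) :
    Measurable[R.past n] (R.state j n) :=
  R.measurable_comp_data (measurable_mfState (M.withDynamics j) n)

theorem ReferenceNoise.measurable_state (R : ReferenceNoise M Pr) (j : Option ℕ) (n : ℕ) :
    Measurable (R.state j n) :=
  ((measurable_mfState (M.withDynamics j) n).mono (pastData_le n) le_rfl).comp R.measurable_data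

theorem ReferenceNoise.measurable_prediction (R : ReferenceNoise M Pr) (j : Option ℕ) (n : ℕ) :
    Measurable (R.prediction j n) :=
  (M.measurable_dynamics j n).comp ((R.measurable_state j n).prodMk (R.measurable_w n))

theorem ReferenceNoise.indepFun_prediction [IsProbabilityMeasure Pr] (R : ReferenceNoise M Pr)
    (j : Option ℕ) (n : ℕ) : IndepFun (R.prediction j n) (R.η (n + 1)) Pr := by
  have hs : Measurable[R.past n ⊔ MeasurableSpace.comap (R.w n) inferInstance] (R.state j n) :=
    (R.measurable_past_state j n).mono le_sup_left le_rfl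
  have hw : Measurable[R.past n ⊔ MeasurableSpace.comap (R.w n) inferInstance] (R.w n) :=
    (comap_measurable (R.w n)).mono le_sup_right le_rfl
  have hp : Measurable[R.past n ⊔ MeasurableSpace.comap (R.w n) inferInstance]
      (R.prediction j n) := (M.measurable_dynamics j n).comp (hs.prodMk hw)
  exact R.indepFun_η hp

theorem ReferenceNoise.mfGain_eq [IsProbabilityMeasure Pr] (R : ReferenceNoise M Pr)
    (j : Option ℕ) (n : ℕ) :
    (M.withDynamics j).mfGain n = M.gain (covMatrix (Pr.map (R.prediction j n))) := by
  have h := (R.withDynamics j).map_predict ((R.withDynamics j).map_mfState n)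
  rw [FilterModel.mfGain, ← h]
  rfl

theorem ReferenceNoise.state_succ [IsProbabilityMeasure Pr] (R : ReferenceNoise M Pr)
    (j : Option ℕ) (n : ℕ) (ω : Ω) :
    R.state j (n + 1) ω = M.assimilate (M.gain (covMatrix (Pr.map (R.prediction j n))))
      (R.prediction j n ω) (M.y (n + 1) + R.η (n + 1) ω) := by
  rw [← R.mfGain_eq]
  rfl

theorem ReferenceNoise.memAllLpAt_of_LpO [IsProbabilityMeasure Pr] (R : ReferenceNoise M Pr)
    {n : ℕ} {u : Ω → Vec d} (hm : Measurable[R.past n] u) (hm' : Measurable u)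
    (h : LpO Pr (fun (_ : Unit) ω => ‖u ω‖) 1) : R.MemAllLpAt n u := fun p _ =>
  ⟨hm.stronglyMeasurable.aestronglyMeasurable,
    (memLp_norm_iff hm'.aestronglyMeasurable).1 (h.memLp () p.toNNReal)⟩

variable {α β : ℝ} {𝔽 : Set (Vec d → ℝ)} [IsProbabilityMeasure Pr] {R : ReferenceNoise M Pr}

/-- For the solvers this is part of the first assumption. For the exact map it is the derivative
bound of order zero, obtained from the second assumption with the sequence of powers of two. -/
theorem exists_stability (h1 : Assumption1 R α 𝔽) (h2 : Assumption2 R β) (n : ℕ) {p : ℝ}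
    (hp : 2 ≤ p) : ∃ c : ℝ≥0, ∀ (j : Option Resolution) (u : Ω → Vec d), R.MemAllLpAt n u →
      eLpNorm (fun ω => M.dynamics (j.map Subtype.val) n (u ω) (R.w n ω)) (ENNReal.ofReal p) Pr
        ≤ c * (1 + eLpNorm u (ENNReal.ofReal p) Pr) := by
  obtain ⟨c, hc⟩ := h1.stability n p hp
  obtain ⟨c', hc', -⟩ := h2.bounds (fun l => 2 ^ l) ⟨fun l => Nat.one_le_two_pow, 1, one_pos, 1,
    fun l => by simp [EquivBy]⟩ n p hp
  refine ⟨max c c', fun j u hu => ?_⟩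
  rcases j with _ | N
  · have h := hc'.first 0 (by norm_num) ![] u (hu p hp)
    simp only [partialDeriv_zero] at h
    refine h.trans ?_
    have := le_max_right c c'
    gcongr
  · refine (hc N.1 N.2 u hu).trans ?_
    have := le_max_left c c'
    gcongr

theorem LpO.coord {Λ : Type*} {V : Λ → Ω → Vec d} {ρ : Λ → ℝ≥0} (hm : ∀ l, Measurable (V l))
    (h : LpO Pr (fun l ω => ‖V l ω‖) ρ) (a : Fin d) : LpO Pr (fun l ω => V l ω a) ρ :=
  h.of_abs_le (fun l => ((measurable_coord a).comp (hm l)).aestronglyMeasurable)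
    fun l => ae_of_all _ fun ω => by simpa using abs_coord_le_norm (V l ω) a

theorem LpO_prediction (h1 : Assumption1 R α 𝔽) (h2 : Assumption2 R β) {n : ℕ}
    (h : ∀ a, LpO Pr (fun (j : Option Resolution) ω => R.state (j.map Subtype.val) n ω a) 1)
    (a : Fin d) :
    LpO Pr (fun (j : Option Resolution) ω => R.prediction (j.map Subtype.val) n ω a) 1 := by
  have hn := LpO.norm_vec (fun j : Option Resolution => R.measurable_state (j.map Subtype.val) n) h
  refine LpO.coord (fun j => R.measurable_prediction _ n) ?_ a
  refine LpO.of_two_le (fun j => (R.measurable_prediction _ n).norm.aestronglyMeasurable)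
    fun p hp => ?_
  obtain ⟨c, hc⟩ := exists_stability h1 h2 n (p := p) (by exact_mod_cast hp)
  obtain ⟨C, hC⟩ := hn.bound p
  refine ⟨c * (1 + C), fun j => ?_⟩
  have hj := hc j _ (R.memAllLpAt_of_LpO (R.measurable_past_state _ n) (R.measurable_state _ n)
    (hn.reindex fun _ : Unit => j))
  rw [ENNReal.ofReal_coe_nnreal] at hj
  rw [eLpNorm_norm]
  refine hj.trans ?_
  have := hC j
  rw [eLpNorm_norm] at this
  simp only [Pi.one_apply, mul_one] at this ⊢
  push_cast
  gcongr

end Dynamics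

/-! ### Growth and Lipschitz bounds for observables -/

section Observables

variable {d : ℕ}

/-- The deterministic estimate is read off from the kernel estimate with a one-point noise space. -/
theorem IsC2Poly.lip {φ : Vec d → ℝ} (hφ : IsC2Poly φ) : ∃ (C : ℝ≥0) (m : ℕ), ∀ x y : Vec d,
    |φ y - φ x| ≤ C * ((1 + (‖x‖ + ‖y‖)) ^ m * ‖y - x‖) := by
  obtain ⟨G, m, hG⟩ := hφ.smoothKernel (ι := Unit) (θ := Unit) ⟨id, id, 0⟩
    (Measure.dirac ())
  obtain ⟨C, hC⟩ := hG.lip.abs_integral_le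
  refine ⟨C, m, fun x y => ?_⟩
  have := hC ((), x, y)
  simpa [add_assoc] using this

theorem IsC2Poly.growth {φ : Vec d → ℝ} (hφ : IsC2Poly φ) : ∃ (C : ℝ≥0) (m : ℕ), ∀ x : Vec d,
    |φ x| ≤ C * (1 + ‖x‖) ^ m := by
  obtain ⟨G, m, hG⟩ := hφ.smoothKernel (ι := Unit) (θ := Unit) ⟨id, id, 0⟩
    (Measure.dirac ())
  obtain ⟨C, hC⟩ := hG.growth.abs_integral_le
  refine ⟨C, m, fun x => ?_⟩
  have := hC ((), x)
  simpa using this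

variable {Ω Λ : Type*} [MeasurableSpace Ω] {Pr : Measure Ω} [IsProbabilityMeasure Pr]

theorem LpO.observable {φ : Vec d → ℝ} (hφ : IsC2Poly φ) {V : Λ → Ω → Vec d}
    (hm : ∀ l, Measurable (V l)) (h : ∀ a, LpO Pr (fun l ω => V l ω a) 1) :
    LpO Pr (fun l ω => φ (V l ω)) 1 := by
  obtain ⟨C, m, hC⟩ := hφ.growth
  refine (((LpO.norm_vec hm h).one_add_pow m).const_mul C).of_abs_le
    (fun l => (hφ.1.continuous.measurable.comp (hm l)).aestronglyMeasurable)
    fun l => ae_of_all _ fun ω => ?_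
  rw [abs_of_nonneg (a := (C : ℝ) * _) (by positivity)]
  exact hC _

theorem LpO.observable_sub {φ : Vec d → ℝ} (hφ : IsC2Poly φ) {V W : Λ → Ω → Vec d} {ρ : Λ → ℝ≥0}
    (hV : ∀ l, Measurable (V l)) (hW : ∀ l, Measurable (W l))
    (h : ∀ a, LpO Pr (fun l ω => V l ω a) 1) (h' : ∀ a, LpO Pr (fun l ω => W l ω a) 1)
    (hd : ∀ a, LpO Pr (fun l ω => V l ω a - W l ω a) ρ) :
    LpO Pr (fun l ω => φ (V l ω) - φ (W l ω)) ρ := by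
  obtain ⟨C, m, hC⟩ := hφ.lip
  have hφm : Measurable φ := hφ.1.continuous.measurable
  have hn := (LpO.norm_vec hW h').add (LpO.norm_vec hV h)
  have hdn : LpO Pr (fun l ω => ‖V l ω - W l ω‖) ρ :=
    LpO.norm_vec (fun l => (hV l).sub (hW l)) hd
  refine (((hn.one_add_pow m).mul_one_left hdn).const_mul C).of_abs_le
    (fun l => ((hφm.comp (hV l)).sub (hφm.comp (hW l))).aestronglyMeasurable)
    fun l => ae_of_all _ fun ω => ?_
  rw [abs_of_nonneg (a := (C : ℝ) * _) (by positivity)]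
  exact hC _ _

end Observables

/-! ### Weak error of the mean-field recursion -/

section WeakError

variable {d dO : ℕ} {𝓦 : Type*} [MeasurableSpace 𝓦] {M : FilterModel d dO 𝓦}
  {Ω : Type*} [MeasurableSpace Ω] {Pr : Measure Ω} [IsProbabilityMeasure Pr]
  {α β : ℝ} {𝔽 : Set (Vec d → ℝ)} {R : ReferenceNoise M Pr}

/-- Comparison of all resolutions with the exact dynamics, with weak rate `α`. -/
noncomputable def exactPairs (α : ℝ) : LevelPairs (Option Resolution) Resolution where
  fine N := some N
  coarse _ := none
  δ N := (N.1 : ℝ≥0) ^ (-α)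

/-- Fubini's theorem: the prediction is independent of the observation noise, which is integrated
out first. -/
theorem integral_pullback (R : ReferenceNoise M Pr) (n : ℕ) (j : Option ℕ) {φ : Vec d → ℝ}
    (hφ : Measurable φ)
    (hi : Integrable (fun ω => φ (M.assimilate (M.mfGain n) (R.prediction j n ω)
      (M.y (n + 1) + R.η (n + 1) ω))) Pr) (hp : Measurable (M.pullback n φ)) :
    ∫ ω, φ (M.assimilate (M.mfGain n) (R.prediction j n ω) (M.y (n + 1) + R.η (n + 1) ω)) ∂Pr
      = ∫ ω, M.pullback n φ (R.prediction j n ω) ∂Pr := by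
  have hv := R.measurable_prediction j n
  have hη := R.measurable_η (n + 1)
  have hlaw := (indepFun_iff_map_prod_eq_prod_map_map hv.aemeasurable hη.aemeasurable).1
    (R.indepFun_prediction j n)
  have hf : Measurable fun q : Vec d × Vec dO =>
      φ (M.assimilate (M.mfGain n) q.1 (M.y (n + 1) + q.2)) :=
    hφ.comp (measurable_assimilate M (fun _ _ => measurable_const) measurable_fst
      (measurable_snd.const_add _))
  have hi' : Integrable (fun q : Vec d × Vec dO =>
      φ (M.assimilate (M.mfGain n) q.1 (M.y (n + 1) + q.2)))
      ((Pr.map (R.prediction j n)).prod (Pr.map (R.η (n + 1)))) := by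
    rw [← hlaw]
    exact (integrable_map_measure hf.aestronglyMeasurable (hv.prodMk hη).aemeasurable).2 hi
  have e1 := integral_map (μ := Pr) (hv.prodMk hη).aemeasurable hf.aestronglyMeasurable
  rw [← e1, hlaw, integral_prod _ hi', R.law_η,
    ← integral_map (f := M.pullback n φ) hv.aemeasurable hp.aestronglyMeasurable]
  rfl

theorem eval_mem_mul (h1 : Assumption1 R α 𝔽) (a b : Fin d) : (fun x : Vec d => x a * x b) ∈ 𝔽 := by
  have := h1.poly_mem (MvPolynomial.X a * MvPolynomial.X b)
    ((MvPolynomial.totalDegree_mul _ _).trans (by simp))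
  simpa using this

theorem eval_mem_coord (h1 : Assumption1 R α 𝔽) (a : Fin d) : (fun x : Vec d => x a) ∈ 𝔽 := by
  have := h1.poly_mem (MvPolynomial.X a) (by simp)
  simpa using this

theorem regular_const_of_weak {F : Option Resolution → ℝ} {K : ℝ≥0} (hK : ∀ j, |F j| ≤ K) {c : ℝ}
    (hc : ∀ N : Resolution, |F (some N) - F none| ≤ c * (N.1 : ℝ) ^ (-α)) :
    Regular Pr (exactPairs α) fun j _ => F j :=
  Regular.const K c.toNNReal hK fun N => (hc N).trans (by
    have : (((exactPairs α).δ N : ℝ≥0) : ℝ) = (N.1 : ℝ) ^ (-α) := by simp [exactPairs]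
    rw [this]
    exact mul_le_mul_of_nonneg_right (Real.le_coe_toNNReal c) (by positivity))

/-- Induction over time. The weak assumption gives rate `α` for the predictions. Since `𝔽` contains
the polynomials of degree two, the covariances and hence the gains converge at the same rate, by the
`Regular` calculus with `exactPairs`. In the update a change of gain has a strong error of order
N^(-α), and with the exact gain frozen the error is that of the pullback of `φ`, again a member of
`𝔽`. Moment bounds uniform in the resolution are carried along. -/
theorem mean_field_weak_error (h1 : Assumption1 R α 𝔽) (h2 : Assumption2 R β) (n : ℕ) :
    (∀ a, LpO Pr (fun (j : Option Resolution) ω => R.state (j.map Subtype.val) n ω a) 1) ∧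
    ∀ φ ∈ 𝔽, ∃ c : ℝ, ∀ N : ℕ, 1 ≤ N →
      |∫ ω, (φ (R.state (some N) n ω) - φ (R.state none n ω)) ∂Pr| ≤ c * (N : ℝ) ^ (-α) := by
  induction n with
  | zero =>
    refine ⟨fun a => ?_, fun φ _ => ⟨0, fun N _ => ?_⟩⟩
    · refine ⟨fun j => ((measurable_coord a).comp R.measurable_u₀).aestronglyMeasurable,
        fun p => ⟨(eLpNorm (fun ω => R.u₀ ω a) p Pr).toNNReal, fun j => ?_⟩⟩
      simp only [Pi.one_apply, mul_one]
      rw [ENNReal.coe_toNNReal (h1.memLp_init a p).2.ne]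
      rfl
    · simp [ReferenceNoise.state, FilterModel.mfState]
  | succ n ih =>
    obtain ⟨hV, hweak⟩ := ih
    have hv := LpO_prediction h1 h2 hV
    have hvm : ∀ j, Measurable (R.prediction j n) := fun j => R.measurable_prediction j n
    have hmem : ∀ j : Option Resolution, R.MemAllLpAt n (R.state (j.map Subtype.val) n) := fun j =>
      R.memAllLpAt_of_LpO (R.measurable_past_state _ n) (R.measurable_state _ n)
        ((LpO.norm_vec (fun j : Option Resolution => R.measurable_state _ n) hV).reindex
          fun _ : Unit => j)
    have hpw : ∀ φ ∈ 𝔽, ∃ c : ℝ, ∀ N : ℕ, 1 ≤ N →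
        |∫ ω, (φ (R.prediction (some N) n ω) - φ (R.prediction none n ω)) ∂Pr|
          ≤ c * (N : ℝ) ^ (-α) :=
      h1.weak n (R.state none n) (fun N => R.state (some N) n) (hmem none)
        (fun N hN => hmem (some ⟨N, hN⟩)) hweak
    have hobs : ∀ φ ∈ 𝔽, LpO Pr (fun (j : Option Resolution) ω =>
        φ (R.prediction (j.map Subtype.val) n ω)) 1 := fun φ hφ =>
      LpO.observable (h1.mem_C2Poly φ hφ) (fun j => hvm _) hv
    have hmean : ∀ φ ∈ 𝔽, Regular Pr (exactPairs α) fun j _ =>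
        ∫ ω, φ (R.prediction (j.map Subtype.val) n ω) ∂Pr := fun φ hφ => by
      obtain ⟨K, hK⟩ := (hobs φ hφ).abs_integral_le
      obtain ⟨c, hc⟩ := hpw φ hφ
      refine regular_const_of_weak (K := K) (fun j => by simpa using hK j) (c := c) fun N => ?_
      rw [← integral_sub ((hobs φ hφ).integrable (some N)) ((hobs φ hφ).integrable none)]
      exact hc N.1 N.2
    set c : Option Resolution → Matrix (Fin d) (Fin d) ℝ := fun j =>
      covMatrix (Pr.map (R.prediction (j.map Subtype.val) n)) with hcdef
    have hvp : ∀ (j : Option Resolution) a,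
        MemLp (fun ω => R.prediction (j.map Subtype.val) n ω a) 2 Pr := fun j a => by
      have h := (hv a).memLp j 2
      exact h
    have hcov : ∀ a b, Regular Pr (exactPairs α) fun j _ => c j a b := fun a b => by
      have h := (hmean _ (eval_mem_mul h1 a b)).sub
        ((hmean _ (eval_mem_coord h1 a)).mul (hmean _ (eval_mem_coord h1 b)))
      have e : (fun (j : Option Resolution) (_ : Ω) => c j a b) = fun j _ =>
          (∫ ω, R.prediction (j.map Subtype.val) n ω a * R.prediction (j.map Subtype.val) n ω b ∂Pr)
          - (∫ ω, R.prediction (j.map Subtype.val) n ω a ∂Pr)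
            * ∫ ω, R.prediction (j.map Subtype.val) n ω b ∂Pr := by
        ext j
        exact covMatrix_map_apply (hvm _) (hvp j) a b
      rw [e]
      exact h
    have hK : ∀ p q, Regular Pr (exactPairs α) fun j _ => M.gain (c j) p q :=
      Regular.gain hcov fun j => covMatrix_map_posSemidef (hvm _) (hvp j)
    have hKH : ∀ a b, Regular Pr (exactPairs α) fun j _ =>
        (1 - M.gain (c j) * M.H : Matrix (Fin d) (Fin d) ℝ) a b := fun a b =>
      (Regular.fixed_const ((1 : Matrix (Fin d) (Fin d) ℝ) a b)).sub
        (Regular.matrix_mul hK (fun a b => Regular.fixed_const (M.H a b)) a b)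
    have hz : ∀ q, LpO Pr (fun (_ : Unit) ω => (M.y (n + 1) + R.η (n + 1) ω) q) 1 := fun q => by
      have hmz : ∀ p : ℝ≥0, MemLp (fun ω => (M.y (n + 1) + R.η (n + 1) ω) q) p Pr := fun p =>
        (memLp_const (M.y (n + 1) q)).add (R.memLp_η (n + 1) q p)
      exact (Regular.fixed (T := (⟨id, id, 0⟩ : LevelPairs Unit Unit))
        ((measurable_coord q).comp ((R.measurable_η (n + 1)).const_add _)) hmz).bdd
    -- The first index selects the gain, the second the prediction, so that the two can be changed
    -- one at a time.
    set A : Option Resolution × Option Resolution → Ω → Vec d := fun q ω =>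
      M.assimilate (M.gain (c q.1)) (R.prediction (q.2.map Subtype.val) n ω)
        (M.y (n + 1) + R.η (n + 1) ω) with hA
    have hAm : ∀ q, Measurable (A q) := fun q => measurable_assimilate M
      (fun _ _ => measurable_const) (hvm _) ((R.measurable_η _).const_add _)
    have hAb : ∀ a, LpO Pr (fun q ω => A q ω a) 1 := fun a => by
      refine ((LpO.sum Finset.univ fun b _ => ((hKH a b).bdd.reindex
        fun q : Option Resolution × Option Resolution => q.1).mul_one_left
          ((hv b).reindex fun q : Option Resolution × Option Resolution => q.2)).add
        (LpO.sum Finset.univ fun r _ => ((hK a r).bdd.reindex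
          fun q : Option Resolution × Option Resolution => q.1).mul_one_left
          ((hz r).reindex fun _ => ()))).congr fun q ω => ?_
      simp only [hA]
      rw [assimilate_apply]
    have hAstate : ∀ (j : Option Resolution) ω,
        R.state (j.map Subtype.val) (n + 1) ω = A (j, j) ω := fun j ω => R.state_succ _ n ω
    refine ⟨fun a => ((hAb a).reindex fun j => (j, j)).congr fun j ω => by rw [hAstate],
      fun φ hφ => ?_⟩
    have hφ2 := h1.mem_C2Poly φ hφ
    have hφm : Measurable φ := hφ2.1.continuous.measurable
    have hdiff : ∀ a, LpO Pr (fun (N : Resolution) ω =>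
        A (some N, some N) ω a - A (none, some N) ω a) (exactPairs α).δ := fun a => by
      have hB := (LpO.sum Finset.univ fun b _ => (hKH a b).pair.mul_one_right
          ((hv b).reindex fun N : Resolution => some N)).add
        (LpO.sum Finset.univ fun r _ => (hK a r).pair.mul_one_right
          ((hz r).reindex fun _ => ()))
      refine hB.congr fun N ω => ?_
      simp only [hA]
      rw [assimilate_apply, assimilate_apply]
      simp only [sub_mul, Finset.sum_sub_distrib]
      simp only [exactPairs]
      ring
    obtain ⟨C, hC⟩ := (LpO.observable_sub hφ2 (fun N : Resolution => hAm (some N, some N))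
      (fun N => hAm (none, some N)) (fun a => (hAb a).reindex _) (fun a => (hAb a).reindex _)
      hdiff).abs_integral_le
    have hAφ := LpO.observable hφ2 hAm hAb
    have hpb := h1.pullback_mem n φ hφ
    have hpbm : Measurable (M.pullback n φ) := (h1.mem_C2Poly _ hpb).1.continuous.measurable
    have hgain0 : M.gain (c none) = M.mfGain n := (R.mfGain_eq none n).symm
    have hfub : ∀ i : Option Resolution, ∫ ω, φ (A (none, i) ω) ∂Pr
        = ∫ ω, M.pullback n φ (R.prediction (i.map Subtype.val) n ω) ∂Pr := fun i => by
      have hi := hAφ.integrable (none, i)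
      simp only [hA, hgain0] at hi ⊢
      exact integral_pullback R n _ hφm hi hpbm
    obtain ⟨D, hD⟩ := hpw _ hpb
    -- `C` accounts for the change of gain at resolution `N`, `D` for the weak error of the
    -- prediction seen through the pullback.
    refine ⟨C + D, fun N hN => ?_⟩
    have hDN := hD N hN
    have hCN := hC ⟨N, hN⟩
    have hδ : (((exactPairs α).δ ⟨N, hN⟩ : ℝ≥0) : ℝ) = (N : ℝ) ^ (-α) := by simp [exactPairs]
    rw [hδ] at hCN
    have i1 := hAφ.integrable (some ⟨N, hN⟩, some ⟨N, hN⟩)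
    have i2 := hAφ.integrable (none, some ⟨N, hN⟩)
    have i3 := hAφ.integrable (none, none)
    rw [integral_sub i1 i2] at hCN
    have i4 : Integrable (fun ω => M.pullback n φ (R.prediction (some N) n ω)) Pr :=
      (hobs _ hpb).integrable (some ⟨N, hN⟩)
    have i5 : Integrable (fun ω => M.pullback n φ (R.prediction none n ω)) Pr :=
      (hobs _ hpb).integrable none
    rw [integral_sub i4 i5] at hDN
    have f1 := hfub (some ⟨N, hN⟩)
    have f2 := hfub none
    simp only [Option.map_some, Option.map_none] at f1 f2
    rw [← f1, ← f2] at hDN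
    have e1 : ∀ ω, R.state (some N) (n + 1) ω = A (some ⟨N, hN⟩, some ⟨N, hN⟩) ω :=
      hAstate (some ⟨N, hN⟩)
    have e2 : ∀ ω, R.state none (n + 1) ω = A (none, none) ω := hAstate none
    simp only [e1, e2]
    rw [integral_sub i1 i3, add_mul]
    refine le_trans (le_of_eq ?_) ((abs_add_le _ _).trans (add_le_add hCN hDN))
    congr 1
    ring

theorem mean_field_accuracy (h1 : Assumption1 R α 𝔽) (h2 : Assumption2 R β) (n : ℕ)
    {φ : Vec d → ℝ} (hφ : φ ∈ 𝔽) : Integrable φ (M.mfMeasure n) ∧ ∃ c : ℝ, ∀ N : ℕ, 1 ≤ N →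
      |∫ x, φ ((M.withSolver N).mfState n x) ∂(Pr.map R.data) - ∫ x, φ x ∂(M.mfMeasure n)|
        ≤ c * (N : ℝ) ^ (-α) := by
  obtain ⟨hb, hw⟩ := mean_field_weak_error h1 h2 n
  have hφ2 := h1.mem_C2Poly φ hφ
  have hφm : Measurable φ := hφ2.1.continuous.measurable
  have hobs := LpO.observable hφ2 (fun j : Option Resolution => R.measurable_state _ n) hb
  have hms := R.measurable_state none n
  have hlaw : Pr.map (R.state none n) = M.mfMeasure n := R.map_mfState n
  obtain ⟨c, hc⟩ := hw φ hφ
  refine ⟨?_, c, fun N hN => ?_⟩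
  · rw [← hlaw, integrable_map_measure hφm.aestronglyMeasurable hms.aemeasurable]
    exact hobs.integrable none
  · have h := hc N hN
    have i1 : Integrable (fun ω => φ (R.state (some N) n ω)) Pr := hobs.integrable (some ⟨N, hN⟩)
    have i2 : Integrable (fun ω => φ (R.state none n ω)) Pr := hobs.integrable none
    rw [integral_sub i1 i2] at h
    have hmN : Measurable ((M.withSolver N).mfState n) :=
      (measurable_mfState (M.withSolver N) n).mono (pastData_le n) le_rfl
    have e := integral_map (μ := Pr) R.measurable_data.aemeasurable
      (hφm.comp hmN).aestronglyMeasurable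
    simp only [Function.comp_apply] at e
    rw [← hlaw, integral_map hms.aemeasurable hφm.aestronglyMeasurable, e]
    exact h

end WeakError

/-! ### Geometric sums, the finest level and the statistical error -/

section Arithmetic

theorem exists_sum_two_rpow_neg_le {t : ℝ} (ht : t < 0) :
    ∃ C : ℝ, 0 < C ∧ ∀ n : ℕ, ∑ l ∈ Finset.range n, (2 : ℝ) ^ (t * l) ≤ C := by
  have hq : (2 : ℝ) ^ t < 1 := Real.rpow_lt_one_of_one_lt_of_neg (by norm_num) ht
  have hq0 : (0 : ℝ) < (2 : ℝ) ^ t := by positivity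
  refine ⟨(1 - (2 : ℝ) ^ t)⁻¹, inv_pos.2 (by linarith), fun n => ?_⟩
  simp only [Real.rpow_mul_natCast (zero_le_two (α := ℝ))]
  rw [← tsum_geometric_of_lt_one hq0.le hq]
  exact (summable_geometric_of_lt_one hq0.le hq).sum_le_tsum _ fun _ _ => by positivity

theorem exists_sum_two_rpow_pos_le {t : ℝ} (ht : 0 < t) :
    ∃ C : ℝ, 0 < C ∧ ∀ L : ℕ, ∑ l ∈ Finset.range (L + 1), (2 : ℝ) ^ (t * l)
      ≤ C * (2 : ℝ) ^ (t * L) := by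
  have hq : 1 < (2 : ℝ) ^ t := Real.one_lt_rpow (by norm_num) ht
  have hq1 : 0 < (2 : ℝ) ^ t - 1 := by linarith
  refine ⟨(2 : ℝ) ^ t / ((2 : ℝ) ^ t - 1), by positivity, fun L => ?_⟩
  simp only [Real.rpow_mul_natCast (zero_le_two (α := ℝ))]
  rw [geom_sum_eq hq.ne', div_mul_eq_mul_div]
  gcongr
  rw [pow_succ, mul_comm]
  linarith

variable {α β s ε : ℝ}

theorem levelRate_pos (hα : 0 < α) (hβ : 0 < β) (hs : 0 < s) : 0 < levelRate α β s := by
  refine lt_min one_pos (lt_min ?_ (mul_pos hα hs))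
  have := mul_pos hβ hs
  linarith

theorem inv_le_two_rpow_finestLevel (hr : 0 < levelRate α β s) (hε : 0 < ε) :
    ε⁻¹ ≤ (2 : ℝ) ^ (levelRate α β s * finestLevel α β s ε) := by
  have h : Real.logb 2 ε⁻¹ / levelRate α β s ≤ finestLevel α β s ε := Nat.le_ceil _
  rw [div_le_iff₀ hr, mul_comm] at h
  exact (Real.logb_le_iff_le_rpow (by norm_num) (inv_pos.2 hε)).1 h

/-- Rounding up raises the level by at most one, at the price of the factor `2 ^ levelRate α β s`.
-/
theorem two_rpow_finestLevel_le (hr : 0 < levelRate α β s) (hε : 0 < ε) (h1 : ε ≤ 1) :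
    (2 : ℝ) ^ (levelRate α β s * finestLevel α β s ε) ≤ 2 ^ levelRate α β s * ε⁻¹ := by
  have h0 : 0 ≤ Real.logb 2 ε⁻¹ / levelRate α β s :=
    div_nonneg (Real.logb_nonneg (by norm_num) (one_le_inv_iff₀.2 ⟨hε, h1⟩)) hr.le
  have h : (finestLevel α β s ε : ℝ) ≤ Real.logb 2 ε⁻¹ / levelRate α β s + 1 :=
    (Nat.ceil_lt_add_one h0).le
  have h2 : levelRate α β s * finestLevel α β s ε ≤ Real.logb 2 ε⁻¹ + levelRate α β s := by
    calc _ ≤ levelRate α β s * (Real.logb 2 ε⁻¹ / levelRate α β s + 1) := by gcongr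
      _ = _ := by field_simp
  calc _ ≤ (2 : ℝ) ^ (Real.logb 2 ε⁻¹ + levelRate α β s) :=
        Real.rpow_le_rpow_of_exponent_le (by norm_num) h2
    _ = _ := by
      rw [Real.rpow_add (by norm_num), Real.rpow_logb (by norm_num) (by norm_num) (inv_pos.2 hε),
        mul_comm]

/-- Powers of `2` at the finest level in terms of the tolerance. -/
theorem le_two_rpow_finestLevel (hr : 0 < levelRate α β s) (hε : 0 < ε) {t : ℝ} (ht : 0 ≤ t) :
    ε ^ (-(t / levelRate α β s)) ≤ (2 : ℝ) ^ (t * finestLevel α β s ε) := by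
  have h := Real.rpow_le_rpow (inv_pos.2 hε).le (inv_le_two_rpow_finestLevel hr hε)
    (div_nonneg ht hr.le)
  rw [Real.inv_rpow hε.le, ← Real.rpow_neg hε.le, ← Real.rpow_mul (by norm_num)] at h
  refine h.trans (le_of_eq ?_)
  congr 1
  field_simp

theorem exists_two_rpow_finestLevel_le (hr : 0 < levelRate α β s) {t : ℝ} (ht : 0 ≤ t) :
    ∃ C : ℝ, 0 < C ∧ ∀ ε : ℝ, 0 < ε → ε ≤ 1 →
      (2 : ℝ) ^ (t * finestLevel α β s ε) ≤ C * ε ^ (-(t / levelRate α β s)) := by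
  refine ⟨2 ^ t, by positivity, fun ε hε h1 => ?_⟩
  have h := Real.rpow_le_rpow (by positivity) (two_rpow_finestLevel_le hr hε h1)
    (div_nonneg ht hr.le)
  rw [Real.mul_rpow (by positivity) (inv_pos.2 hε).le, Real.inv_rpow hε.le,
    ← Real.rpow_neg hε.le, ← Real.rpow_mul (by norm_num), ← Real.rpow_mul (by norm_num)] at h
  have e1 : levelRate α β s * (t / levelRate α β s) = t := by field_simp
  have e2 : levelRate α β s * (finestLevel α β s ε : ℝ) * (t / levelRate α β s)
      = t * finestLevel α β s ε := by field_simp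
  rwa [e1, e2] at h

theorem finestLevel_eq_zero (hr : 0 < levelRate α β s) (h1 : 1 ≤ ε) :
    finestLevel α β s ε = 0 := by
  refine Nat.ceil_eq_zero.2 (div_nonpos_of_nonpos_of_nonneg ?_ hr.le)
  exact Real.logb_nonpos (by norm_num) (inv_nonneg.2 (by linarith)) (inv_le_one_of_one_le₀ h1)

theorem one_le_finestLevel (hr : 0 < levelRate α β s) (hε : 0 < ε) (h1 : ε < 1) :
    1 ≤ finestLevel α β s ε := by
  refine Nat.one_le_ceil_iff.2 (div_pos ?_ hr)
  exact Real.logb_pos (by norm_num) (one_lt_inv_iff₀.2 ⟨hε, h1⟩)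

theorem one_le_sampleRate (hε : 0 < ε) (l : ℕ) : 1 ≤ sampleRate α β s ε l := by
  unfold sampleRate
  split_ifs <;> exact le_add_of_nonneg_left (by positivity)

theorem inv_sqrt_le_of_sq_le {x a : ℝ} (ha : 0 < a) (h : a ^ 2 ≤ x) : (√x)⁻¹ ≤ a⁻¹ :=
  inv_anti₀ ha (Real.le_sqrt_of_sq_le h)

/-- The statistical error of the estimator for the prescribed sample sizes. -/
theorem exists_sum_sampleRate_le (hα : 0 < α) (hβ : 0 < β) (hs : 0 < s) :
    ∃ C : ℝ, 0 < C ∧ ∀ ε : ℝ, 0 < ε → ∑ l ∈ Finset.range (finestLevel α β s ε + 1),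
      (2 : ℝ) ^ (-((1 + min (β * s) 1) / 2 * l)) * (√(sampleRate α β s ε l))⁻¹ ≤ C * ε := by
  have hr := levelRate_pos hα hβ hs
  set b : ℝ := min (β * s) 1 with hb
  -- For `ε ≥ 1` there is only level `0`, whose term is at most `1 ≤ ε`.
  suffices h : ∃ C : ℝ, 0 < C ∧ ∀ ε : ℝ, 0 < ε → ε < 1 →
      ∑ l ∈ Finset.range (finestLevel α β s ε + 1),
        (2 : ℝ) ^ (-((1 + b) / 2 * l)) * (√(sampleRate α β s ε l))⁻¹ ≤ C * ε by
    obtain ⟨C, hC, h⟩ := h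
    refine ⟨max C 1, lt_max_of_lt_left hC, fun ε hε => ?_⟩
    rcases lt_or_ge ε 1 with h1 | h1
    · exact (h ε hε h1).trans (mul_le_mul_of_nonneg_right (le_max_left _ _) hε.le)
    · rw [finestLevel_eq_zero hr h1]
      have h2 : (√(sampleRate α β s ε 0))⁻¹ ≤ 1 :=
        inv_le_one_of_one_le₀ (Real.one_le_sqrt.2 (one_le_sampleRate hε 0))
      have h3 : 1 ≤ max C 1 := le_max_right _ _
      simp only [zero_add, Finset.sum_range_one, Nat.cast_zero, mul_zero, neg_zero,
        Real.rpow_zero, one_mul]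
      nlinarith
  -- The square root of `M_ℓ` contributes the exponent (3 + 2s + b)/6 and the level the exponent -(1
  -- + b)/2, with sum (s - b)/3. The series is accordingly decreasing, constant or increasing in the
  -- level.
  rcases lt_trichotomy s b with hsb | hsb | hsb
  · obtain ⟨C, hC, hsum⟩ := exists_sum_two_rpow_neg_le (t := -(b - s) / 3) (by linarith)
    refine ⟨C, hC, fun ε hε _ => ?_⟩
    refine le_trans (Finset.sum_le_sum fun l _ => ?_)
      ((Finset.sum_mul _ _ ε).symm.le.trans (mul_le_mul_of_nonneg_right (hsum _) hε.le))
    have h1 : (√(sampleRate α β s ε l))⁻¹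
        ≤ (ε⁻¹ * (2 : ℝ) ^ (-((3 + 2 * s + b) / 6 * l)))⁻¹ := by
      refine inv_sqrt_le_of_sq_le (by positivity) ?_
      rw [sampleRate, if_pos hsb, mul_pow, ← Real.rpow_natCast ((2 : ℝ) ^ _) 2,
        ← Real.rpow_mul (by norm_num)]
      have e : -((3 + 2 * s + b) / 6 * (l : ℝ)) * ((2 : ℕ) : ℝ) = -((3 + 2 * s + b) / 3 * l) := by
        push_cast; ring
      rw [e, Real.rpow_neg hε.le, inv_pow, Real.rpow_two]
      exact le_add_of_nonneg_right zero_le_one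
    refine (mul_le_mul_of_nonneg_left h1 (by positivity)).trans (le_of_eq ?_)
    rw [mul_inv, inv_inv, ← Real.rpow_neg (by norm_num), mul_left_comm,
      ← Real.rpow_add (by norm_num), mul_comm]
    congr 2
    ring
  -- The `L + 1` terms are at most `ε / L` each, and `(L + 1) / L ≤ 2` because `L ≥ 1` for `ε < 1`.
  · refine ⟨2, two_pos, fun ε hε hε1 => ?_⟩
    have hL : (1 : ℝ) ≤ finestLevel α β s ε := by exact_mod_cast one_le_finestLevel hr hε hε1
    have hterm : ∀ l ∈ Finset.range (finestLevel α β s ε + 1),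
        (2 : ℝ) ^ (-((1 + b) / 2 * l)) * (√(sampleRate α β s ε l))⁻¹
          ≤ ε / finestLevel α β s ε := fun l _ => by
      have h1 : (√(sampleRate α β s ε l))⁻¹
          ≤ (ε⁻¹ * finestLevel α β s ε * (2 : ℝ) ^ (-((1 + s) / 2 * l)))⁻¹ := by
        refine inv_sqrt_le_of_sq_le (by positivity) ?_
        rw [sampleRate, if_neg (by rw [← hb, ← hsb]; exact lt_irrefl _), if_pos hsb.symm,
          mul_pow, ← Real.rpow_natCast ((2 : ℝ) ^ _) 2, ← Real.rpow_mul (by norm_num)]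
        have e : -((1 + s) / 2 * (l : ℝ)) * ((2 : ℕ) : ℝ) = -((1 + s) * l) := by
          push_cast; ring
        rw [e, Real.rpow_neg hε.le, mul_pow, inv_pow, Real.rpow_two]
        exact le_add_of_nonneg_right zero_le_one
      refine (mul_le_mul_of_nonneg_left h1 (by positivity)).trans (le_of_eq ?_)
      rw [← hsb, mul_inv, mul_inv, inv_inv, mul_left_comm, mul_inv_cancel₀ (by positivity),
        mul_one, div_eq_mul_inv]
    refine (Finset.sum_le_sum hterm).trans ?_
    rw [Finset.sum_const, Finset.card_range, nsmul_eq_mul, mul_div_assoc', div_le_iff₀ (by linarith)]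
    push_cast
    nlinarith
  -- The finest level dominates. Its excess 2^((s-b)L/3) is compensated by the additional negative
  -- power of `ε` in `M_ℓ`.
  · obtain ⟨C, hC, hsum⟩ := exists_sum_two_rpow_pos_le (t := (s - b) / 3) (by linarith)
    obtain ⟨D, hD, hpow⟩ := exists_two_rpow_finestLevel_le (t := (s - b) / 3) hr (by linarith)
    refine ⟨C * D, by positivity, fun ε hε hε1 => ?_⟩
    have hterm : ∀ l ∈ Finset.range (finestLevel α β s ε + 1),
        (2 : ℝ) ^ (-((1 + b) / 2 * l)) * (√(sampleRate α β s ε l))⁻¹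
          ≤ (2 : ℝ) ^ ((s - b) / 3 * l) * ε ^ (1 + (s - b) / 3 / levelRate α β s) := fun l _ => by
      have h1 : (√(sampleRate α β s ε l))⁻¹
          ≤ (ε ^ (-(1 + (s - b) / 3 / levelRate α β s))
            * (2 : ℝ) ^ (-((3 + 2 * s + b) / 6 * l)))⁻¹ := by
        refine inv_sqrt_le_of_sq_le (by positivity) ?_
        rw [sampleRate, if_neg (by rw [← hb]; exact not_lt.2 hsb.le), if_neg hsb.ne, mul_pow,
          ← Real.rpow_natCast ((2 : ℝ) ^ _) 2, ← Real.rpow_mul (by norm_num),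
          ← Real.rpow_natCast (ε ^ _) 2, ← Real.rpow_mul hε.le]
        have e : -((3 + 2 * s + b) / 6 * (l : ℝ)) * ((2 : ℕ) : ℝ)
            = -((3 + 2 * s + b) / 3 * l) := by
          push_cast; ring
        have e' : -(1 + (s - b) / 3 / levelRate α β s) * ((2 : ℕ) : ℝ)
            = -2 - 2 * (s - b) / (3 * levelRate α β s) := by
          push_cast; field_simp; ring
        rw [e, e']
        exact le_add_of_nonneg_right zero_le_one
      refine (mul_le_mul_of_nonneg_left h1 (by positivity)).trans (le_of_eq ?_)
      rw [mul_inv, ← Real.rpow_neg hε.le, ← Real.rpow_neg (by norm_num), neg_neg, neg_neg,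
        mul_left_comm, ← Real.rpow_add (by norm_num), mul_comm]
      congr 2
      ring
    refine (Finset.sum_le_sum hterm).trans ?_
    rw [← Finset.sum_mul]
    calc _ ≤ (C * (D * ε ^ (-((s - b) / 3 / levelRate α β s))))
          * ε ^ (1 + (s - b) / 3 / levelRate α β s) := by
          gcongr
          exact (hsum _).trans (mul_le_mul_of_nonneg_left (hpow ε hε hε1.le) hC.le)
      _ = C * D * (ε ^ (-((s - b) / 3 / levelRate α β s))
          * ε ^ (1 + (s - b) / 3 / levelRate α β s)) := by ring
      _ = C * D * ε := by
        rw [← Real.rpow_add hε, neg_add_cancel_comm_assoc, Real.rpow_one]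

end Arithmetic

/-! ### Error of the multilevel estimator -/

section Accuracy

variable {α β s κ ε : ℝ} {Ms N P : ℕ → ℕ}

theorem rpow_le_of_le_mul {X y z : ℝ} (hκ : 0 < κ) (hy : 0 < y) (h : y ≤ κ * X) (hz : z ≤ 0) :
    X ^ z ≤ κ ^ (-z) * y ^ z := by
  have h1 : y / κ ≤ X := (div_le_iff₀' hκ).2 h
  refine (Real.rpow_le_rpow_of_nonpos (by positivity) h1 hz).trans (le_of_eq ?_)
  rw [Real.div_rpow hy.le hκ.le, Real.rpow_neg hκ.le, div_eq_mul_inv, mul_comm]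

theorem inv_sqrt_eq_rpow {X : ℝ} (hX : 0 ≤ X) : (√X)⁻¹ = X ^ (-(1 / 2) : ℝ) := by
  rw [Real.sqrt_eq_rpow, Real.rpow_neg hX]

theorem nat_pos_of_le_mul {X : ℕ} {y : ℝ} (hy : 0 < y) (h : y ≤ κ * X) : 1 ≤ X := by
  rcases Nat.eq_zero_or_pos X with rfl | h0
  · simp at h
    linarith
  · exact h0

/-- The size of a coupled sample on level `l + 1`. -/
theorem exists_level_weight_le (hβ : 0 < β) (hκ : 0 < κ) : ∃ C : ℝ, 0 < C ∧
    ∀ (X Y : ℝ) (l : ℕ), 0 ≤ Y → (2 : ℝ) ^ (s * l) ≤ κ * X → (2 : ℝ) ^ l ≤ κ * Y →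
      X ^ (-β / 2) * (√Y)⁻¹ + Y⁻¹
        ≤ C * (2 : ℝ) ^ (-((1 + min (β * s) 1) / 2 * (l + 1 : ℕ))) := by
  -- The final factor `2` pays for the index shift from `l` to `l + 1`, as (1 + b)/2 ≤ 1.
  refine ⟨(κ ^ (β / 2) * κ ^ (1 / 2 : ℝ) + κ) * 2, by positivity, fun X Y l hY hX' hY' => ?_⟩
  set b := min (β * s) 1 with hb
  have hb1 : b ≤ 1 := min_le_right _ _
  have hb2 : b ≤ β * s := min_le_left _ _
  have h1 := rpow_le_of_le_mul (z := -β / 2) hκ (by positivity) hX' (by linarith)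
  have h2 := rpow_le_of_le_mul (z := -(1 / 2)) hκ (by positivity) hY' (by norm_num)
  have h3 := rpow_le_of_le_mul (z := -1) hκ (by positivity) hY' (by norm_num)
  rw [← Real.rpow_natCast 2 l] at h2 h3
  rw [← Real.rpow_mul (by norm_num)] at h1 h2 h3
  rw [Real.rpow_neg_one, neg_neg, Real.rpow_one] at h3
  rw [inv_sqrt_eq_rpow hY]
  have hl : (0 : ℝ) ≤ l := Nat.cast_nonneg l
  have hγ : (2 : ℝ) ^ (-((1 + b) / 2 * l))
      ≤ 2 * (2 : ℝ) ^ (-((1 + b) / 2 * (l + 1 : ℕ))) := by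
    calc (2 : ℝ) ^ (-((1 + b) / 2 * l)) ≤ (2 : ℝ) ^ (1 + -((1 + b) / 2 * (l + 1 : ℕ))) :=
          Real.rpow_le_rpow_of_exponent_le (by norm_num) (by push_cast; linarith)
      _ = _ := by rw [Real.rpow_add (by norm_num), Real.rpow_one]
  have e1 : -(-β / 2) = β / 2 := by ring
  rw [e1] at h1
  rw [neg_neg] at h2
  have h4 : X ^ (-β / 2) * Y ^ (-(1 / 2) : ℝ) ≤ κ ^ (β / 2) * κ ^ (1 / 2 : ℝ)
      * (2 : ℝ) ^ (-((1 + b) / 2 * l)) := by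
    calc _ ≤ (κ ^ (β / 2) * (2 : ℝ) ^ (s * l * (-β / 2)))
          * (κ ^ (1 / 2 : ℝ) * (2 : ℝ) ^ (l * -(1 / 2) : ℝ)) :=
          mul_le_mul h1 h2 (by positivity) (by positivity)
      _ = κ ^ (β / 2) * κ ^ (1 / 2 : ℝ) * (2 : ℝ) ^ (s * l * (-β / 2) + l * -(1 / 2)) := by
          rw [Real.rpow_add (by norm_num)]; ring
      _ ≤ _ := by
          refine mul_le_mul_of_nonneg_left
            (Real.rpow_le_rpow_of_exponent_le (by norm_num) ?_) (by positivity)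
          nlinarith
  have h5 : Y⁻¹ ≤ κ * (2 : ℝ) ^ (-((1 + b) / 2 * l)) := by
    refine h3.trans (mul_le_mul_of_nonneg_left
      (Real.rpow_le_rpow_of_exponent_le (by norm_num) ?_) hκ.le)
    nlinarith
  calc _ ≤ (κ ^ (β / 2) * κ ^ (1 / 2 : ℝ) + κ) * (2 : ℝ) ^ (-((1 + b) / 2 * l)) := by
        rw [add_mul]; exact add_le_add h4 h5
    _ ≤ (κ ^ (β / 2) * κ ^ (1 / 2 : ℝ) + κ)
        * (2 * (2 : ℝ) ^ (-((1 + b) / 2 * (l + 1 : ℕ)))) := by gcongr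
    _ = _ := by ring

/-- At the finest level the finite ensemble contributes 2^(-L) and the resolution 2^(-αsL). Both are
at most 2^(-rL) ≤ ε for `r` the `levelRate`. Of the three terms in its minimum only `1` and `α * s`
matter here. -/
theorem exists_bias_le (hα : 0 < α) (hβ : 0 < β) (hs : 0 < s) (hκ : 0 < κ) (K c : ℝ) (hK : 0 ≤ K) :
    ∃ C : ℝ, 0 < C ∧ ∀ (ε : ℝ), 0 < ε → ∀ X Y : ℝ, 0 ≤ X → 0 ≤ Y →
      (2 : ℝ) ^ (s * finestLevel α β s ε) ≤ κ * X → (2 : ℝ) ^ finestLevel α β s ε ≤ κ * Y →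
      K * Y⁻¹ + c * X ^ (-α) ≤ C * ε := by
  have hr := levelRate_pos hα hβ hs
  refine ⟨K * κ + |c| * κ ^ α + 1, by positivity, fun ε hε X Y hX0 hY0 hX hY => ?_⟩
  set L := finestLevel α β s ε with hL
  have h0 : (2 : ℝ) ^ (-(levelRate α β s * L)) ≤ ε := by
    rw [Real.rpow_neg (by norm_num)]
    exact inv_le_of_inv_le₀ hε (inv_le_two_rpow_finestLevel hr hε)
  have h1 := rpow_le_of_le_mul (z := -α) hκ (by positivity) hX (by linarith)
  have h3 := rpow_le_of_le_mul (z := -1) hκ (by positivity) hY (by norm_num)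
  rw [← Real.rpow_natCast 2 L] at h3
  rw [← Real.rpow_mul (by norm_num), neg_neg] at h1 h3
  rw [Real.rpow_neg_one, Real.rpow_one] at h3
  have hl : (0 : ℝ) ≤ L := Nat.cast_nonneg L
  have r1 : levelRate α β s ≤ 1 := min_le_left _ _
  have r2 : levelRate α β s ≤ α * s := (min_le_right _ _).trans (min_le_right _ _)
  have h4 : Y⁻¹ ≤ κ * ε := h3.trans (mul_le_mul_of_nonneg_left
    ((Real.rpow_le_rpow_of_exponent_le (by norm_num) (by nlinarith)).trans h0) hκ.le)
  have h5 : X ^ (-α) ≤ κ ^ α * ε := h1.trans (mul_le_mul_of_nonneg_left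
    ((Real.rpow_le_rpow_of_exponent_le (by norm_num) (by nlinarith)).trans h0) (by positivity))
  calc _ ≤ K * (κ * ε) + |c| * (κ ^ α * ε) := by
        refine add_le_add (mul_le_mul_of_nonneg_left h4 hK) ?_
        exact (mul_le_mul_of_nonneg_right (le_abs_self c) (by positivity)).trans
          (mul_le_mul_of_nonneg_left h5 (abs_nonneg c))
    _ ≤ _ := by nlinarith

variable {d dO : ℕ} {𝓦 : Type*} [MeasurableSpace 𝓦] {Ω : Type*} [MeasurableSpace Ω]
  {M : FilterModel d dO 𝓦} {Pr : Measure Ω} [IsProbabilityMeasure Pr] {R : ReferenceNoise M Pr}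
  {Ω' : Type*} [MeasurableSpace Ω'] {Pr' : Measure Ω'} [IsProbabilityMeasure Pr']
  {𝔽 : Set (Vec d → ℝ)}

/-- The error is the sum of the centred level averages plus the bias of the finest EnKF. Minkowski's
inequality combines the estimates of `exists_level_estimates` with the prescribed sample sizes. -/
theorem mlenkf_accuracy (h1 : Assumption1 R α 𝔽) (h2 : Assumption2 R β)
    (S : EnsembleNoise M Pr') (hs : 0 < s) (hκ : 0 < κ) {φ : Vec d → ℝ} (hφ : φ ∈ 𝔽) (n : ℕ)
    {p : ℝ} (hp : 2 ≤ p) :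
    ∃ C : ℝ, 0 < C ∧ ∀ ε : ℝ, 0 < ε → ∀ Ms N P : ℕ → ℕ, IsConfiguration α β s κ ε Ms N P →
      eLpNorm (fun ω => S.mlenkf (finestLevel α β s ε) Ms N P n φ ω
        - ∫ x, φ x ∂(M.mfMeasure n)) (ENNReal.ofReal p) Pr' ≤ ENNReal.ofReal (C * ε) := by
  have hα := h1.alpha_pos
  have hβ := h2.beta_pos
  obtain ⟨e, hA, hB, K, hK⟩ := exists_level_estimates h1 h2 S hs κ (h1.mem_C2Poly φ hφ) n
  obtain ⟨-, c, hc⟩ := mean_field_accuracy h1 h2 n hφ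
  obtain ⟨C₀, hC₀⟩ := hA.bound p.toNNReal
  obtain ⟨C₁, hC₁⟩ := hB.bound p.toNNReal
  obtain ⟨D, hD, hw⟩ := exists_level_weight_le (s := s) hβ hκ
  obtain ⟨B, hB0, hbias⟩ := exists_bias_le hα hβ hs hκ K c K.2
  obtain ⟨E, hE, hsum⟩ := exists_sum_sampleRate_le hα hβ hs
  set G : ℝ := (C₀ + C₁ * D) * κ ^ (1 / 2 : ℝ) with hG
  have hG0 : 0 ≤ G := by positivity
  refine ⟨G * E + B, by positivity, fun ε hε Ms N P hc' => ?_⟩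
  set L := finestLevel α β s ε with hL
  have hN : ∀ l, 1 ≤ N l := fun l => nat_pos_of_le_mul (by positivity) (hc'.resolution l).2
  have hP : ∀ l, 1 ≤ P l := fun l => nat_pos_of_le_mul (by positivity) (hc'.size l).2
  have hM : ∀ l, l ≤ L → 1 ≤ Ms l := fun l hl => nat_pos_of_le_mul
    (zero_lt_one.trans_le (one_le_sampleRate hε l)) (hc'.samples l hl).2
  have hMrate : ∀ l, l ≤ L → (√(Ms l : ℝ))⁻¹
      ≤ κ ^ (1 / 2 : ℝ) * (√(sampleRate α β s ε l))⁻¹ := fun l hl => by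
    have h0 := zero_lt_one.trans_le (one_le_sampleRate (α := α) (β := β) (s := s) hε l)
    have := rpow_le_of_le_mul (z := -(1 / 2)) hκ h0 (hc'.samples l hl).2 (by norm_num)
    rwa [neg_neg, ← inv_sqrt_eq_rpow (Nat.cast_nonneg _), ← inv_sqrt_eq_rpow h0.le] at this
  let ee : ℕ → ℝ := fun l => e ⟨N l, hN l⟩ ⟨P l, hP l⟩
  -- The expectations of the level samples. They telescope because the coarse ensembles of level `k
  -- + 1` have the parameters of level `k`.
  let El : ℕ → ℝ := fun l => Nat.casesOn l (ee 0) fun k => ee (k + 1) - ee k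
  let A : ℕ → Ω' → ℝ := fun l ω =>
    (∑ m ∈ Finset.range (Ms l), M.levelSample N P (S.drivers l m ω) n φ l) / Ms l - El l
  have hAl : ∀ l, l ≤ L → AEStronglyMeasurable (A l) Pr' ∧
      eLpNorm (A l) (ENNReal.ofReal p) Pr' ≤ ENNReal.ofReal
        (G * ((2 : ℝ) ^ (-((1 + min (β * s) 1) / 2 * l)) * (√(sampleRate α β s ε l))⁻¹)) := by
    intro l hl
    rcases l with _ | l
    · have hq := hA.meas (⟨N 0, hN 0⟩, ⟨P 0, hP 0⟩, 0, ⟨Ms 0, hM 0 hl⟩)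
      refine ⟨hq, (hC₀ (⟨N 0, hN 0⟩, ⟨P 0, hP 0⟩, 0, ⟨Ms 0, hM 0 hl⟩)).trans ?_⟩
      rw [← ENNReal.ofReal_coe_nnreal]
      refine ENNReal.ofReal_le_ofReal ?_
      have := hMrate 0 hl
      simp only [PNat.mk_coe, NNReal.coe_mul, NNReal.coe_inv, Real.coe_sqrt, NNReal.coe_natCast,
        Nat.cast_zero, mul_zero, neg_zero, Real.rpow_zero, one_mul]
      have hCD : (C₀ : ℝ) ≤ C₀ + C₁ * D := le_add_of_nonneg_right (by positivity)
      calc (C₀ : ℝ) * (√(Ms 0 : ℝ))⁻¹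
          ≤ (C₀ + C₁ * D) * (κ ^ (1 / 2 : ℝ) * (√(sampleRate α β s ε 0))⁻¹) := by gcongr
        _ = _ := by rw [hG]; ring
    · let q : consecutivePairs s κ × ℕ+ × ℕ × ℕ+ :=
        (⟨(N l, N (l + 1)), hN l, hN (l + 1), l, hc'.resolution l, hc'.resolution (l + 1)⟩,
          ⟨P l, hP l⟩, l + 1, ⟨Ms (l + 1), hM _ hl⟩)
      have hP2 : (2 * ⟨P l, hP l⟩ : ℕ+) = ⟨P (l + 1), hP (l + 1)⟩ := PNat.eq (hc'.double l).symm
      have hAq : A (l + 1) = fun ω => (∑ m ∈ Finset.range q.2.2.2,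
          coupledSample M q.1.1 q.2.1 (S.drivers q.2.2.1 m ω) n φ) / (q.2.2.2 : ℕ)
          - (e ⟨q.1.1.2, q.1.2.2.1⟩ (2 * q.2.1) - e ⟨q.1.1.1, q.1.2.1⟩ q.2.1) := by
        funext ω
        simp only [A, El, ee, q, FilterModel.levelSample, coupledSample, hP2, hc'.double l,
          PNat.mk_coe]
      rw [hAq]
      refine ⟨hB.meas q, (hC₁ q).trans ?_⟩
      rw [← ENNReal.ofReal_coe_nnreal]
      refine ENNReal.ofReal_le_ofReal ?_
      have h3 := hMrate (l + 1) hl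
      have h4 := hw (N l) (P l) l (Nat.cast_nonneg _) (hc'.resolution l).2 (hc'.size l).2
      simp only [q, PNat.mk_coe, NNReal.coe_mul, NNReal.coe_inv, Real.coe_sqrt,
        NNReal.coe_natCast, NNReal.coe_add, NNReal.coe_rpow]
      have hCD : (C₁ * D : ℝ) ≤ C₀ + C₁ * D := le_add_of_nonneg_left C₀.2
      calc (C₁ : ℝ) * (((N l : ℝ) ^ (-β / 2) * (√(P l : ℝ))⁻¹ + (P l : ℝ)⁻¹)
            * (√(Ms (l + 1) : ℝ))⁻¹)
          ≤ C₁ * ((D * (2 : ℝ) ^ (-((1 + min (β * s) 1) / 2 * (l + 1 : ℕ))))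
            * (κ ^ (1 / 2 : ℝ) * (√(sampleRate α β s ε (l + 1)))⁻¹)) := by gcongr
        _ = (C₁ * D) * κ ^ (1 / 2 : ℝ) * ((2 : ℝ) ^ (-((1 + min (β * s) 1) / 2 * (l + 1 : ℕ)))
            * (√(sampleRate α β s ε (l + 1)))⁻¹) := by ring
        _ ≤ _ := by rw [hG]; gcongr
  have htel : ∑ l ∈ Finset.range (L + 1), El l = ee L := by
    rw [Finset.sum_range_succ']
    have : ∑ k ∈ Finset.range L, El (k + 1) = ee L - ee 0 := Finset.sum_range_sub ee L
    rw [this]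
    exact sub_add_cancel _ _
  have hdec : (fun ω => S.mlenkf L Ms N P n φ ω - ∫ x, φ x ∂(M.mfMeasure n))
      = (∑ l ∈ Finset.range (L + 1), A l) + fun _ => ee L - ∫ x, φ x ∂(M.mfMeasure n) := by
    funext ω
    simp only [EnsembleNoise.mlenkf, Pi.add_apply, Finset.sum_apply, A, Finset.sum_sub_distrib,
      htel]
    ring
  have hp1 : (1 : ℝ≥0∞) ≤ ENNReal.ofReal p := by
    rw [← ENNReal.ofReal_one]
    exact ENNReal.ofReal_le_ofReal (by linarith)
  have hAm : ∀ l ∈ Finset.range (L + 1), AEStronglyMeasurable (A l) Pr' := fun l hl =>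
    (hAl l (Nat.lt_succ_iff.1 (Finset.mem_range.1 hl))).1
  have hconst : eLpNorm (fun _ : Ω' => ee L - ∫ x, φ x ∂(M.mfMeasure n)) (ENNReal.ofReal p) Pr'
      ≤ ENNReal.ofReal (B * ε) := by
    refine (eLpNorm_const_le (Pr := Pr') _ _).trans ?_
    rw [← ofReal_norm, Real.norm_eq_abs]
    refine ENNReal.ofReal_le_ofReal ?_
    refine le_trans ?_ (hbias ε hε (N L) (P L) (Nat.cast_nonneg _) (Nat.cast_nonneg _)
      (hc'.resolution L).2 (hc'.size L).2)
    refine le_trans ?_ (add_le_add (hK ⟨N L, hN L⟩ ⟨P L, hP L⟩) (hc (N L) (hN L)))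
    refine le_trans (le_of_eq ?_) (abs_add_le _ _)
    congr 1
    ring
  rw [hdec]
  refine (eLpNorm_add_le (Finset.aestronglyMeasurable_sum _ hAm) aestronglyMeasurable_const
    hp1).trans ?_
  rw [add_mul, ENNReal.ofReal_add (by positivity) (by positivity)]
  refine add_le_add ((eLpNorm_sum_le hAm hp1).trans ?_) hconst
  refine (Finset.sum_le_sum fun l hl =>
    (hAl l (Nat.lt_succ_iff.1 (Finset.mem_range.1 hl))).2).trans ?_
  rw [← ENNReal.ofReal_sum_of_nonneg fun l _ => by positivity, ← Finset.mul_sum]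
  refine ENNReal.ofReal_le_ofReal ?_
  exact (mul_le_mul_of_nonneg_left (hsum ε hε) hG0).trans (le_of_eq (by ring))

end Accuracy

/-! ### Cost of the prescribed configuration -/

section Workload

variable {α β s κ ε : ℝ} {Ms N P : ℕ → ℕ}

/-- The cost of the estimator for the prescribed sizes. -/
noncomputable def workload (α β s ε : ℝ) : ℝ :=
  ∑ l ∈ Finset.range (finestLevel α β s ε + 1),
    sampleRate α β s ε l * (2 : ℝ) ^ (s * l) * (2 : ℝ) ^ l

theorem mlCost_le_workload (hκ : 0 < κ) (h : IsConfiguration α β s κ ε Ms N P) :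
    mlCost (finestLevel α β s ε) Ms N P ≤ κ ^ 3 * workload α β s ε := by
  rw [mlCost, workload, Finset.mul_sum]
  refine Finset.sum_le_sum fun l hl => ?_
  have hM := (h.samples l (Nat.lt_succ_iff.1 (Finset.mem_range.1 hl))).1
  have h0 : 0 ≤ κ * sampleRate α β s ε l := (Nat.cast_nonneg _).trans hM
  calc (Ms l : ℝ) * N l * P l
      ≤ (κ * sampleRate α β s ε l) * (κ * (2 : ℝ) ^ (s * l)) * (κ * (2 : ℝ) ^ l) := by
        gcongr
        · exact (h.resolution l).1
        · exact (h.size l).1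
    _ = _ := by ring

theorem workload_le_mlCost (hκ : 0 < κ) (h : IsConfiguration α β s κ ε Ms N P) :
    workload α β s ε ≤ κ ^ 3 * mlCost (finestLevel α β s ε) Ms N P := by
  rw [mlCost, workload, Finset.mul_sum]
  refine Finset.sum_le_sum fun l hl => ?_
  calc sampleRate α β s ε l * (2 : ℝ) ^ (s * l) * (2 : ℝ) ^ l
      ≤ (κ * Ms l) * (κ * N l) * (κ * P l) := by
        gcongr
        · exact (h.samples l (Nat.lt_succ_iff.1 (Finset.mem_range.1 hl))).2
        · exact (h.resolution l).2
        · exact (h.size l).2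
    _ = _ := by ring

theorem two_rpow_mul_two_pow (s : ℝ) (l : ℕ) :
    (2 : ℝ) ^ (s * l) * (2 : ℝ) ^ l = (2 : ℝ) ^ ((1 + s) * l) := by
  rw [← Real.rpow_natCast 2 l, ← Real.rpow_add (by norm_num)]
  ring_nf

/-- Lower bounds on the cost come from a single level: level `0` if the contributions decrease, the
finest level if they increase. -/
theorem term_le_workload (hε : 0 < ε) {l : ℕ} (hl : l ≤ finestLevel α β s ε) :
    sampleRate α β s ε l * (2 : ℝ) ^ ((1 + s) * l) ≤ workload α β s ε := by
  rw [← two_rpow_mul_two_pow, ← mul_assoc]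
  refine Finset.single_le_sum (f := fun l : ℕ => sampleRate α β s ε l * (2 : ℝ) ^ (s * l) *
    (2 : ℝ) ^ l) (fun i _ => ?_) (Finset.mem_range.2 (Nat.lt_succ_iff.2 hl))
  have := zero_lt_one.trans_le (one_le_sampleRate (α := α) (β := β) (s := s) hε i)
  positivity

theorem rpow_neg_le_rpow_neg {a b : ℝ} (hε : 0 < ε) (h1 : ε ≤ 1) (h : a ≤ b) :
    ε ^ (-a) ≤ ε ^ (-b) :=
  Real.rpow_le_rpow_of_exponent_ge hε h1 (neg_le_neg h)

/-- The part of the cost due to a fixed number of samples on each level. -/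
theorem exists_sum_two_rpow_le (hr : 0 < levelRate α β s) (hs : 0 < s) {q : ℝ}
    (hq : 1 + s ≤ q * levelRate α β s) : ∃ C : ℝ, 0 < C ∧ ∀ ε : ℝ, 0 < ε → ε ≤ 1 →
      ∑ l ∈ Finset.range (finestLevel α β s ε + 1), (2 : ℝ) ^ ((1 + s) * l) ≤ C * ε ^ (-q) := by
  obtain ⟨C, hC, hsum⟩ := exists_sum_two_rpow_pos_le (t := 1 + s) (by linarith)
  obtain ⟨D, hD, hpow⟩ := exists_two_rpow_finestLevel_le (t := 1 + s) hr (by linarith)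
  refine ⟨C * D, by positivity, fun ε hε h1 => ?_⟩
  calc _ ≤ C * (D * ε ^ (-((1 + s) / levelRate α β s))) :=
        (hsum _).trans (mul_le_mul_of_nonneg_left (hpow ε hε h1) hC.le)
    _ ≤ C * (D * ε ^ (-q)) := by
        gcongr C * (D * ?_)
        exact rpow_neg_le_rpow_neg hε h1 ((div_le_iff₀ hr).2 hq)
    _ = _ := by ring

/-- This separates the effective sample sizes from the `+ 1`, which forces at least a fixed number
of samples on every level and costs 2^((1+s)ℓ). -/
theorem workload_eq (α β s ε : ℝ) {A t : ℝ} (h : ∀ l : ℕ, sampleRate α β s ε l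
      = A * (2 : ℝ) ^ (-(t * l)) + 1) :
    workload α β s ε = A * ∑ l ∈ Finset.range (finestLevel α β s ε + 1),
        (2 : ℝ) ^ ((1 + s - t) * l)
      + ∑ l ∈ Finset.range (finestLevel α β s ε + 1), (2 : ℝ) ^ ((1 + s) * l) := by
  rw [workload, Finset.mul_sum, ← Finset.sum_add_distrib]
  refine Finset.sum_congr rfl fun l _ => ?_
  have e : (1 + s - t) * l = -(t * l) + (1 + s) * l := by ring
  rw [mul_assoc, two_rpow_mul_two_pow, h, e, Real.rpow_add (by norm_num)]
  ring

/-- The contributions decrease like 2^((s-b)ℓ/3), so the cost is that of level `0`. The hypothesis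
`hq` keeps the cost due to the `+ 1`, of order ε^(-(1+s)/r), below ε^(-2). -/
theorem workload_bounds_of_lt (hr : 0 < levelRate α β s) (hs : 0 < s) (hb : s < min (β * s) 1)
    (hq : 1 + s ≤ 2 * levelRate α β s) : ∃ C : ℝ, 0 < C ∧ ∀ ε : ℝ, 0 < ε → ε ≤ 1 →
      ε ^ (-2 : ℝ) ≤ workload α β s ε ∧ workload α β s ε ≤ C * ε ^ (-2 : ℝ) := by
  obtain ⟨C, hC, hsum⟩ := exists_sum_two_rpow_neg_le
    (t := 1 + s - (3 + 2 * s + min (β * s) 1) / 3) (by linarith)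
  obtain ⟨D, hD, hsum'⟩ := exists_sum_two_rpow_le hr hs hq
  have hM : ∀ ε l, sampleRate α β s ε l = ε ^ (-2 : ℝ)
      * (2 : ℝ) ^ (-((3 + 2 * s + min (β * s) 1) / 3 * l)) + 1 := fun ε l => by
    rw [sampleRate, if_pos hb]
  refine ⟨C + D, by positivity, fun ε hε h1 => ⟨?_, ?_⟩⟩
  · refine le_trans ?_ (term_le_workload (α := α) (β := β) (s := s) hε (Nat.zero_le _))
    rw [hM]
    simp
  · rw [workload_eq α β s ε (hM ε), add_mul, mul_comm C]
    exact add_le_add (mul_le_mul_of_nonneg_left (hsum _) (by positivity)) (hsum' ε hε h1)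

/-- The finest level dominates. The exponent 2 + 2(s-b)/(3r) of the sample size and (s-b)/(3r) from
the geometric growth add up to 2 + (s-b)/r. By `hq` the cost due to the `+ 1` is no larger. -/
theorem workload_bounds_of_gt (hr : 0 < levelRate α β s) (hs : 0 < s) (hb : min (β * s) 1 < s)
    (hq : 1 + min (β * s) 1 ≤ 2 * levelRate α β s) : ∃ C : ℝ, 0 < C ∧ ∀ ε : ℝ, 0 < ε → ε ≤ 1 →
      ε ^ (-(2 + (s - min (β * s) 1) / levelRate α β s)) ≤ workload α β s ε ∧
      workload α β s ε ≤ C * ε ^ (-(2 + (s - min (β * s) 1) / levelRate α β s)) := by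
  set b := min (β * s) 1 with hbdef
  set r := levelRate α β s with hrdef
  have ht : 1 + s - (3 + 2 * s + b) / 3 = (s - b) / 3 := by ring
  obtain ⟨C, hC, hsum⟩ := exists_sum_two_rpow_pos_le (t := (s - b) / 3) (by linarith)
  obtain ⟨E, hE, hpow⟩ := exists_two_rpow_finestLevel_le (t := (s - b) / 3) hr (by linarith)
  obtain ⟨D, hD, hsum'⟩ := exists_sum_two_rpow_le (q := 2 + (s - b) / r) hr hs (by
    rw [add_mul, div_mul_cancel₀ _ hr.ne']
    linarith)
  have hM : ∀ ε l, sampleRate α β s ε l = ε ^ (-2 - 2 * (s - b) / (3 * r))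
      * (2 : ℝ) ^ (-((3 + 2 * s + b) / 3 * l)) + 1 := fun ε l => by
    rw [sampleRate, ← hbdef, if_neg (not_lt.2 hb.le), if_neg hb.ne]
  have hexp : -(2 + (s - b) / r) = (-2 - 2 * (s - b) / (3 * r)) + -((s - b) / 3 / r) := by
    field_simp
    ring
  refine ⟨C * E + D, by positivity, fun ε hε h1 => ?_⟩
  have hsplit : ε ^ (-(2 + (s - b) / r))
      = ε ^ (-2 - 2 * (s - b) / (3 * r)) * ε ^ (-((s - b) / 3 / r)) := by
    rw [hexp, Real.rpow_add hε]
  refine ⟨?_, ?_⟩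
  · refine le_trans ?_ (term_le_workload hε le_rfl)
    rw [hM, add_mul, mul_assoc, ← Real.rpow_add (by norm_num), hsplit]
    refine le_add_of_le_of_nonneg (mul_le_mul_of_nonneg_left ?_ (by positivity)) (by positivity)
    refine (le_two_rpow_finestLevel hr hε (t := (s - b) / 3) (by linarith)).trans (le_of_eq ?_)
    congr 1
    ring
  · rw [workload_eq α β s ε (hM ε), add_mul, ht]
    refine add_le_add ?_ (hsum' ε hε h1)
    calc _ ≤ ε ^ (-2 - 2 * (s - b) / (3 * r)) * (C * (E * ε ^ (-((s - b) / 3 / r)))) := by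
          gcongr
          exact (hsum _).trans (mul_le_mul_of_nonneg_left (hpow ε hε h1) hC.le)
      _ = _ := by rw [hsplit]; ring

/-- The `1` lost by rounding up is absorbed because |log ε| stays above |log ε₀| > 0; this is where
`ε₀ < 1` is needed. -/
theorem finestLevel_bounds (hr : 0 < levelRate α β s) {ε₀ : ℝ} (h0 : 0 < ε₀) (h1 : ε₀ < 1) :
    ∃ c C : ℝ, 0 < c ∧ 0 < C ∧ ∀ ε : ℝ, 0 < ε → ε ≤ ε₀ →
      c * |Real.log ε| ≤ finestLevel α β s ε ∧ finestLevel α β s ε ≤ C * |Real.log ε| := by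
  have hlog2 : 0 < Real.log 2 := Real.log_pos (by norm_num)
  have hlog : 0 < -Real.log ε₀ := neg_pos.2 (Real.log_neg h0 h1)
  set r := levelRate α β s with hrdef
  refine ⟨(Real.log 2 * r)⁻¹, (Real.log 2 * r)⁻¹ + (-Real.log ε₀)⁻¹, by positivity, by positivity,
    fun ε hε hle => ?_⟩
  have hlogε : -Real.log ε₀ ≤ -Real.log ε := neg_le_neg (Real.log_le_log hε hle)
  have habs : |Real.log ε| = -Real.log ε := abs_of_neg (by linarith)
  have he : Real.logb 2 ε⁻¹ / r = (Real.log 2 * r)⁻¹ * |Real.log ε| := by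
    rw [habs, Real.logb, Real.log_inv]
    field_simp
  rw [finestLevel, ← hrdef, he]
  refine ⟨Nat.le_ceil _, (Nat.ceil_lt_add_one (by positivity)).le.trans ?_⟩
  rw [add_mul]
  refine add_le_add_right ?_ _
  rw [habs, inv_mul_eq_div]
  exact (one_le_div hlog).2 hlogε

/-- All `L + 1` levels cost about ε^(-2) L² each, which gives L³, and `L` is comparable to |log ε|.
-/
theorem workload_bounds_of_eq (hr : 0 < levelRate α β s) (hs : 0 < s) (hb : min (β * s) 1 = s)
    (hq : 1 + s ≤ 2 * levelRate α β s) {ε₀ : ℝ} (h0 : 0 < ε₀) (h1 : ε₀ < 1) :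
    ∃ c C : ℝ, 0 < c ∧ 0 < C ∧ ∀ ε : ℝ, 0 < ε → ε ≤ ε₀ →
      c * (ε ^ (-2 : ℝ) * |Real.log ε| ^ 3) ≤ workload α β s ε ∧
      workload α β s ε ≤ C * (ε ^ (-2 : ℝ) * |Real.log ε| ^ 3) := by
  obtain ⟨c, C, hc, hC, hL⟩ := finestLevel_bounds hr h0 h1
  obtain ⟨D, hD, hsum⟩ := exists_sum_two_rpow_le hr hs hq
  refine ⟨c ^ 3, (2 + D) * C ^ 3, by positivity, by positivity, fun ε hε hle => ?_⟩
  obtain ⟨l1, l2⟩ := hL ε hε hle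
  have hε1 : ε < 1 := hle.trans_lt h1
  have hL1 : (1 : ℝ) ≤ finestLevel α β s ε := by exact_mod_cast one_le_finestLevel hr hε hε1
  have hM : ∀ l, sampleRate α β s ε l = ε ^ (-2 : ℝ) * (finestLevel α β s ε : ℝ) ^ 2
      * (2 : ℝ) ^ (-((1 + s) * l)) + 1 := fun l => by
    rw [sampleRate, if_neg (by rw [hb]; exact lt_irrefl _), if_pos hb]
  have hsum' := hsum ε hε hε1.le
  have hsum0 : 0 ≤ ∑ l ∈ Finset.range (finestLevel α β s ε + 1), (2 : ℝ) ^ ((1 + s) * l) :=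
    Finset.sum_nonneg fun _ _ => by positivity
  rw [workload_eq α β s ε hM]
  simp only [sub_self, zero_mul, Real.rpow_zero, Finset.sum_const, Finset.card_range,
    nsmul_eq_mul, mul_one]
  set L : ℝ := (finestLevel α β s ε : ℝ) with hLdef
  push_cast
  rw [← hLdef]
  have hE : 0 < ε ^ (-2 : ℝ) := by positivity
  constructor
  · refine le_add_of_le_of_nonneg ?_ hsum0
    calc c ^ 3 * (ε ^ (-2 : ℝ) * |Real.log ε| ^ 3) = ε ^ (-2 : ℝ) * (c * |Real.log ε|) ^ 3 := by ring
      _ ≤ ε ^ (-2 : ℝ) * L ^ 3 := by gcongr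
      _ ≤ ε ^ (-2 : ℝ) * L ^ 2 * (L + 1) := by nlinarith [mul_pos hE (show 0 < L ^ 2 by positivity)]
  · have hL3 : 1 ≤ L ^ 3 := one_le_pow₀ hL1
    calc _ ≤ ε ^ (-2 : ℝ) * L ^ 2 * (L + L) + D * ε ^ (-2 : ℝ) * L ^ 3 := by
          gcongr
          exact hsum'.trans (le_mul_of_one_le_right (by positivity) hL3)
      _ = (2 + D) * ε ^ (-2 : ℝ) * L ^ 3 := by ring
      _ ≤ (2 + D) * ε ^ (-2 : ℝ) * (C * |Real.log ε|) ^ 3 := by gcongr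
      _ = _ := by ring

/-- In every regime `s` determines b = min(βs, 1) and the level rate, which selects one of the three
preceding estimates: b > s in the first regime, b = s in the second, and b < s in the last two. -/
theorem workload_bounds (hα : 0 < α) (hβ : 0 < β) (hs : s ∈ optimalS α β) :
    0 < s ∧ ∀ ε₀ : ℝ, 0 < ε₀ → ε₀ < 1 → ∃ c C : ℝ, 0 < c ∧ 0 < C ∧
      ∀ ε : ℝ, 0 < ε → ε ≤ ε₀ →
        c * costRate α β ε ≤ workload α β s ε ∧ workload α β s ε ≤ C * costRate α β ε := by
  have key : ∀ q : ℝ, (0 < s → min (β * s) 1 < s ∧ 1 + min (β * s) 1 ≤ 2 * levelRate α β s ∧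
      2 + (s - min (β * s) 1) / levelRate α β s = q) → 0 < s →
      (∀ ε, costRate α β ε = ε ^ (-q)) → ∀ ε₀ : ℝ, 0 < ε₀ → ε₀ < 1 → ∃ c C : ℝ, 0 < c ∧ 0 < C ∧
      ∀ ε : ℝ, 0 < ε → ε ≤ ε₀ →
        c * costRate α β ε ≤ workload α β s ε ∧ workload α β s ε ≤ C * costRate α β ε := by
    intro q h hs hcr ε₀ _ h1
    obtain ⟨hb, hq, rfl⟩ := h hs
    obtain ⟨C, hC, h⟩ := workload_bounds_of_gt (levelRate_pos hα hβ hs) hs hb hq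
    exact ⟨1, C, one_pos, hC, fun ε hε hle => by
      rw [hcr, one_mul]
      exact h ε hε (hle.trans h1.le)⟩
  rw [optimalS] at hs
  split_ifs at hs with c1 c2 c3
  · obtain ⟨s1, s2⟩ := hs
    have hs0 : 0 < s := (inv_pos.2 hα).trans_le s1
    have hαs : 1 ≤ α * s := by rwa [inv_le_iff_one_le_mul₀' hα] at s1
    have hb : s < min (β * s) 1 := lt_min (by nlinarith [c1.1]) s2
    -- Each of the three terms in the minimum is at least (1 + s)/2: the first by s < 1, the second
    -- by β > 1, the third by αs ≥ 1.
    have hq : 1 + s ≤ 2 * levelRate α β s := by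
      have : (1 + s) / 2 ≤ levelRate α β s :=
        le_min (by linarith) (le_min (by nlinarith [c1.1]) (by linarith))
      linarith
    refine ⟨hs0, fun ε₀ _ h1 => ?_⟩
    obtain ⟨C, hC, h⟩ := workload_bounds_of_lt (levelRate_pos hα hβ hs0) hs0 hb hq
    refine ⟨1, C, one_pos, hC, fun ε hε hle => ?_⟩
    rw [costRate, if_pos c1, one_mul]
    exact h ε hε (hle.trans h1.le)
  · obtain ⟨s1, s2⟩ := hs
    have hs0 : 0 < s := (inv_pos.2 hα).trans_le s1
    have hαs : 1 ≤ α * s := by rwa [inv_le_iff_one_le_mul₀' hα] at s1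
    have hβs : s ≤ β * s := by
      rcases c2 with c2 | c2
      · nlinarith [c2.1]
      · rw [c2.1, one_mul]
    have hb : min (β * s) 1 = s := by
      rcases c2 with ⟨c2, rfl⟩ | ⟨rfl, c2⟩
      · have : s = 1 := le_antisymm s2 (by simpa using hαs)
        rw [this] at hβs ⊢
        exact min_eq_right hβs
      · rw [one_mul]
        exact min_eq_left s2
    have hq : 1 + s ≤ 2 * levelRate α β s := by
      have : (1 + s) / 2 ≤ levelRate α β s :=
        le_min (by linarith) (le_min (by linarith) (by linarith))
      linarith
    refine ⟨hs0, fun ε₀ h0 h1 => ?_⟩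
    simp only [costRate, if_neg c1, if_pos c2]
    exact workload_bounds_of_eq (levelRate_pos hα hβ hs0) hs0 hb hq h0 h1
  · obtain rfl : s = α⁻¹ := hs
    have hs0 : 0 < α⁻¹ := inv_pos.2 hα
    have hα1 : α < 1 := by
      rcases c3 with c3 | c3
      · exact c3.2
      · exact c3.2.trans_lt c3.1
    have hαβ : α ≤ β := by
      rcases c3 with c3 | c3
      · linarith [c3.1]
      · exact c3.2
    refine ⟨hs0, key (1 + 1 / α) (fun _ => ?_) hs0 fun ε => by
      rw [costRate, if_neg c1, if_neg c2, if_pos c3]⟩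
    -- Here αs = 1 and βs ≥ 1, so `b` and the level rate are both `1` and the exponent is 2 + (s -
    -- 1) = 1 + 1/α.
    have h2 : 1 ≤ β * α⁻¹ := by
      rw [← div_eq_mul_inv]
      exact (one_le_div hα).2 hαβ
    have h3 : 1 < α⁻¹ := (one_lt_inv₀ hα).2 hα1
    have hr : levelRate α β α⁻¹ = 1 := by
      rw [levelRate, mul_inv_cancel₀ hα.ne']
      exact min_eq_left (le_min (by linarith) le_rfl)
    rw [min_eq_right h2, hr]
    refine ⟨h3, by norm_num, ?_⟩
    rw [one_div]
    ring
  · obtain rfl : s = (2 * α - β)⁻¹ := hs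
    have hβ1 : β < 1 := by
      by_contra h
      rw [not_lt] at h
      rcases h.eq_or_lt with rfl | h
      · rcases le_or_gt 1 α with h' | h'
        · exact c2 (Or.inr ⟨rfl, h'⟩)
        · exact c3 (Or.inl ⟨le_rfl, h'⟩)
      · rcases lt_trichotomy α 1 with h' | h' | h'
        · exact c3 (Or.inl ⟨h.le, h'⟩)
        · exact c2 (Or.inl ⟨h, h'⟩)
        · exact c1 ⟨h, h'⟩
    have hαβ : β < α := not_le.1 fun h => c3 (Or.inr ⟨hβ1, h⟩)
    have hpos : 0 < 2 * α - β := by linarith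
    have hs0 : 0 < (2 * α - β)⁻¹ := inv_pos.2 hpos
    refine ⟨hs0, key (2 + (1 - β) / α) (fun _ => ?_) hs0 fun ε => by
      rw [costRate, if_neg c1, if_neg c2, if_neg c3]⟩
    -- This `s` balances αs with (1 + βs)/2. The level rate is then αs < 1, with b = βs, and the
    -- exponent 2 + (s - b)/(αs) is 2 + (1 - β)/α.
    set s := (2 * α - β)⁻¹ with hsdef
    have hone : (2 * α - β) * s = 1 := mul_inv_cancel₀ hpos.ne'
    have hαs : α * s < 1 := by nlinarith
    have hβs : β * s < α * s := mul_lt_mul_of_pos_right hαβ hs0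
    have e : (1 + β * s) / 2 = α * s := by linarith
    have hr : levelRate α β s = α * s := by
      rw [levelRate, e, min_self]
      exact min_eq_right hαs.le
    rw [min_eq_left (by linarith), hr]
    refine ⟨by nlinarith, by linarith, ?_⟩
    have : s - β * s = (1 - β) * s := by ring
    rw [this, mul_div_mul_right _ _ hs0.ne']

end Workload

/-! ### Accumulated cost of the solver evaluations -/

section SolverCost

variable {d dO : ℕ} {𝓦 : Type*} [MeasurableSpace 𝓦] {Ω : Type*} [MeasurableSpace Ω]
  {M : FilterModel d dO 𝓦} {Pr : Measure Ω} [IsProbabilityMeasure Pr] {R : ReferenceNoise M Pr}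
  {Ω' : Type*} [MeasurableSpace Ω'] {Pr' : Measure Ω'} [IsProbabilityMeasure Pr']
  {α β s κ ε : ℝ} {Ms N P : ℕ → ℕ} {𝔽 : Set (Vec d → ℝ)}

theorem EnsembleInput.measurable_enkf (E : EnsembleInput M Pr') (N P n : ℕ) :
    ∀ i, Measurable[E.past n] fun ω => M.enkf N P (E.drivers ω) n i := by
  induction n with
  | zero => exact E.measurable_past_init 0
  | succ n ih =>
    have hv : ∀ i, Measurable[E.past (n + 1)] fun ω =>
        M.solver n N (M.enkf N P (E.drivers ω) n i) ((E.drivers ω).noise n i) := fun i =>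
      (M.measurable_solver n N).comp (((ih i).mono (E.past_mono n.le_succ) le_rfl).prodMk
        (E.measurable_past_noise n.lt_succ_self i))
    exact fun i => measurable_assimilate M (measurable_gain M (measurable_sampleCov hv P)) (hv i)
      ((E.measurable_past_obs (n + 1) (n + 1, i)).const_add _)

/-- The assumption is tested with constant states. The exceptional null set may depend on `x`, which
is enough for Fubini's theorem. -/
theorem Assumption1.exists_cost_le (h1 : Assumption1 R α 𝔽) (n : ℕ) : ∃ c : ℝ≥0, ∀ N : ℕ, 1 ≤ N →
    ∀ x, ∀ᵐ w ∂(M.noiseLaw n), M.cost n N x w ≤ c * N := by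
  obtain ⟨c, hc⟩ := h1.cost_le n
  refine ⟨c, fun N hN x => ?_⟩
  rw [← R.law_w n, ae_map_iff (R.measurable_w n).aemeasurable]
  · exact hc N hN (fun _ => x) fun p _ => R.memLpAt_const n p x
  · exact measurableSet_le ((M.measurable_cost n N).comp measurable_prodMk_left) measurable_const

/-- The particles do not depend on the driving noise of the next step, so that the almost sure
bound on the cost of an evaluation applies to them. -/
theorem EnsembleInput.ae_cost_le (E : EnsembleInput M Pr') {n N : ℕ} {c : ℝ≥0}
    (hc : ∀ x, ∀ᵐ w ∂(M.noiseLaw n), M.cost n N x w ≤ c * N) (P i : ℕ) :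
    ∀ᵐ ω ∂Pr', M.cost n N (M.enkf N P (E.drivers ω) n i) ((E.drivers ω).noise n i) ≤ c * N := by
  have hV : Measurable fun ω => M.enkf N P (E.drivers ω) n i :=
    (E.measurable_enkf N P n i).mono (E.past_le n) le_rfl
  have hW := E.measurable_noise (n, i)
  have hset : MeasurableSet {q : Vec d × 𝓦 | M.cost n N q.1 q.2 ≤ c * N} :=
    measurableSet_le (M.measurable_cost n N) measurable_const
  have hmap := (E.indepFun_noise i (E.measurable_enkf N P n i)).map_prod_eq_prod_map_map
    hV.aemeasurable hW.aemeasurable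
  rw [E.law_noise] at hmap
  have : IsProbabilityMeasure (M.noiseLaw n) := by
    rw [← E.law_noise (n, i)]
    exact Measure.isProbabilityMeasure_map hW.aemeasurable
  refine (ae_map_iff (hV.prodMk hW).aemeasurable hset).1 ?_
  rw [hmap]
  exact (Measure.ae_prod_iff_ae_ae hset).2 (ae_of_all _ hc)

theorem EnsembleInput.ae_enkfSolverCost_le (E : EnsembleInput M Pr') {N : ℕ} {c : ℕ → ℝ≥0}
    (hc : ∀ n x, ∀ᵐ w ∂(M.noiseLaw n), M.cost n N x w ≤ c n * N) (P n : ℕ) :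
    ∀ᵐ ω ∂Pr', M.enkfSolverCost N P (E.drivers ω) n ≤ (∑ k ∈ Finset.range n, c k) * (N * P) := by
  have h : ∀ᵐ ω ∂Pr', ∀ k i, M.cost k N (M.enkf N P (E.drivers ω) k i) ((E.drivers ω).noise k i)
      ≤ c k * N := ae_all_iff.2 fun k => ae_all_iff.2 fun i => E.ae_cost_le (hc k) P i
  filter_upwards [h] with ω hω
  rw [FilterModel.enkfSolverCost, Finset.sum_mul]
  refine Finset.sum_le_sum fun k _ => (Finset.sum_le_card_nsmul _ _ _ fun i _ => hω k i).trans ?_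
  rw [Finset.card_range, nsmul_eq_mul]
  exact le_of_eq (by ring)

/-- The two coarse ensembles of level `l + 1` cost about `2 * N l * P l = N l * P (l + 1)`. This is
at most `κ ^ 2` times `N (l + 1) * P (l + 1)`, since resolutions are comparable to an increasing
sequence. The coarse parts thus cost at most a constant multiple of the fine ones. -/
theorem solverCost_le (h1 : Assumption1 R α 𝔽) (S : EnsembleNoise M Pr') (hs : 0 < s) (hκ : 0 < κ)
    (n : ℕ) : ∃ C : ℝ, 0 < C ∧ ∀ ε : ℝ, 0 < ε → ∀ Ms N P : ℕ → ℕ,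
      IsConfiguration α β s κ ε Ms N P → ∀ᵐ ω ∂Pr',
        (S.solverCost (finestLevel α β s ε) Ms N P n ω : ℝ)
          ≤ C * mlCost (finestLevel α β s ε) Ms N P := by
  choose c hc using h1.exists_cost_le
  set G : ℝ := ((∑ k ∈ Finset.range n, c k : ℝ≥0) : ℝ) with hG
  have hG0 : 0 ≤ G := NNReal.coe_nonneg _
  -- `1` stands for the fine and `κ ^ 2` for the coarse ensembles; the last `+ 1` only secures
  -- positivity when `G = 0`.
  refine ⟨G * (1 + κ ^ 2) + 1, by positivity, fun ε hε Ms N P h => ?_⟩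
  have hN : ∀ l, 1 ≤ N l := fun l => nat_pos_of_le_mul (by positivity) (h.resolution l).2
  have hcost : ∀ᵐ ω ∂Pr', ∀ l m q k, M.enkfSolverCost (N k) (P k) ((S.input l m q).drivers ω) n
      ≤ (∑ k ∈ Finset.range n, c k) * (N k * P k) :=
    ae_all_iff.2 fun l => ae_all_iff.2 fun m => ae_all_iff.2 fun q => ae_all_iff.2 fun k =>
      (S.input l m q).ae_enkfSolverCost_le (fun n x => hc n (N k) (hN k) x) (P k) n
  have hNN : ∀ l, (N l : ℝ) ≤ κ ^ 2 * N (l + 1) := fun l => by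
    calc (N l : ℝ) ≤ κ * (2 : ℝ) ^ (s * l) := (h.resolution l).1
      _ ≤ κ * (2 : ℝ) ^ (s * (l + 1 : ℕ)) := by
          gcongr
          · norm_num
          · exact l.le_succ
      _ ≤ κ * (κ * N (l + 1)) := by
          gcongr
          exact (h.resolution (l + 1)).2
      _ = _ := by ring
  filter_upwards [hcost] with ω hω
  have hω' : ∀ l m q k, (M.enkfSolverCost (N k) (P k) ((S.input l m q).drivers ω) n : ℝ)
      ≤ G * (N k * P k) := fun l m q k => by exact_mod_cast hω l m q k
  have hlevel : ∀ l m, (M.levelSolverCost N P (S.drivers l m ω) n l : ℝ)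
      ≤ (G * (1 + κ ^ 2) + 1) * (N l * P l) := fun l m => by
    have hNP : ∀ l, (0 : ℝ) ≤ N l * P l := fun l => by positivity
    rcases l with _ | l
    · refine (hω' 0 m 0 0).trans (mul_le_mul_of_nonneg_right ?_ (hNP 0))
      nlinarith [mul_nonneg hG0 (sq_nonneg κ)]
    · have a1 := hω' (l + 1) m 0 (l + 1)
      have a2 := hω' (l + 1) m 0 l
      have a3 := hω' (l + 1) m (P l) l
      have e : (M.levelSolverCost N P (S.drivers (l + 1) m ω) n (l + 1) : ℝ)
          = M.enkfSolverCost (N (l + 1)) (P (l + 1)) ((S.input (l + 1) m 0).drivers ω) n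
            + (M.enkfSolverCost (N l) (P l) ((S.input (l + 1) m 0).drivers ω) n
              + M.enkfSolverCost (N l) (P l) ((S.input (l + 1) m (P l)).drivers ω) n) := by
        rw [FilterModel.levelSolverCost]
        push_cast
        rfl
      have hP : (P (l + 1) : ℝ) = 2 * P l := by exact_mod_cast h.double l
      have h2 : (N l * P l + N l * P l : ℝ) ≤ κ ^ 2 * (N (l + 1) * P (l + 1)) := by
        calc (N l * P l + N l * P l : ℝ) = N l * P (l + 1) := by rw [hP]; ring
          _ ≤ κ ^ 2 * N (l + 1) * P (l + 1) := by
              gcongr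
              exact hNN l
          _ = _ := by ring
      rw [e]
      nlinarith [mul_le_mul_of_nonneg_left h2 hG0, hNP (l + 1)]
  rw [EnsembleNoise.solverCost, mlCost, Finset.mul_sum]
  push_cast
  refine Finset.sum_le_sum fun l _ => (Finset.sum_le_card_nsmul _ _ _ fun m _ => hlevel l m).trans ?_
  rw [Finset.card_range, nsmul_eq_mul]
  exact le_of_eq (by ring)

end SolverCost

end MLEnKF

theorem corollary2 {d dO : ℕ} {𝓦 : Type*} [MeasurableSpace 𝓦]
    {Ω : Type*} [MeasurableSpace Ω] (Pr : Measure Ω) [IsProbabilityMeasure Pr]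
    {Ω' : Type*} [MeasurableSpace Ω'] (Pr' : Measure Ω') [IsProbabilityMeasure Pr']
    (M : FilterModel d dO 𝓦) (R : ReferenceNoise M Pr) (S : EnsembleNoise M Pr')
    (α β : ℝ) (𝔽 : Set (Vec d → ℝ))
    (h1 : Assumption1 R α 𝔽) (h2 : Assumption2 R β) :
    -- accuracy
    (∀ s : ℝ, 0 < s → ∀ κ : ℝ, 0 < κ → ∀ φ ∈ 𝔽, ∀ (n : ℕ) (p : ℝ), 2 ≤ p →
      Integrable φ (M.mfMeasure n) ∧
      ∃ C : ℝ, 0 < C ∧ ∀ ε : ℝ, 0 < ε → ∀ Ms N P : ℕ → ℕ, IsConfiguration α β s κ ε Ms N P →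
        eLpNorm (fun ω => S.mlenkf (finestLevel α β s ε) Ms N P n φ ω
            - ∫ x, φ x ∂(M.mfMeasure n)) (ENNReal.ofReal p) Pr' ≤ ENNReal.ofReal (C * ε)) ∧
    -- cost, as `ε → 0`
    (∀ s ∈ optimalS α β, 0 < s ∧ ∀ κ : ℝ, 0 < κ → ∀ ε₀ : ℝ, 0 < ε₀ → ε₀ < 1 →
      (∃ c C : ℝ, 0 < c ∧ 0 < C ∧ ∀ ε : ℝ, 0 < ε → ε ≤ ε₀ →
        ∀ Ms N P : ℕ → ℕ, IsConfiguration α β s κ ε Ms N P →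
          c * costRate α β ε ≤ mlCost (finestLevel α β s ε) Ms N P ∧
          mlCost (finestLevel α β s ε) Ms N P ≤ C * costRate α β ε) ∧
      (∀ n : ℕ, ∃ C : ℝ, 0 < C ∧ ∀ ε : ℝ, 0 < ε → ε ≤ ε₀ →
        ∀ Ms N P : ℕ → ℕ, IsConfiguration α β s κ ε Ms N P →
          ∀ᵐ ω ∂Pr', (S.solverCost (finestLevel α β s ε) Ms N P n ω : ℝ)
            ≤ C * costRate α β ε)) := by
  refine ⟨fun s hs κ hκ φ hφ n p hp => ⟨(mean_field_accuracy h1 h2 n hφ).1,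
    mlenkf_accuracy h1 h2 S hs hκ hφ n hp⟩, fun s hs => ?_⟩
  obtain ⟨hs0, hw⟩ := workload_bounds h1.alpha_pos h2.beta_pos hs
  refine ⟨hs0, fun κ hκ ε₀ h0 hlt => ?_⟩
  obtain ⟨c, C, hc, hC, hcC⟩ := hw ε₀ h0 hlt
  have hκ3 : 0 < κ ^ 3 := by positivity
  have hupper : ∀ ε : ℝ, 0 < ε → ε ≤ ε₀ → ∀ Ms N P : ℕ → ℕ, IsConfiguration α β s κ ε Ms N P →
      mlCost (finestLevel α β s ε) Ms N P ≤ κ ^ 3 * C * costRate α β ε :=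
    fun ε hε hle Ms N P h => (mlCost_le_workload hκ h).trans <| by
      rw [mul_assoc]
      exact mul_le_mul_of_nonneg_left (hcC ε hε hle).2 hκ3.le
  refine ⟨⟨c / κ ^ 3, κ ^ 3 * C, by positivity, by positivity, fun ε hε hle Ms N P h =>
    ⟨?_, hupper ε hε hle Ms N P h⟩⟩, fun n => ?_⟩
  · rw [div_mul_eq_mul_div, div_le_iff₀' hκ3]
    exact (hcC ε hε hle).1.trans (workload_le_mlCost hκ h)
  · obtain ⟨D, hD, hsolve⟩ := solverCost_le h1 S hs0 hκ n (β := β) (s := s)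
    refine ⟨D * (κ ^ 3 * C), by positivity, fun ε hε hle Ms N P h => ?_⟩
    filter_upwards [hsolve ε hε Ms N P h] with ω hω
    refine hω.trans ?_
    rw [mul_assoc]
    exact mul_le_mul_of_nonneg_left (hupper ε hε hle Ms N P h) hD.le
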